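/- Let $(\mathcal V,\otimes,I)$ be a cocomplete monoidal category whose tensor product preserves colimits in each variable, and assume that $\mathcal V$ is enriched over abelian groups (preadditive) and has kernels. Let $\Delta_f$ be the category of finite intervals: its objects are the posets $[n]=\{0,\dots,n\}$, $n\ge 0$, and its morphisms $[m]\to[n]$ are the order morphisms $f$ with $f(0)=0$ and $f(m)=n$. It is monoidal with $[m]+[n]=[m+n]$ (the top of $[m]$ is identified with the bottom of $[n]$) and unit $[0]$. Let $\mathrm{Frob}_{su}(\Delta_f^{op},\mathcal V)$ be the category whose objects are the strongly unital Frobenius monoidal functors $X:\Delta_f^{op}\to\mathcal V$, that is, functors with a colax monoidal structure $(\mu,\epsilon)$ and a lax monoidal structure $(Z,\eta)$ such that $\epsilon$ and $\eta$ are mutually inverse and, for all $A,B,C$ (suppressing associators), $$(\mathrm{id}\otimes Z_{B,C})(\mu_{A,B}\otimes\mathrm{id})=\mu_{A,B\otimes C}\,Z_{A\otimes B,C},\qquad (Z_{A,B}\otimes\mathrm{id})(\mathrm{id}\otimes\mu_{B,C})=\mu_{A\otimes B,C}\,Z_{A,B\otimes C};$$ its morphisms are the natural transformations that are monoidal for both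 structures. Write $X_n=X([n])$. Let $S_+\mathcal V=\mathrm{Fun}(\Delta_+^{op},\mathcal V)$ be the category of augmented simplicial objects of $\mathcal V$, with the Day convolution (join) tensor product $(A\otimes B)_n=\bigoplus_{k+l+1=n}A_k\otimes B_l$ ($n,k,l\ge -1$) for the juxtaposition $[m]\star[n]=[m+n+1]$ on $\Delta_+$, and let $\mathrm{Mon}(S_+\mathcal V)$ be its category of monoids. Then there is an adjoint equivalence of categories $$\mathrm{Frob}_{su}(\Delta_f^{op},\mathcal V)\;\simeq\;\mathrm{Mon}(S_+\mathcal V).$$ More precisely, it can be chosen such that the functor from left to right sends $X$ to the monoid $K(X)$ given, for $n\ge -1$, by the joint kernel $$K(X)_n=\bigcap_{k,l\ge 1,\;k+l=n+2}\ker\bigl(\mu_{k,l}:X_{n+2}\to X_k\otimes X_l\bigr)$$ (so that $K(X)_{-1}=X_1$), with the simplicial structure induced from $X$ along $[0]\star-\star[0]:\Delta_+\to\Delta_f$, $[n]\mapsto[n+2]$, with the multiplication induced by the morphisms $d_p Z^{p,q}:X_p\otimes X_q\to X_{p+q-1}$ ($p,q\ge 1$, $d_p$ the inner face map $X(\delta_p)$),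 and with the unit induced by $s_0\epsilon^{-1}:I\to X_1$; and sends a morphism $\alpha$ to the morphism induced by $\alpha$ on these kernels. -/

import Mathlib

open CategoryTheory MonoidalCategory Limits Opposite
open scoped MonoidalCategory.DayFunctor

universe v u v₁ u₁

/-! ### The category of finite intervals -/

/-- The category of finite intervals. Its objects are the posets `[n] = {0, ..., n}` for `n ≥ 0`,
and its morphisms are the order morphisms that preserve both endpoints. -/
structure FiniteInterval : Type where
  /-- the natural number `n` of the object `[n]` -/
  len : ℕ

namespace FiniteInterval

/-- An order morphism `[m] ⟶ [n]` that sends `0` to `0` and `m` to `n`. -/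
@[ext]
structure Hom (m n : FiniteInterval) : Type where
  /-- the underlying order morphism -/
  toOrderHom : Fin (m.len + 1) →o Fin (n.len + 1)
  map_zero : toOrderHom 0 = 0
  map_last : toOrderHom (Fin.last m.len) = Fin.last n.len

instance : Category FiniteInterval where
  Hom := Hom
  id m := ⟨OrderHom.id, rfl, rfl⟩
  comp f g := ⟨g.toOrderHom.comp f.toOrderHom,
    by simp [f.map_zero, g.map_zero], by simp [f.map_last, g.map_last]⟩

theorem hom_ext {m n : FiniteInterval} {f g : m ⟶ n}
    (h : ∀ i, (f.toOrderHom i : ℕ) = g.toOrderHom i) : f = g :=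
  Hom.ext (OrderHom.ext _ _ (funext fun i => Fin.ext (h i)))

@[simp] theorem id_apply (m : FiniteInterval) (i : Fin (m.len + 1)) :
    (𝟙 m : m ⟶ m).toOrderHom i = i := rfl

@[simp] theorem comp_apply {m n p : FiniteInterval} (f : m ⟶ n) (g : n ⟶ p)
    (i : Fin (m.len + 1)) : (f ≫ g).toOrderHom i = g.toOrderHom (f.toOrderHom i) := rfl

/-- A morphism given by a function on natural numbers. -/
def mkHom {m n : FiniteInterval} (f : ℕ → ℕ) (hf : ∀ i j, i ≤ j → j ≤ m.len → f i ≤ f j)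
    (h0 : f 0 = 0) (h1 : f m.len = n.len) : m ⟶ n where
  toOrderHom :=
    { toFun := fun i => ⟨f i, by
        have := hf i m.len (Nat.lt_succ_iff.1 i.2) le_rfl
        omega⟩
      monotone' := fun i j hij => hf i j hij (Nat.lt_succ_iff.1 j.2) }
  map_zero := Fin.ext h0
  map_last := Fin.ext h1

@[simp] theorem mkHom_apply {m n : FiniteInterval} (f : ℕ → ℕ) (hf h0 h1)
    (i : Fin (m.len + 1)) :
    ((mkHom (m := m) (n := n) f hf h0 h1).toOrderHom i : ℕ) = f i := rfl

/-- The value at a natural number `i ≤ m` of a morphism `[m] ⟶ [n]` (and `n` for `i > m`). -/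
def Hom.val {m n : FiniteInterval} (f : m ⟶ n) (i : ℕ) : ℕ :=
  if h : i < m.len + 1 then f.toOrderHom ⟨i, h⟩ else n.len

theorem toOrderHom_eq_val {m n : FiniteInterval} (f : m ⟶ n) (i : Fin (m.len + 1)) :
    (f.toOrderHom i : ℕ) = Hom.val f i := by
  unfold Hom.val
  rw [dif_pos i.2]

theorem val_zero {m n : FiniteInterval} (f : m ⟶ n) : Hom.val f 0 = 0 := by
  have := congrArg Fin.val f.map_zero
  rw [toOrderHom_eq_val] at this
  exact this

theorem val_len {m n : FiniteInterval} (f : m ⟶ n) : Hom.val f m.len = n.len := by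
  have := congrArg Fin.val f.map_last
  rw [toOrderHom_eq_val] at this
  exact this

theorem val_le {m n : FiniteInterval} (f : m ⟶ n) (i : ℕ) : Hom.val f i ≤ n.len := by
  unfold Hom.val
  split
  · exact Nat.lt_succ_iff.1 (f.toOrderHom _).2
  · exact le_rfl

theorem val_mono {m n : FiniteInterval} (f : m ⟶ n) {i j : ℕ} (h : i ≤ j) :
    Hom.val f i ≤ Hom.val f j := by
  by_cases hj : j < m.len + 1
  · have hi : i < m.len + 1 := by omega
    simp only [Hom.val, hi, hj, dif_pos]
    exact f.toOrderHom.monotone (show (⟨i, hi⟩ : Fin (m.len + 1)) ≤ ⟨j, hj⟩ from h)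
  · have : Hom.val f j = n.len := by simp [Hom.val, hj]
    rw [this]
    exact val_le f i

theorem val_of_len_le {m n : FiniteInterval} (f : m ⟶ n) {i : ℕ} (h : m.len ≤ i) :
    Hom.val f i = n.len :=
  le_antisymm (val_le f i) ((val_len f).symm.le.trans (val_mono f h))

theorem val_id (m : FiniteInterval) (i : ℕ) : Hom.val (𝟙 m) i = min i m.len := by
  by_cases h : i < m.len + 1
  · simp only [Hom.val, h, dif_pos, id_apply]
    omega
  · rw [val_of_len_le _ (by omega)]
    omega

theorem val_comp {m n p : FiniteInterval} (f : m ⟶ n) (g : n ⟶ p) (i : ℕ) :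
    Hom.val (f ≫ g) i = Hom.val g (Hom.val f i) := by
  by_cases h : i < m.len + 1
  · rw [← toOrderHom_eq_val (f ≫ g) ⟨i, h⟩, ← toOrderHom_eq_val f ⟨i, h⟩, comp_apply,
      toOrderHom_eq_val]
  · rw [val_of_len_le (f ≫ g) (by omega), val_of_len_le f (by omega), val_len]

theorem val_mkHom {m n : FiniteInterval} (f : ℕ → ℕ) (hf h0 h1) {i : ℕ} (h : i ≤ m.len) :
    Hom.val (mkHom (m := m) (n := n) f hf h0 h1) i = f i := by
  have : i < m.len + 1 := by omega
  rw [← toOrderHom_eq_val _ ⟨i, this⟩, mkHom_apply]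

theorem hom_ext_val {m n : FiniteInterval} {f g : m ⟶ n}
    (h : ∀ i ≤ m.len, Hom.val f i = Hom.val g i) : f = g :=
  hom_ext fun i => by
    rw [toOrderHom_eq_val, toOrderHom_eq_val]
    exact h i (Nat.lt_succ_iff.1 i.2)

/-- The isomorphism `[m] ≅ [n]` for `m = n`, given by the identity function. -/
def isoOfEq {m n : FiniteInterval} (h : m.len = n.len) : m ≅ n where
  hom := mkHom id (fun _ _ hij _ => hij) rfl h
  inv := mkHom id (fun _ _ hij _ => hij) rfl h.symm
  hom_inv_id := hom_ext fun _ => rfl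
  inv_hom_id := hom_ext fun _ => rfl

theorem val_isoOfEq_hom {m n : FiniteInterval} (h : m.len = n.len) (i : ℕ) :
    Hom.val (isoOfEq h).hom i = min i m.len := by
  by_cases hi : i ≤ m.len
  · refine (val_mkHom (m := m) (n := n) id (fun _ _ hij _ => hij) rfl h hi).trans ?_
    exact (min_eq_left hi).symm
  · rw [val_of_len_le _ (by omega)]
    omega

/-- The morphism `f + g : [m + n] ⟶ [m' + n']` which is `f i` for `i ≤ m` and
`m' + g (i - m)` for `i ≥ m`. -/
def add {m n m' n' : FiniteInterval} (f : m ⟶ m') (g : n ⟶ n') :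
    (⟨m.len + n.len⟩ : FiniteInterval) ⟶ ⟨m'.len + n'.len⟩ :=
  mkHom (fun i => if i ≤ m.len then Hom.val f i else m'.len + Hom.val g (i - m.len))
    (fun i j hij _ => by
      split_ifs with h1 h2
      · exact val_mono f hij
      · exact (val_le f i).trans (Nat.le_add_right _ _)
      · omega
      · exact Nat.add_le_add_left (val_mono g (by omega)) _)
    (by simp [val_zero])
    (by
      dsimp only
      split_ifs with h
      · have hn : n.len = 0 := by omega
        have h1 := val_zero g
        have h2 := val_len g
        rw [hn] at h2
        rw [hn, Nat.add_zero, val_len f]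
        omega
      · rw [Nat.add_sub_cancel_left, val_len g])

theorem val_add {m n m' n' : FiniteInterval} (f : m ⟶ m') (g : n ⟶ n') (i : ℕ) :
    Hom.val (add f g) i = if i ≤ m.len then Hom.val f i else m'.len + Hom.val g (i - m.len) := by
  by_cases h : i ≤ m.len + n.len
  · exact val_mkHom _ _ _ _ h
  · rw [val_of_len_le (add f g) (Nat.le_of_not_le h), if_neg (by omega),
      val_of_len_le g (by omega)]

/-- The monoidal structure `([m], [n]) ↦ [m + n]` which identifies the top endpoint of `[m]` with
the bottom endpoint of `[n]`. Its unit is `[0]`. -/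
instance : MonoidalCategoryStruct FiniteInterval where
  tensorObj m n := ⟨m.len + n.len⟩
  tensorHom f g := add f g
  whiskerLeft m _ _ f := add (𝟙 m) f
  whiskerRight f n := add f (𝟙 n)
  tensorUnit := ⟨0⟩
  associator _ _ _ := isoOfEq (Nat.add_assoc _ _ _)
  leftUnitor _ := isoOfEq (Nat.zero_add _)
  rightUnitor _ := isoOfEq (Nat.add_zero _)

theorem tensorObj_len (m n : FiniteInterval) : (m ⊗ n).len = m.len + n.len := rfl

theorem tensorUnit_len : (𝟙_ FiniteInterval).len = 0 := rfl

theorem val_tensorHom {m n m' n' : FiniteInterval} (f : m ⟶ m') (g : n ⟶ n') (i : ℕ) :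
    Hom.val (f ⊗ₘ g) i = if i ≤ m.len then Hom.val f i else m'.len + Hom.val g (i - m.len) :=
  val_add f g i

theorem val_associator_hom (m n p : FiniteInterval) (i : ℕ) :
    Hom.val (α_ m n p).hom i = min i (m.len + n.len + p.len) :=
  val_isoOfEq_hom _ i

theorem val_leftUnitor_hom (m : FiniteInterval) (i : ℕ) :
    Hom.val (λ_ m).hom i = min i m.len :=
  (val_isoOfEq_hom _ i).trans (by rw [tensorObj_len, tensorUnit_len, Nat.zero_add])

theorem val_rightUnitor_hom (m : FiniteInterval) (i : ℕ) :
    Hom.val (ρ_ m).hom i = min i m.len :=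
  (val_isoOfEq_hom _ i).trans (by rw [tensorObj_len, tensorUnit_len, Nat.add_zero])

instance : MonoidalCategory FiniteInterval :=
  MonoidalCategory.ofTensorHom
    (id_tensorHom_id := fun m n => hom_ext_val fun i hi => by
      rw [tensorObj_len] at hi
      simp only [val_tensorHom, val_id, tensorObj_len]
      split_ifs <;> omega)
    (id_tensorHom := fun _ _ _ _ => rfl)
    (tensorHom_id := fun _ _ => rfl)
    (tensorHom_comp_tensorHom := fun {m₁ n₁ p₁ m₂ n₂ p₂} f₁ f₂ g₁ g₂ => hom_ext_val fun i hi => by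
      simp only [val_tensorHom, val_comp]
      by_cases h : i ≤ m₁.len
      · rw [if_pos h, if_pos h, if_pos (val_le f₁ i)]
      · rw [if_neg h, if_neg h, Nat.add_sub_cancel_left]
        split_ifs with h'
        · have : Hom.val f₂ (i - m₁.len) = 0 := by omega
          rw [this, val_zero, Nat.add_zero, Nat.add_zero, val_len]
        · rfl)
    (associator_naturality := fun {m₁ m₂ m₃ n₁ n₂ n₃} f₁ f₂ f₃ => hom_ext_val fun i hi => by
      have h₁ := val_le f₁ i
      have h₂ := val_le f₂ (i - m₁.len)
      have h₃ := val_le f₃ (i - m₁.len - m₂.len)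
      simp only [tensorObj_len] at hi
      simp only [val_comp, val_associator_hom, val_tensorHom, tensorObj_len, min_eq_left hi,
        ← Nat.sub_sub]
      split_ifs <;> omega)
    (leftUnitor_naturality := fun {m n} f => hom_ext_val fun i hi => by
      rw [tensorObj_len, tensorUnit_len, Nat.zero_add] at hi
      have h := val_le f i
      simp only [val_comp, val_leftUnitor_hom, val_tensorHom, tensorUnit_len, val_id,
        min_eq_left hi, Nat.sub_zero, Nat.zero_add]
      split_ifs with h0
      · rw [Nat.le_zero.1 h0, val_zero]
        simp
      · omega)
    (rightUnitor_naturality := fun {m n} f => hom_ext_val fun i hi => by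
      rw [tensorObj_len, tensorUnit_len, Nat.add_zero] at hi
      have h := val_le f i
      simp only [val_comp, val_rightUnitor_hom, val_tensorHom, min_eq_left hi, if_pos hi]
      omega)
    (pentagon := fun m n p q => hom_ext_val fun i hi => by
      simp only [tensorObj_len] at hi
      simp only [val_comp, val_associator_hom, val_tensorHom, val_id, tensorObj_len]
      split_ifs <;> omega)
    (triangle := fun m n => hom_ext_val fun i hi => by
      simp only [tensorObj_len, tensorUnit_len] at hi
      simp only [val_comp, val_associator_hom, val_tensorHom, val_id, tensorObj_len,
        val_leftUnitor_hom, val_rightUnitor_hom, tensorUnit_len]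
      split_ifs <;> omega)

/-- The unique morphism `[n] ⟶ [0]`. For `n = 1` this is the codegeneracy `σ₀`. -/
def toUnit (n : FiniteInterval) : n ⟶ 𝟙_ FiniteInterval :=
  mkHom (fun _ => 0) (fun _ _ _ _ => le_rfl) rfl rfl

/-- The inner coface map `δ_p : [n] ⟶ [n + 1]`, for `0 < p ≤ n`: the injective morphism whose
image omits `p`. -/
def coface {m n : FiniteInterval} (p : ℕ) (h : n.len = m.len + 1) (h0 : 0 < p) (h1 : p ≤ m.len) :
    m ⟶ n :=
  mkHom (fun i => if i < p then i else i + 1)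
    (fun i j hij _ => by split_ifs <;> omega) (by simp [h0]) (by
      rw [if_neg (by omega), h])

/-- The morphism `[m + 2] ⟶ [n + 2]` with `0 ↦ 0`, `i + 1 ↦ f i + 1` for `0 ≤ i ≤ m` and
`m + 2 ↦ n + 2`, for an order morphism `f : [m] ⟶ [n]`; that is, `[0] ⋆ f ⋆ [0]`. -/
def addEndpoints {m n : SimplexCategory} (f : m ⟶ n) :
    (⟨m.len + 2⟩ : FiniteInterval) ⟶ ⟨n.len + 2⟩ :=
  mkHom
    (fun i => if i = 0 then 0 else
      if h : i - 1 < m.len + 1 then (f.toOrderHom ⟨i - 1, h⟩ : ℕ) + 1 else n.len + 2)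
    (fun i j hij _ => by
      split_ifs with h1 h2 h3 h4 h5 h6 h7
      all_goals first
        | omega
        | exact Nat.succ_le_succ (f.toOrderHom.monotone
            (Fin.mk_le_mk.2 (Nat.sub_le_sub_right hij 1))))
    rfl (by simp)

theorem val_addEndpoints_zero {m n : SimplexCategory} (f : m ⟶ n) :
    Hom.val (addEndpoints f) 0 = 0 :=
  val_zero _

theorem val_addEndpoints_succ {m n : SimplexCategory} (f : m ⟶ n) (i : Fin (m.len + 1)) :
    Hom.val (addEndpoints f) (i + 1) = (f.toOrderHom i : ℕ) + 1 := by
  have hi := i.2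
  refine (val_mkHom _ _ _ _ (show (i : ℕ) + 1 ≤ m.len + 2 by omega)).trans ?_
  rw [if_neg (Nat.succ_ne_zero _), dif_pos (show (i : ℕ) + 1 - 1 < m.len + 1 from hi)]
  rfl

theorem val_addEndpoints_last {m n : SimplexCategory} (f : m ⟶ n) :
    Hom.val (addEndpoints f) (m.len + 2) = n.len + 2 :=
  val_len (addEndpoints f)

theorem addEndpoints_hom_ext {m : SimplexCategory} {n : FiniteInterval}
    {f g : (⟨m.len + 2⟩ : FiniteInterval) ⟶ n}
    (h : ∀ i : Fin (m.len + 1), Hom.val f (i + 1) = Hom.val g (i + 1)) : f = g :=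
  hom_ext_val fun i hi => by
    rcases Nat.eq_zero_or_pos i with rfl | h0
    · rw [val_zero, val_zero]
    · rcases Nat.lt_or_ge i (m.len + 2) with h1 | h1
      · have := h ⟨i - 1, by omega⟩
        rwa [Nat.sub_add_cancel h0] at this
      · rw [val_of_len_le f h1, val_of_len_le g h1]

/-- The functor `[n] ↦ [0] ⋆ [n] ⋆ [0] = [n + 2]` on nonempty simplices. -/
def narrowSimplex : SimplexCategory ⥤ FiniteInterval where
  obj n := ⟨n.len + 2⟩
  map f := addEndpoints f
  map_id n := addEndpoints_hom_ext fun i => by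
    have hi := i.2
    rw [val_addEndpoints_succ, val_id]
    exact (min_eq_left (show (i : ℕ) + 1 ≤ n.len + 2 by omega)).symm
  map_comp f g := addEndpoints_hom_ext fun i => by
    rw [val_comp, val_addEndpoints_succ, val_addEndpoints_succ, val_addEndpoints_succ]
    rfl

/-- The functor `[0] ⋆ - ⋆ [0]` from the augmented simplex category to finite intervals. It sends
`[n]` to `[n + 2]` for every `n ≥ -1`. -/
def narrow : AugmentedSimplexCategory ⥤ FiniteInterval :=
  WithInitial.lift narrowSimplex
    (fun n => (mkHom (fun i => if i = 0 then 0 else n.len + 2)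
      (fun i j hij _ => by split_ifs <;> omega) rfl rfl :
        (⟨1⟩ : FiniteInterval) ⟶ ⟨n.len + 2⟩))
    (fun n p f => hom_ext_val fun i hi => by
      obtain rfl | rfl : i = 0 ∨ i = 1 := by
        have : i ≤ 1 := hi
        omega
      · exact (val_zero _).trans (val_zero _).symm
      · exact (val_of_len_le _ le_rfl).trans (val_of_len_le _ le_rfl).symm)

theorem narrow_len_pos (x : AugmentedSimplexCategory) : 0 < (narrow.obj x).len := by
  cases x
  · exact Nat.succ_pos _
  · exact Nat.one_pos

/-- If `[0] ⋆ x ⋆ [0] = [p]` and `[0] ⋆ y ⋆ [0] = [q]`, then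
`[0] ⋆ (x ⋆ y) ⋆ [0] = [p + q - 1]`. -/
theorem narrow_tensor_len (x y : AugmentedSimplexCategory) :
    (narrow.obj x ⊗ narrow.obj y).len = (narrow.obj (x ⊗ y)).len + 1 := by
  cases x with
  | of x =>
    cases y with
    | of y => exact (by omega : (x.len + 2) + (y.len + 2) = (x.len + y.len + 1 + 2) + 1)
    | star => rfl
  | star =>
    cases y with
    | of y => exact (by omega : 1 + (y.len + 2) = (y.len + 2) + 1)
    | star => rfl

theorem narrow_len_le (x y : AugmentedSimplexCategory) :
    (narrow.obj x).len ≤ (narrow.obj (x ⊗ y)).len := by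
  have h := narrow_tensor_len x y
  have h' := narrow_len_pos y
  rw [tensorObj_len] at h
  omega

end FiniteInterval

/-! ### Frobenius monoidal functors -/

/-- A strongly unital Frobenius monoidal functor `U ⥤ V`: a functor with a lax and a colax monoidal
structure such that the two Frobenius squares commute and such that the unit and the counit are
inverse to each other. -/
structure FrobeniusFunctor (U : Type u₁) [Category.{v₁} U] [MonoidalCategory U]
    (V : Type u) [Category.{v} V] [MonoidalCategory V] where
  /-- the underlying functor -/
  functor : U ⥤ V
  [colax : functor.OplaxMonoidal]
  [lax : functor.LaxMonoidal]
  frobenius_left : ∀ A B C : U,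
    Functor.OplaxMonoidal.δ functor A B ▷ functor.obj C ≫
        (α_ (functor.obj A) (functor.obj B) (functor.obj C)).hom ≫
          functor.obj A ◁ Functor.LaxMonoidal.μ functor B C =
      Functor.LaxMonoidal.μ functor (A ⊗ B) C ≫ functor.map (α_ A B C).hom ≫
        Functor.OplaxMonoidal.δ functor A (B ⊗ C)
  frobenius_right : ∀ A B C : U,
    functor.obj A ◁ Functor.OplaxMonoidal.δ functor B C ≫
        (α_ (functor.obj A) (functor.obj B) (functor.obj C)).inv ≫
          Functor.LaxMonoidal.μ functor A B ▷ functor.obj C =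
      Functor.LaxMonoidal.μ functor A (B ⊗ C) ≫ functor.map (α_ A B C).inv ≫
        Functor.OplaxMonoidal.δ functor (A ⊗ B) C
  counit_unit : Functor.OplaxMonoidal.η functor ≫ Functor.LaxMonoidal.ε functor = 𝟙 _
  unit_counit : Functor.LaxMonoidal.ε functor ≫ Functor.OplaxMonoidal.η functor = 𝟙 _

namespace FrobeniusFunctor

attribute [instance] colax lax

variable {U : Type u₁} [Category.{v₁} U] [MonoidalCategory U]
  {V : Type u} [Category.{v} V] [MonoidalCategory V]

/-- A bimonoidal natural transformation: a natural transformation that is monoidal for the colax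
and for the lax structures. -/
@[ext]
structure Hom (X Y : FrobeniusFunctor U V) where
  /-- the underlying natural transformation -/
  natTrans : X.functor ⟶ Y.functor
  lax_unit : Functor.LaxMonoidal.ε X.functor ≫ natTrans.app (𝟙_ U) =
    Functor.LaxMonoidal.ε Y.functor
  lax_tensor : ∀ A B : U, Functor.LaxMonoidal.μ X.functor A B ≫ natTrans.app (A ⊗ B) =
    (natTrans.app A ⊗ₘ natTrans.app B) ≫ Functor.LaxMonoidal.μ Y.functor A B
  colax_unit : natTrans.app (𝟙_ U) ≫ Functor.OplaxMonoidal.η Y.functor =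
    Functor.OplaxMonoidal.η X.functor
  colax_tensor : ∀ A B : U, natTrans.app (A ⊗ B) ≫ Functor.OplaxMonoidal.δ Y.functor A B =
    Functor.OplaxMonoidal.δ X.functor A B ≫ (natTrans.app A ⊗ₘ natTrans.app B)

/-- The category of strongly unital Frobenius monoidal functors and bimonoidal natural
transformations. -/
instance : Category (FrobeniusFunctor U V) where
  Hom := Hom
  id X := ⟨𝟙 _, by simp, by simp, by simp, by simp⟩
  comp f g := ⟨f.natTrans ≫ g.natTrans,
    by rw [NatTrans.comp_app, ← Category.assoc, f.lax_unit, g.lax_unit],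
    fun A B => by
      rw [NatTrans.comp_app, ← Category.assoc, f.lax_tensor, Category.assoc, g.lax_tensor,
        NatTrans.comp_app, NatTrans.comp_app, ← tensorHom_comp_tensorHom, Category.assoc],
    by rw [NatTrans.comp_app, Category.assoc, g.colax_unit, f.colax_unit],
    fun A B => by
      rw [NatTrans.comp_app, Category.assoc, g.colax_tensor, ← Category.assoc, f.colax_tensor,
        NatTrans.comp_app, NatTrans.comp_app, ← tensorHom_comp_tensorHom, Category.assoc]⟩
  id_comp f := Hom.ext (Category.id_comp _)
  comp_id f := Hom.ext (Category.comp_id _)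
  assoc f g h := Hom.ext (Category.assoc _ _ _)

end FrobeniusFunctor

/-! ### Monoids in augmented simplicial objects -/

section

variable {C : Type} [Category.{0} C] {D : Type} [Category.{0} D] (L : C ⥤ D) (d : D)
  {V : Type u} [Category.{v} V]

instance hasColimitsOfShape_costructuredArrow [HasColimits V] :
    HasColimitsOfShape (CostructuredArrow L d) V :=
  haveI : HasColimitsOfSize.{0, 0} V := hasSmallestColimitsOfHasColimits V
  inferInstance

instance preservesColimitsOfShape_costructuredArrow_tensorLeft [MonoidalCategory V] (X : V)
    [PreservesColimits (tensorLeft X)] :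
    PreservesColimitsOfShape (CostructuredArrow L d) (tensorLeft X) :=
  haveI := preservesSmallestColimits_of_preservesColimits (tensorLeft X)
  inferInstance

instance preservesColimitsOfShape_costructuredArrow_tensorRight [MonoidalCategory V] (X : V)
    [PreservesColimits (tensorRight X)] :
    PreservesColimitsOfShape (CostructuredArrow L d) (tensorRight X) :=
  haveI := preservesSmallestColimits_of_preservesColimits (tensorRight X)
  inferInstance

end

/-- The category of augmented simplicial objects of `V`; it carries the monoidal structure given
by Day convolution (the join of augmented simplicial objects) along the juxtaposition
`[m] ⋆ [n] = [m + n + 1]` on the augmented simplex category. -/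
abbrev AugSimplicialObject (V : Type u) [Category.{v} V] [MonoidalCategory V] :=
  AugmentedSimplexCategoryᵒᵖ ⊛⥤ V

section

variable {V : Type u} [Category.{v} V] [MonoidalCategory V]
  [HasColimits V] [∀ X : V, PreservesColimits (tensorLeft X)]
  [∀ X : V, PreservesColimits (tensorRight X)]

/-- Let `X` be a Frobenius monoidal functor on finite intervals and `M` a monoid in augmented
simplicial objects. The morphisms `ι n : M_n ⟶ X_{n + 2}`, for `n ≥ -1`, exhibit `M` as the kernel
monoid of `X` if
* `ι n` is the joint kernel of all comultiplications `X_{n + 2} ⟶ X_k ⊗ X_l` with `k, l ≥ 1`;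
* the simplicial structure of `M` is induced by that of `X` along `[0] ⋆ - ⋆ [0]`;
* the multiplication of `M` is induced by `d_p Z^{p,q} : X_p ⊗ X_q ⟶ X_{p + q - 1}`, where `Z` is
  the multiplication of `X`;
* the unit of `M` is induced by `I ≅ X_0 ⟶ X_1`, the second map being the degeneracy `s_0`. -/
structure IsKernelMonoid [Preadditive V] (X : FrobeniusFunctor FiniteIntervalᵒᵖ V)
    (M : Mon (AugSimplicialObject V))
    (ι : ∀ n : AugmentedSimplexCategory,
      M.X.functor.obj (op n) ⟶ X.functor.obj (op (FiniteInterval.narrow.obj n))) : Prop where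
  comul_zero : ∀ (n : AugmentedSimplexCategory) (k l : FiniteInterval), 0 < k.len → 0 < l.len →
    ∀ h : (k ⊗ l).len = (FiniteInterval.narrow.obj n).len,
      ι n ≫ X.functor.map (FiniteInterval.isoOfEq h).hom.op ≫
        Functor.OplaxMonoidal.δ X.functor (op k) (op l) = 0
  existsUnique_lift : ∀ (n : AugmentedSimplexCategory) (W : V)
    (g : W ⟶ X.functor.obj (op (FiniteInterval.narrow.obj n))),
    (∀ k l : FiniteInterval, 0 < k.len → 0 < l.len →
      ∀ h : (k ⊗ l).len = (FiniteInterval.narrow.obj n).len,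
        g ≫ X.functor.map (FiniteInterval.isoOfEq h).hom.op ≫
          Functor.OplaxMonoidal.δ X.functor (op k) (op l) = 0) →
    ∃! g' : W ⟶ M.X.functor.obj (op n), g' ≫ ι n = g
  naturality : ∀ {m n : AugmentedSimplexCategory} (f : m ⟶ n),
    M.X.functor.map f.op ≫ ι m = ι n ≫ X.functor.map (FiniteInterval.narrow.map f).op
  mul : ∀ m n : AugmentedSimplexCategory,
    (DayFunctor.η M.X M.X).app (op m, op n) ≫
        (MonObj.mul (X := M.X)).natTrans.app (op m ⊗ op n) ≫ ι (m ⊗ n) =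
      (ι m ⊗ₘ ι n) ≫
        Functor.LaxMonoidal.μ X.functor (op (FiniteInterval.narrow.obj m))
          (op (FiniteInterval.narrow.obj n)) ≫
        X.functor.map (FiniteInterval.coface (FiniteInterval.narrow.obj m).len
          (FiniteInterval.narrow_tensor_len m n) (FiniteInterval.narrow_len_pos m)
          (FiniteInterval.narrow_len_le m n)).op
  one : DayFunctor.ν AugmentedSimplexCategoryᵒᵖ V ≫
        (MonObj.one (X := M.X)).natTrans.app (𝟙_ AugmentedSimplexCategoryᵒᵖ) ≫
          ι (𝟙_ AugmentedSimplexCategory) =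
      Functor.LaxMonoidal.ε X.functor ≫ X.functor.map (FiniteInterval.toUnit
        (FiniteInterval.narrow.obj (𝟙_ AugmentedSimplexCategory))).op

end

/-! ### Iterated tensor products and the lax morphism classifier -/

universe v₂ u₂

/-! By the universal property of Day convolution, a monoid in augmented simplicial objects is a lax
monoidal functor `M` on the opposite of the augmented simplex category. The functor `[0] ⋆ - ⋆ [0]`
is oplax monoidal: gluing two intervals creates one extra point, and the comparison is the inner
coface that omits it.

From `M` to a Frobenius functor. Augmented simplices correspond to positive lengths, so a list of
them is a subdivision of an interval `[n]`, recorded by its set of cut points. Let `X_n` be the sum,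
over all subdivisions of `[n]`, of the tensor products of the values of `M`. A map `[m] ⟶ [n]` pulls
cut points back. The interior of each block of `[m]` then avoids the cuts of `[n]`, so it maps to
the join of the blocks that it meets; `M` multiplies over these blocks and restricts along this map.
Formally, a map of intervals lifts uniquely to a map of lists (`exists_listHomVal`,
`eq_of_listHomVal_eq`, `listHom_ext`), and lax functors act on maps of lists. Multiplication
concatenates subdivisions, and comultiplication projects to those with a cut at the given point. The
Frobenius laws hold because a cut of a concatenation that lies inside one part is a cut of that
part. A primitive morphism has no component at a subdivision with an interior cut, so the joint
kernel gives back `M` (`isKernelCone_frobCone`).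

From `X` to its kernel and back. Strong unitality and a Frobenius law show that multiplication
followed by comultiplication is the identity (`μ_δ`). The composite in the other order is thus an
idempotent `e_k` of `X_n` for each interior point `k`. The product of the `1 - e_k` lands in the
joint kernel, and its difference from `1` factors through tensor products of values at shorter
intervals. By induction on `n`, the comparison morphism to `X` from the Frobenius functor built on
its kernel has a section; it is monic because whatever it kills is primitive
(`isIso_comparisonApp`). So bimonoidal transformations out of `X` are the same as monoidal cones of
primitives on its kernel (`hom_ext_of_isKernelCone`, `exists_hom_of_isKernelCone`), which makes the
kernel functor fully faithful. -/

theorem whiskerLeft_append_assoc {V : Type u} [Category.{v} V] [MonoidalCategory V]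
    {x A A' B P Q R S : V} {s : A ⟶ B ⊗ R} {t : B ⟶ P ⊗ Q}
    {c : A ⟶ A'} {p : A' ⟶ P ⊗ S} {q : S ⟶ Q ⊗ R}
    (h : s ≫ t ▷ R ≫ (α_ P Q R).hom = c ≫ p ≫ P ◁ q) :
    (x ◁ s ≫ (α_ x B R).inv) ≫ (x ◁ t ≫ (α_ x P Q).inv) ▷ R ≫ (α_ (x ⊗ P) Q R).hom =
      x ◁ c ≫ (x ◁ p ≫ (α_ x P S).inv) ≫ (x ⊗ P) ◁ q := by
  have := congrArg (fun t => x ◁ t ≫ (α_ _ _ _).inv) h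
  simp only [MonoidalCategory.whiskerLeft_comp, Category.assoc] at this
  simp only [comp_whiskerRight, Category.assoc, tensor_whiskerLeft, Iso.inv_hom_id_assoc]
  rw [← this]
  monoidal

section ListTensor

variable {C : Type u₁} [Category.{v₁} C] {V : Type u} [Category.{v} V] [MonoidalCategory V]

/-- The iterated tensor product of the values of a functor at a list of objects. -/
def listTensor (F : C ⥤ V) : List C → V
  | [] => 𝟙_ V
  | x :: l => F.obj x ⊗ listTensor F l

/-- Iterated tensor products of concatenated lists. -/
def listTensorAppend (F : C ⥤ V) : ∀ l₁ l₂ : List C,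
    listTensor F (l₁ ++ l₂) ≅ listTensor F l₁ ⊗ listTensor F l₂
  | [], l₂ => (λ_ (listTensor F l₂)).symm
  | x :: l₁, l₂ => whiskerLeftIso (F.obj x) (listTensorAppend F l₁ l₂) ≪≫
      (α_ (F.obj x) (listTensor F l₁) (listTensor F l₂)).symm

/-- The transport of iterated tensor products along an equality of lists. -/
def listTensorCast (F : C ⥤ V) {l₁ l₂ : List C} (h : l₁ = l₂) :
    listTensor F l₁ ⟶ listTensor F l₂ :=
  eqToHom (congrArg _ h)

@[simp] theorem listTensorCast_rfl (F : C ⥤ V) (l : List C) :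
    listTensorCast F (rfl : l = l) = 𝟙 _ := rfl

@[simp]
theorem listTensorCast_trans (F : C ⥤ V) {l₁ l₂ l₃ : List C} (h : l₁ = l₂) (h' : l₂ = l₃) :
    listTensorCast F h ≫ listTensorCast F h' = listTensorCast F (h.trans h') := by
  subst h h'
  simp

theorem listTensorCast_cons (F : C ⥤ V) (x : C) {l₁ l₂ : List C} (h : l₁ = l₂) :
    listTensorCast F (congrArg (x :: ·) h) = F.obj x ◁ listTensorCast F h := by
  subst h
  exact (MonoidalCategory.whiskerLeft_id _ _).symm

/-- Coherence for reassociating a concatenation. The transport is needed because the two bracketings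
of the list are equal only propositionally. -/
theorem listTensorAppend_assoc (F : C ⥤ V) (l₁ l₂ l₃ : List C) :
    (listTensorAppend F (l₁ ++ l₂) l₃).hom ≫ (listTensorAppend F l₁ l₂).hom ▷ listTensor F l₃ ≫
        (α_ _ _ _).hom =
      listTensorCast F (List.append_assoc l₁ l₂ l₃) ≫ (listTensorAppend F l₁ (l₂ ++ l₃)).hom ≫
        listTensor F l₁ ◁ (listTensorAppend F l₂ l₃).hom := by
  induction l₁ with
  | nil =>
    -- The identity is proved for arbitrary objects and morphisms and then specialised up to
    -- unfolding of the recursive definitions. The same device recurs below under the names `h`,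
    -- `h'` and `key`.
    have h : ∀ {A B D : V} (f : A ⟶ B ⊗ D), f ≫ (λ_ B).inv ▷ D ≫ (α_ _ _ _).hom =
        𝟙 A ≫ (λ_ A).inv ≫ 𝟙_ V ◁ f := by simp
    exact h _
  | cons x l₁ ih =>
    refine (whiskerLeft_append_assoc ih).trans ?_
    rw [← listTensorCast_cons]
    rfl

theorem listTensorAppend_nil_right (F : C ⥤ V) (l : List C) :
    (listTensorAppend F l []).hom =
      listTensorCast F (List.append_nil l) ≫ (ρ_ (listTensor F l)).inv := by
  induction l with
  | nil => exact unitors_inv_equal.trans (Category.id_comp _).symm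
  | cons x l ih =>
    have h : ∀ {x A B : V} {s : A ⟶ B ⊗ 𝟙_ V} {c : A ⟶ B}, s = c ≫ (ρ_ B).inv →
        x ◁ s ≫ (α_ x B (𝟙_ V)).inv = x ◁ c ≫ (ρ_ (x ⊗ B)).inv := by
      rintro x A B s c rfl
      simp
    refine (h ih).trans ?_
    rw [← listTensorCast_cons]
    rfl

theorem listTensorAppend_assoc_inv (F : C ⥤ V) (l₁ l₂ l₃ : List C) :
    (listTensorAppend F l₁ l₂).inv ▷ listTensor F l₃ ≫ (listTensorAppend F (l₁ ++ l₂) l₃).inv =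
      (α_ _ _ _).hom ≫ listTensor F l₁ ◁ (listTensorAppend F l₂ l₃).inv ≫
        (listTensorAppend F l₁ (l₂ ++ l₃)).inv ≫
          listTensorCast F (List.append_assoc l₁ l₂ l₃).symm := by
  have h : ∀ {A A' B P Q R S : V} {s : A ≅ B ⊗ R} {t : B ≅ P ⊗ Q} {c : A ⟶ A'} {c' : A' ⟶ A}
      {p : A' ≅ P ⊗ S} {q : S ≅ Q ⊗ R}, c ≫ c' = 𝟙 _ →
      s.hom ≫ t.hom ▷ R ≫ (α_ P Q R).hom = c ≫ p.hom ≫ P ◁ q.hom →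
      t.inv ▷ R ≫ s.inv = (α_ P Q R).hom ≫ P ◁ q.inv ≫ p.inv ≫ c' := by
    intro A A' B P Q R S s t c c' p q hc h
    rw [← cancel_epi (t.hom ▷ R), ← cancel_epi s.hom, reassoc_of% h]
    simp [hc]
  exact h (by simp) (listTensorAppend_assoc F l₁ l₂ l₃)

theorem listTensorAppend_nil_right_inv (F : C ⥤ V) (l : List C) :
    (listTensorAppend F l []).inv =
      (ρ_ (listTensor F l)).hom ≫ listTensorCast F (List.append_nil l).symm := by
  have h : ∀ {A B : V} {s : A ≅ B ⊗ 𝟙_ V} {c : A ⟶ B} {c' : B ⟶ A}, c ≫ c' = 𝟙 _ →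
      s.hom = c ≫ (ρ_ B).inv → s.inv = (ρ_ B).hom ≫ c' := by
    intro A B s c c' hc h
    rw [← cancel_epi s.hom, Iso.hom_inv_id, h]
    simp [hc]
  exact h (by simp) (listTensorAppend_nil_right F l)

end ListTensor

/-! ### Maps from iterated tensor products into lax monoidal functors -/

section ListDesc

variable {C : Type u₁} [Category.{v₁} C] {U : Type u₂} [Category.{v₂} U] [MonoidalCategory U]
  {V : Type u} [Category.{v} V] [MonoidalCategory V]
  {M : C ⥤ V} {N : C ⥤ U} {X : U ⥤ V} [X.LaxMonoidal]

open Functor.LaxMonoidal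

/-- The morphism from an iterated tensor product induced by a natural transformation into a
functor that factors through a lax monoidal functor. -/
def listDesc (ι : M ⟶ N ⋙ X) : ∀ l : List C, listTensor M l ⟶ X.obj (listTensor N l)
  | [] => ε X
  | x :: l => (ι.app x ⊗ₘ listDesc ι l) ≫ μ X (N.obj x) (listTensor N l)

theorem leftUnitor_inv_tensor_μ {A : V} {B : U} (d : A ⟶ X.obj B) :
    d ≫ X.map (λ_ B).inv = (λ_ A).inv ≫ (ε X ⊗ₘ d) ≫ μ X (𝟙_ U) B := by
  rw [tensorHom_def', Category.assoc, ← leftUnitor_inv_naturality_assoc, left_unitality_inv]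

/-- The inductive step of `listDesc_append`: naturality of `μ` in the second variable exposes `t`,
the hypothesis splits the tail, and associativity of `μ` regroups. -/
theorem tensor_μ_append {x A P Q : V} {y B R S : U} (a : x ⟶ X.obj y) {d : A ⟶ X.obj B}
    {d₁ : P ⟶ X.obj R} {d₂ : Q ⟶ X.obj S} {s : A ⟶ P ⊗ Q} {t : B ⟶ R ⊗ S}
    (h : d ≫ X.map t = s ≫ (d₁ ⊗ₘ d₂) ≫ μ X R S) :
    ((a ⊗ₘ d) ≫ μ X y B) ≫ X.map (y ◁ t ≫ (α_ y R S).inv) =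
      (x ◁ s ≫ (α_ x P Q).inv) ≫ ((a ⊗ₘ d₁) ≫ μ X y R ⊗ₘ d₂) ≫ μ X (y ⊗ R) S := by
  rw [Functor.map_comp, Category.assoc, ← μ_natural_right_assoc, tensorHom_def a d]
  simp only [Category.assoc]
  rw [← MonoidalCategory.whiskerLeft_comp_assoc, h]
  have e : ((a ⊗ₘ d₁) ≫ μ X y R ⊗ₘ d₂) = ((a ⊗ₘ d₁) ⊗ₘ d₂) ≫ μ X y R ▷ X.obj S := by
    rw [← tensorHom_id, tensorHom_comp_tensorHom, Category.comp_id]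
  rw [e]
  simp only [MonoidalCategory.whiskerLeft_comp, Category.assoc, associativity_inv]
  rw [← whisker_exchange_assoc, ← tensorHom_def_assoc, associator_inv_naturality_assoc]

/-- Generalised associativity of the lax structure of `X`, by induction on the first list. -/
theorem listDesc_append (ι : M ⟶ N ⋙ X) (l₁ l₂ : List C) :
    listDesc ι (l₁ ++ l₂) ≫ X.map (listTensorAppend N l₁ l₂).hom =
      (listTensorAppend M l₁ l₂).hom ≫ (listDesc ι l₁ ⊗ₘ listDesc ι l₂) ≫ μ X _ _ := by
  induction l₁ with
  | nil => exact leftUnitor_inv_tensor_μ _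
  | cons x l₁ ih => exact tensor_μ_append (X := X) (y := N.obj x) (ι.app x) ih

end ListDesc

/-! ### Maps of lists and the action of lax monoidal functors on them -/

section ListHom

open Functor.LaxMonoidal

/-- Morphisms of lists of objects of a monoidal category: a morphism to `[x₁, ..., xₙ]` is a
decomposition of the source into `n` consecutive sublists, together with morphisms from their tensor
products to `x₁, ..., xₙ`. -/
inductive ListHom {C : Type u₁} [Category.{v₁} C] [MonoidalCategory C] :
    List C → List C → Type (max u₁ v₁)
  | nil : ListHom [] []
  | cons {l₁ l₂ l' : List C} {x : C} (f : listTensor (𝟭 C) l₁ ⟶ x) (g : ListHom l₂ l') :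
      ListHom (l₁ ++ l₂) (x :: l')

variable {C : Type u₁} [Category.{v₁} C] [MonoidalCategory C]
  {U : Type u₂} [Category.{v₂} U] [MonoidalCategory U]
  {V : Type u} [Category.{v} V] [MonoidalCategory V]
  (M : C ⥤ V) [M.LaxMonoidal] (N : C ⥤ U) [N.LaxMonoidal] {X : U ⥤ V} [X.LaxMonoidal]

/-- The iterated multiplication of a lax monoidal functor. -/
def listMul (l : List C) : listTensor M l ⟶ M.obj (listTensor (𝟭 C) l) :=
  listDesc (N := 𝟭 C) (X := M) M.leftUnitor.inv l

theorem listMul_cons (x : C) (l : List C) :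
    listMul M (x :: l) = (M.obj x ◁ listMul M l) ≫ μ M x (listTensor (𝟭 C) l) := by
  rw [← id_tensorHom]
  rfl

/-- Iterates the monoidality of `ι`: the lax structure of `N ⋙ X` is that of `X` followed by the
image of that of `N`, so the multiplication of `N` ends up inside `X`. -/
theorem listMul_listDesc (ι : M ⟶ N ⋙ X) [NatTrans.IsMonoidal ι] (l : List C) :
    listMul M l ≫ ι.app (listTensor (𝟭 C) l) = listDesc ι l ≫ X.map (listMul N l) := by
  induction l with
  | nil => exact NatTrans.IsMonoidal.unit
  | cons x l ih =>
    have h : ∀ {P : V} {Q : U} {c : C} {a : P ⟶ M.obj c} {b : Q ⟶ N.obj c} {d : P ⟶ X.obj Q},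
        a ≫ ι.app c = d ≫ X.map b → (M.obj x ◁ a ≫ μ M x c) ≫ ι.app (x ⊗ c) =
          ((ι.app x ⊗ₘ d) ≫ μ X (N.obj x) Q) ≫ X.map (N.obj x ◁ b ≫ μ N x c) := by
      intro P Q c a b d h
      rw [Category.assoc, NatTrans.IsMonoidal.tensor, Functor.LaxMonoidal.comp_μ, X.map_comp,
        Category.assoc, ← μ_natural_right_assoc, ← id_tensorHom, tensorHom_comp_tensorHom_assoc, h,
        Category.id_comp, ← id_tensorHom, tensorHom_comp_tensorHom_assoc]
      simp
    rw [listMul_cons, listMul_cons]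
    exact h ih

namespace ListHom

/-- The morphism between iterated tensor products induced by a morphism of lists. -/
def map : ∀ {l l' : List C}, ListHom l l' → (listTensor M l ⟶ listTensor M l')
  | _, _, nil => 𝟙 _
  | _, _, cons (l₁ := l₁) (l₂ := l₂) f g =>
    (listTensorAppend M l₁ l₂).hom ≫ ((listMul M l₁ ≫ M.map f) ⊗ₘ g.map)

theorem map_cons {l₁ l₂ l' : List C} {x : C} (f : listTensor (𝟭 C) l₁ ⟶ x) (g : ListHom l₂ l') :
    (cons f g).map M = (listTensorAppend M l₁ l₂).hom ≫
      ((listMul M l₁ ≫ M.map f) ⊗ₘ g.map M) := rfl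

variable {M N} in
-- Naturality of `listDesc ι` in maps of lists; the naturality of the comparison morphism rests on
-- it.
theorem map_listDesc (ι : M ⟶ N ⋙ X) [NatTrans.IsMonoidal ι] {l l' : List C} (e : ListHom l l') :
    e.map M ≫ listDesc ι l' = listDesc ι l ≫ X.map (e.map N) := by
  induction e with
  | nil =>
    exact (Category.id_comp _).trans ((Category.comp_id _).symm.trans
      (congrArg (_ ≫ ·) (X.map_id _).symm))
  | @cons l₁ l₂ l' x f g ih =>
    have h : (listMul M l₁ ≫ M.map f) ≫ ι.app x =
        listDesc ι l₁ ≫ X.map (listMul N l₁ ≫ N.map f) := by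
      rw [Category.assoc, ι.naturality, ← Category.assoc, listMul_listDesc, Category.assoc,
        Functor.comp_map, ← X.map_comp]
    have h' : ∀ {A P Q : V} {B R S R' : U} {a : P ⟶ M.obj x} {b : R ⟶ N.obj x} {c : P ⟶ X.obj R}
        {p : Q ⟶ listTensor M l'} {q : S ⟶ R'} {d : Q ⟶ X.obj S} {d' : listTensor M l' ⟶ X.obj R'}
        {s : A ⟶ P ⊗ Q} {t : B ⟶ R ⊗ S} {w : A ⟶ X.obj B},
        w ≫ X.map t = s ≫ (c ⊗ₘ d) ≫ μ X R S →
        a ≫ ι.app x = c ≫ X.map b → p ≫ d' = d ≫ X.map q →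
          (s ≫ (a ⊗ₘ p)) ≫ (ι.app x ⊗ₘ d') ≫ μ X (N.obj x) R' =
            w ≫ X.map (t ≫ (b ⊗ₘ q)) := by
      intro A P Q B R S R' a b c p q d d' s t w h₀ h₁ h₂
      rw [X.map_comp, reassoc_of% h₀, Category.assoc, tensorHom_comp_tensorHom_assoc, h₁, h₂,
        ← μ_natural, tensorHom_comp_tensorHom_assoc]
    exact h' (listDesc_append ι l₁ l₂) h ih

/-- The case where `ι` is the inverse of the left unitor, so that `N` is the identity. It is what
makes maps of lists composable. -/
theorem map_listMul {l l' : List C} (e : ListHom l l') :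
    e.map M ≫ listMul M l' = listMul M l ≫ M.map (e.map (𝟭 C)) := by
  have : NatTrans.IsMonoidal (M.leftUnitor.inv) := by
    constructor
    · simp
    · intro X Y
      simp
  exact map_listDesc (N := 𝟭 C) (X := M) M.leftUnitor.inv e

/-- The identity morphism of a list. -/
def id : ∀ l : List C, ListHom l l
  | [] => nil
  | x :: l => cons (l₁ := [x]) (ρ_ x).hom (id l)

/-- Each block of the identity is a list `[x]`, whose iterated tensor product is `x ⊗ 𝟙_ C`; right
unitality of `M` and the triangle identity cancel the superfluous unit. -/
theorem map_id (l : List C) : (id l).map M = 𝟙 _ := by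
  induction l with
  | nil => rfl
  | cons x l ih =>
    have h : ∀ (A : V), ((M.obj x ◁ (λ_ A).inv ≫ (α_ (M.obj x) (𝟙_ V) A).inv) ≫
        ((((𝟙 (M.obj x) ⊗ₘ ε M) ≫ μ M x (𝟙_ C)) ≫ M.map (ρ_ x).hom) ⊗ₘ 𝟙 A)) = 𝟙 _ := by
      intro A
      rw [id_tensorHom, Category.assoc, Category.assoc, ← right_unitality, tensorHom_id,
        triangle_assoc_comp_right, ← MonoidalCategory.whiskerLeft_comp, Iso.inv_hom_id,
        MonoidalCategory.whiskerLeft_id]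
    change ((M.obj x ◁ (λ_ (listTensor M l)).inv ≫ (α_ (M.obj x) (𝟙_ V) (listTensor M l)).inv) ≫
        ((((𝟙 (M.obj x) ⊗ₘ ε M) ≫ μ M x (𝟙_ C)) ≫ M.map (ρ_ x).hom) ⊗ₘ (id l).map M)) = _
    rw [ih]
    exact h _

/-- The transport of a morphism of lists along an equality. -/
def cast {l₁ l₂ l' : List C} (h : l₁ = l₂) (e : ListHom l₂ l') : ListHom l₁ l' := h ▸ e

theorem map_cast {l₁ l₂ l' : List C} (h : l₁ = l₂) (e : ListHom l₂ l') :
    (cast h e).map M = listTensorCast M h ≫ e.map M := by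
  subst h
  exact (Category.id_comp _).symm

/-- The concatenation of morphisms of lists. -/
def append : ∀ {l₁ l₂ l₁' l₂' : List C}, ListHom l₁ l₁' → ListHom l₂ l₂' →
    ListHom (l₁ ++ l₂) (l₁' ++ l₂')
  | _, _, _, _, nil, e => e
  | _, _, _, _, cons f g, e => cast (List.append_assoc _ _ _) (cons f (g.append e))

theorem map_append {l₁ l₂ l₁' l₂' : List C} (e₁ : ListHom l₁ l₁') (e₂ : ListHom l₂ l₂') :
    (e₁.append e₂).map M ≫ (listTensorAppend M l₁' l₂').hom =
      (listTensorAppend M l₁ l₂).hom ≫ (e₁.map M ⊗ₘ e₂.map M) := by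
  induction e₁ with
  | nil =>
    have h : ∀ {A B : V} (f : A ⟶ B), f ≫ (λ_ B).inv = (λ_ A).inv ≫ (𝟙 (𝟙_ V) ⊗ₘ f) := by
      intro A B f
      simp
    exact h _
  | @cons l l₂' l' x f g ih =>
    have h := map_cast M (List.append_assoc l l₂' l₂) (cons f (g.append e₂))
    rw [map_cons] at h
    have h' : ∀ {A A' B P Q R S S' Q' R' : V} {s : A ⟶ B ⊗ R} {t : B ⟶ P ⊗ Q}
        {c : A ⟶ A'} {p : A' ⟶ P ⊗ S} {q : S ⟶ Q ⊗ R} {y : V} {a : P ⟶ y} {g : Q ⟶ Q'}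
        {e : R ⟶ R'} {w : S ⟶ S'} {z : S' ⟶ Q' ⊗ R'},
        s ≫ t ▷ R ≫ (α_ P Q R).hom = c ≫ p ≫ P ◁ q → w ≫ z = q ≫ (g ⊗ₘ e) →
        (c ≫ p ≫ (a ⊗ₘ w)) ≫ y ◁ z ≫ (α_ y Q' R').inv =
          s ≫ ((t ≫ (a ⊗ₘ g)) ⊗ₘ e) := by
      intro A A' B P Q R S S' Q' R' s t c p q y a g e w z h₁ h₂
      have e₁ : (a ⊗ₘ w) ≫ y ◁ z = P ◁ q ≫ (a ⊗ₘ (g ⊗ₘ e)) := by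
        rw [← id_tensorHom, ← id_tensorHom, tensorHom_comp_tensorHom, tensorHom_comp_tensorHom, h₂]
        simp
      have e₂ : ((t ≫ (a ⊗ₘ g)) ⊗ₘ e) = t ▷ R ≫ ((a ⊗ₘ g) ⊗ₘ e) := by
        rw [← tensorHom_id, tensorHom_comp_tensorHom, Category.id_comp]
      simp only [Category.assoc]
      rw [reassoc_of% e₁, e₂, associator_inv_naturality, ← reassoc_of% h₁]
      simp
    exact (congrArg (· ≫ _) h).trans (h' (listTensorAppend_assoc M l l₂' l₂) ih)

/-- The source of a map of lists is cut into one consecutive sublist per entry of the target, so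
cutting the target cuts the source. -/
theorem exists_append {l a b : List C} (e : ListHom l (a ++ b)) :
    ∃ (l₁ l₂ : List C) (h : l = l₁ ++ l₂) (e₁ : ListHom l₁ a) (e₂ : ListHom l₂ b),
      e = cast h (e₁.append e₂) := by
  induction a generalizing l with
  | nil => exact ⟨[], l, rfl, nil, e, rfl⟩
  | cons x a ih =>
    change ListHom l (x :: (a ++ b)) at e
    cases e with
    | @cons l₁ l₂ _ _ f g =>
      obtain ⟨m₁, m₂, rfl, e₁, e₂, rfl⟩ := ih g
      refine ⟨l₁ ++ m₁, m₂, (List.append_assoc _ _ _).symm, cons f e₁, e₂, ?_⟩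
      change _ = cast _ (cast _ (cons f (e₁.append e₂)))
      simp only [cast, eqRec_eq_cast, cast_cast, cast_eq]

/-- Blocks are composed after multiplying out, by `map_listMul`. Only the existence of a composite
is needed, but the same one must serve two functors: one computes the action of the lax functor, the
other, `narrow.op`, identifies the underlying map of intervals. -/
theorem exists_comp {l l' l'' : List C} (e : ListHom l l') (e' : ListHom l' l'') :
    ∃ e'' : ListHom l l'', e''.map M = e.map M ≫ e'.map M ∧ e''.map N = e.map N ≫ e'.map N := by
  induction e' generalizing l with
  | nil => exact ⟨e, (Category.comp_id _).symm, (Category.comp_id _).symm⟩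
  | @cons l₁ l₂ l' x f g ih =>
    obtain ⟨m₁, m₂, rfl, e₁, e₂, rfl⟩ := exists_append e
    obtain ⟨e₃, h₁, h₂⟩ := ih e₂
    refine ⟨cons (e₁.map (𝟭 C) ≫ f) e₃, ?_, ?_⟩
    · rw [map_cons, map_cons, h₁, M.map_comp, ← reassoc_of% (map_listMul), ← tensorHom_comp_tensorHom,
        ← reassoc_of% (map_append)]
      rfl
    · rw [map_cons, map_cons, h₂, N.map_comp, ← reassoc_of% (map_listMul), ← tensorHom_comp_tensorHom,
        ← reassoc_of% (map_append)]
      rfl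

end ListHom

end ListHom

/-! ### The lax monoidal functor from augmented simplices to finite intervals -/

namespace FiniteInterval

/-- An isomorphism is injective and monotone, hence strictly increasing. Applied to it and to its
inverse, this bound forces equality. -/
theorem le_val_of_isIso {m n : FiniteInterval} (f : m ⟶ n) [IsIso f] {i : ℕ} (hi : i ≤ m.len) :
    i ≤ Hom.val f i := by
  induction i with
  | zero => exact Nat.zero_le _
  | succ i ih =>
    refine Nat.succ_le_of_lt (lt_of_le_of_ne ((ih (by omega)).trans (val_mono f (Nat.le_succ i)))
      fun h => ?_)
    change i = Hom.val f (i + 1) at h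
    have h₁ := val_mono f (show i ≤ i + 1 by omega)
    have h₂ := ih (by omega)
    have h₃ := congrArg (Hom.val (inv f)) (show Hom.val f i = Hom.val f (i + 1) by omega)
    rw [← val_comp, ← val_comp, IsIso.hom_inv_id, val_id, val_id] at h₃
    omega

theorem len_eq_of_isIso {m n : FiniteInterval} (f : m ⟶ n) [IsIso f] : m.len = n.len :=
  le_antisymm ((le_val_of_isIso f le_rfl).trans (val_le f _))
    ((le_val_of_isIso (inv f) le_rfl).trans (val_le (inv f) _))

/-- Isomorphisms of intervals are identity functions, so associators, unitors and casts drop out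
whenever values are compared. The minimum reflects that `Hom.val` is constant beyond the last point.
-/
theorem val_of_isIso {m n : FiniteInterval} (f : m ⟶ n) [IsIso f] (i : ℕ) :
    Hom.val f i = min i m.len := by
  have hmn := len_eq_of_isIso f
  rcases le_total i m.len with hi | hi
  · have h₁ := le_val_of_isIso f hi
    have h₂ := le_val_of_isIso (inv f) (val_le f i)
    rw [← val_comp, IsIso.hom_inv_id, val_id] at h₂
    omega
  · rw [val_of_len_le f hi]
    omega

/-- Together with `narrow_map_injective` and `exists_narrow_map`, this identifies maps of augmented
simplices with the maps of intervals that send interior points to interior points. -/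
theorem narrow_val_interior {x y : AugmentedSimplexCategory} (f : x ⟶ y) {i : ℕ} (h0 : 0 < i)
    (hi : i < (narrow.obj x).len) :
    0 < Hom.val (narrow.map f) i ∧ Hom.val (narrow.map f) i < (narrow.obj y).len := by
  cases x with
  | star =>
    have : i < 1 := hi
    omega
  | of x =>
    cases y with
    | star => exact f.elim
    | of y =>
      have hi' : i < x.len + 2 := hi
      have h := val_addEndpoints_succ (WithInitial.down f) ⟨i - 1, by omega⟩
      have h' : i - 1 + 1 = i := by omega
      have := ((WithInitial.down f).toOrderHom ⟨i - 1, by omega⟩).2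
      simp only [h'] at h
      change 0 < Hom.val (addEndpoints (WithInitial.down f)) i ∧
        Hom.val (addEndpoints (WithInitial.down f)) i < y.len + 2
      omega

theorem narrow_map_injective {x y : AugmentedSimplexCategory} {f g : x ⟶ y}
    (h : narrow.map f = narrow.map g) : f = g := by
  cases x with
  | star => exact WithInitial.starInitial.hom_ext f g
  | of x =>
    cases y with
    | star => exact f.elim
    | of y =>
      change WithInitial.down f = WithInitial.down g
      refine SimplexCategory.Hom.ext _ _ (OrderHom.ext _ _ (funext fun i => Fin.ext ?_))
      have h₁ := val_addEndpoints_succ (WithInitial.down f) i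
      have h₂ := val_addEndpoints_succ (WithInitial.down g) i
      have h₃ : addEndpoints (WithInitial.down f) = addEndpoints (WithInitial.down g) := h
      rw [h₃] at h₁
      omega

theorem exists_narrow_map {x y : AugmentedSimplexCategory} (h : narrow.obj x ⟶ narrow.obj y)
    (hh : ∀ i, 0 < i → i < (narrow.obj x).len →
      0 < Hom.val h i ∧ Hom.val h i < (narrow.obj y).len) :
    ∃ f : x ⟶ y, narrow.map f = h := by
  cases x with
  | star =>
    refine ⟨WithInitial.starInitial.to y, hom_ext_val fun i hi => ?_⟩
    obtain rfl | rfl : i = 0 ∨ i = 1 := by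
      have : i ≤ 1 := hi
      omega
    · rw [val_zero, val_zero]
    · exact (val_len _).trans (val_len _).symm
  | of x =>
    cases y with
    | star =>
      have := hh 1 Nat.one_pos (show 1 < x.len + 2 by omega)
      have h' : Hom.val h 1 < 1 := this.2
      omega
    | of y =>
      have hy : ∀ i : Fin (x.len + 1), 0 < Hom.val h (i + 1) ∧ Hom.val h (i + 1) < y.len + 2 :=
        fun i => hh (i + 1) (Nat.succ_pos _) (show (i : ℕ) + 1 < x.len + 2 by omega)
      let f : x ⟶ y := SimplexCategory.Hom.mk
        { toFun := fun i => ⟨Hom.val h (i + 1) - 1, by have := hy i; omega⟩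
          monotone' := fun i j hij => Fin.mk_le_mk.2 (Nat.sub_le_sub_right
            (val_mono h (Nat.succ_le_succ hij)) 1) }
      refine ⟨f, addEndpoints_hom_ext fun i => ?_⟩
      refine (val_addEndpoints_succ f i).trans ?_
      exact Nat.sub_add_cancel (hy i).1

theorem narrow_tensor_len' (x y : AugmentedSimplexCategory) :
    (narrow.obj x).len + (narrow.obj y).len = (narrow.obj (x ⊗ y)).len + 1 :=
  narrow_tensor_len x y

/-- The top endpoint is excluded because it goes to the top endpoint of the join. -/
theorem val_narrow_inl (x y : AugmentedSimplexCategory) {i : ℕ} (hi : i < (narrow.obj x).len) :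
    Hom.val (narrow.map (AugmentedSimplexCategory.inl x y)) i = i := by
  rcases Nat.eq_zero_or_pos i with rfl | h0
  · exact val_zero _
  cases x with
  | star =>
    have : i < 1 := hi
    omega
  | of x =>
    cases y with
    | star =>
      have : IsIso (WithInitial.starInitial.to (𝟙_ AugmentedSimplexCategory)) :=
        inferInstanceAs (IsIso (𝟙 (𝟙_ AugmentedSimplexCategory)))
      have : IsIso (AugmentedSimplexCategory.inl (WithInitial.of x)
          (𝟙_ AugmentedSimplexCategory)) := by
        unfold AugmentedSimplexCategory.inl
        infer_instance
      exact (val_of_isIso (narrow.map (AugmentedSimplexCategory.inl (WithInitial.of x)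
          (𝟙_ AugmentedSimplexCategory))) i).trans (min_eq_left hi.le)
    | of y =>
      have hi' : i < x.len + 2 := hi
      have h := val_addEndpoints_succ (AugmentedSimplexCategory.inl' x y) ⟨i - 1, by omega⟩
      have h' : i - 1 + 1 = i := by omega
      rw [AugmentedSimplexCategory.inl'_eval] at h
      simp only [h', Fin.val_cast, Fin.val_castAdd] at h
      exact h

/-- The shift is the number of elements of `x`, one less than the length of `[0] ⋆ x ⋆ [0]`. The
bottom endpoint is excluded because it stays at `0`. -/
theorem val_narrow_inr (x y : AugmentedSimplexCategory) {i : ℕ} (h0 : 0 < i)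
    (hi : i ≤ (narrow.obj y).len) :
    Hom.val (narrow.map (AugmentedSimplexCategory.inr x y)) i = (narrow.obj x).len - 1 + i := by
  have hl := narrow_tensor_len' x y
  have hx := narrow_len_pos x
  rcases Nat.eq_or_lt_of_le hi with rfl | hi
  · rw [val_len]
    omega
  cases y with
  | star =>
    have : i < 1 := hi
    omega
  | of y =>
    cases x with
    | star =>
      have : IsIso (WithInitial.starInitial.to (𝟙_ AugmentedSimplexCategory)) :=
        inferInstanceAs (IsIso (𝟙 (𝟙_ AugmentedSimplexCategory)))
      have : IsIso (AugmentedSimplexCategory.inr (𝟙_ AugmentedSimplexCategory)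
          (WithInitial.of y)) := by
        unfold AugmentedSimplexCategory.inr
        infer_instance
      refine (val_of_isIso (narrow.map (AugmentedSimplexCategory.inr
          (𝟙_ AugmentedSimplexCategory) (WithInitial.of y))) i).trans
        ((min_eq_left hi.le).trans ?_)
      exact (Nat.zero_add i).symm
    | of x =>
      have hi' : i < y.len + 2 := hi
      have h := val_addEndpoints_succ (AugmentedSimplexCategory.inr' x y) ⟨i - 1, by omega⟩
      have h' : i - 1 + 1 = i := by omega
      rw [AugmentedSimplexCategory.inr'_eval] at h
      simp only [h', Fin.val_cast, Fin.val_natAdd] at h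
      refine Eq.trans h ?_
      change x.len + 1 + (i - 1) + 1 = x.len + 2 - 1 + i
      omega

/-- The comparison morphism `[0] ⋆ (x ⋆ y) ⋆ [0] ⟶ ([0] ⋆ x ⋆ [0]) + ([0] ⋆ y ⋆ [0])`. -/
def narrowComul (x y : AugmentedSimplexCategory) :
    narrow.obj (x ⊗ y) ⟶ narrow.obj x ⊗ narrow.obj y :=
  coface (narrow.obj x).len (narrow_tensor_len x y) (narrow_len_pos x) (narrow_len_le x y)

theorem val_narrowComul (x y : AugmentedSimplexCategory) {i : ℕ}
    (hi : i ≤ (narrow.obj (x ⊗ y)).len) :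
    Hom.val (narrowComul x y) i = if i < (narrow.obj x).len then i else i + 1 :=
  val_mkHom _ _ _ _ hi

/-- The two inclusions into the join cover all its points, and their compatibility with the tensor
product of morphisms determines every value. -/
theorem val_narrow_tensorHom {x y x' y' : AugmentedSimplexCategory} (f : x ⟶ y) (g : x' ⟶ y')
    {i : ℕ} (hi : i ≤ (narrow.obj (x ⊗ x')).len) :
    Hom.val (narrow.map (f ⊗ₘ g)) i = if i < (narrow.obj x).len then Hom.val (narrow.map f) i else
      (narrow.obj y).len - 1 + Hom.val (narrow.map g) (i + 1 - (narrow.obj x).len) := by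
  have hl := narrow_tensor_len' x x'
  have hx := narrow_len_pos x
  have hl' := narrow_tensor_len' y y'
  have hy := narrow_len_pos y
  split_ifs with h
  · have e := congrArg (fun t => Hom.val (narrow.map t) i)
      (AugmentedSimplexCategory.inl_comp_tensorHom f g)
    simp only [Functor.map_comp, val_comp, val_narrow_inl x x' h] at e
    rw [e]
    rcases Nat.eq_zero_or_pos i with rfl | h0
    · rw [val_zero, val_zero]
    · exact val_narrow_inl y y' (narrow_val_interior f h0 h).2
  · have e := congrArg (fun t => Hom.val (narrow.map t) (i + 1 - (narrow.obj x).len))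
      (AugmentedSimplexCategory.inr_comp_tensorHom f g)
    simp only [Functor.map_comp, val_comp] at e
    rw [val_narrow_inr x x' (by omega) (by omega)] at e
    have h₁ : (narrow.obj x).len - 1 + (i + 1 - (narrow.obj x).len) = i := by omega
    rw [h₁] at e
    rw [e]
    refine val_narrow_inr y y' ?_ (val_le _ _)
    rcases Nat.eq_or_lt_of_le (show i + 1 - (narrow.obj x).len ≤ (narrow.obj x').len by omega)
      with h₂ | h₂
    · rw [h₂, val_len]
      exact narrow_len_pos y'
    · exact (narrow_val_interior g (by omega) h₂).1

theorem val_toUnit (n : FiniteInterval) (i : ℕ) : Hom.val (toUnit n) i = 0 :=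
  Nat.le_zero.1 (val_le (toUnit n) i)

theorem narrowComul_natural {x y x' y' : AugmentedSimplexCategory} (f : x ⟶ y) (g : x' ⟶ y') :
    narrowComul x x' ≫ (narrow.map f ⊗ₘ narrow.map g) =
      narrow.map (f ⊗ₘ g) ≫ narrowComul y y' := by
  refine hom_ext_val fun i hi => ?_
  have hl := narrow_tensor_len' x x'
  have hx := narrow_len_pos x
  have hy := narrow_len_pos y
  rw [val_comp, val_comp, val_narrowComul x x' hi, val_tensorHom,
    val_narrowComul y y' (val_le _ _), val_narrow_tensorHom f g hi]
  by_cases h : i < (narrow.obj x).len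
  · rw [if_pos h, if_pos h, if_pos h.le, if_pos]
    rcases Nat.eq_zero_or_pos i with rfl | h0
    · rw [val_zero]
      exact hy
    · exact (narrow_val_interior f h0 h).2
  · have h₂ : 0 < Hom.val (narrow.map g) (i + 1 - (narrow.obj x).len) := by
      rcases Nat.eq_or_lt_of_le (show i + 1 - (narrow.obj x).len ≤ (narrow.obj x').len by omega)
        with h₂ | h₂
      · rw [h₂, val_len]
        exact narrow_len_pos y'
      · exact (narrow_val_interior g (by omega) h₂).1
    rw [if_neg h, if_neg h, if_neg (by omega), if_neg (by omega)]
    omega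

theorem val_associator_inv (m n p : FiniteInterval) (i : ℕ) :
    Hom.val (α_ m n p).inv i = min i (m ⊗ n ⊗ p).len :=
  val_of_isIso _ i

/-- Both sides omit exactly the two points at which consecutive intervals are glued; the three cases
are the possible positions of `i` relative to these. -/
theorem narrowComul_coassoc (x y z : AugmentedSimplexCategory) :
    narrow.map (α_ x y z).inv ≫ narrowComul (x ⊗ y) z ≫
        (narrowComul x y ⊗ₘ 𝟙 (narrow.obj z)) =
      narrowComul x (y ⊗ z) ≫ (𝟙 (narrow.obj x) ⊗ₘ narrowComul y z) ≫ (α_ _ _ _).inv := by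
  refine hom_ext_val fun i hi => ?_
  have h₁ := narrow_tensor_len' x y
  have h₂ := narrow_tensor_len' y z
  have h₃ := narrow_tensor_len' (x ⊗ y) z
  have h₄ := narrow_tensor_len' x (y ⊗ z)
  have hx := narrow_len_pos x
  have hy := narrow_len_pos y
  have hz := narrow_len_pos z
  rw [val_comp, val_comp, val_comp, val_comp, val_associator_inv,
    val_of_isIso (narrow.map (α_ x y z).inv), min_eq_left hi,
    val_narrowComul _ _ (by omega), val_tensorHom, val_narrowComul _ _ hi, val_tensorHom,
    val_id, val_id]
  simp only [tensorObj_len]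
  by_cases hb : i < (narrow.obj (x ⊗ y)).len
  · rw [if_pos hb, if_pos hb.le, val_narrowComul x y hb.le]
    by_cases ha : i < (narrow.obj x).len
    · rw [if_pos ha, if_pos ha.le]
      omega
    · rw [if_neg ha, if_neg (show ¬ i + 1 ≤ (narrow.obj x).len by omega),
        val_narrowComul y z (by omega), if_pos (by omega)]
      omega
  · rw [if_neg hb, if_neg (show ¬ i + 1 ≤ (narrow.obj (x ⊗ y)).len by omega),
      if_neg (show ¬ i < (narrow.obj x).len by omega),
      if_neg (show ¬ i + 1 ≤ (narrow.obj x).len by omega),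
      val_narrowComul y z (by omega), if_neg (by omega)]
    omega

theorem narrowComul_counit_left (x : AugmentedSimplexCategory) :
    narrow.map (λ_ x).inv ≫ narrowComul (𝟙_ AugmentedSimplexCategory) x ≫
        (toUnit _ ⊗ₘ 𝟙 (narrow.obj x)) = (λ_ (narrow.obj x)).inv := by
  refine hom_ext_val fun i hi => ?_
  have h₁ := narrow_tensor_len' (𝟙_ AugmentedSimplexCategory) x
  have h₂ : (narrow.obj (𝟙_ AugmentedSimplexCategory)).len = 1 := rfl
  rw [val_comp, val_comp, val_of_isIso (narrow.map (λ_ x).inv), val_of_isIso (λ_ _).inv,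
    min_eq_left hi, val_narrowComul _ _ (by omega), val_tensorHom, val_toUnit, val_id, tensorUnit_len]
  split_ifs <;> omega

theorem narrowComul_counit_right (x : AugmentedSimplexCategory) :
    narrow.map (ρ_ x).inv ≫ narrowComul x (𝟙_ AugmentedSimplexCategory) ≫
        (𝟙 (narrow.obj x) ⊗ₘ toUnit _) = (ρ_ (narrow.obj x)).inv := by
  refine hom_ext_val fun i hi => ?_
  have h₁ := narrow_tensor_len' x (𝟙_ AugmentedSimplexCategory)
  have h₂ : (narrow.obj (𝟙_ AugmentedSimplexCategory)).len = 1 := rfl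
  rw [val_comp, val_comp, val_of_isIso (narrow.map (ρ_ x).inv), val_of_isIso (ρ_ _).inv,
    min_eq_left hi, val_narrowComul _ _ (by omega), val_tensorHom, val_toUnit, val_id]
  split_ifs <;> omega

/-- The structure is not strong: `narrowComul` omits the gluing point, which does not come from an
element of either simplex. -/
instance narrowOpLaxMonoidal : narrow.op.LaxMonoidal :=
  Functor.LaxMonoidal.ofTensorHom
    (ε := (toUnit (narrow.obj (𝟙_ AugmentedSimplexCategory))).op)
    (μ := fun X Y => (narrowComul X.unop Y.unop).op)
    (μ_natural := fun f g => Quiver.Hom.unop_inj (narrowComul_natural f.unop g.unop))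
    (associativity := fun X Y Z => Quiver.Hom.unop_inj
      ((Category.assoc _ _ _).trans (narrowComul_coassoc X.unop Y.unop Z.unop) |>.trans
        (Category.assoc _ _ _).symm))
    (left_unitality := fun X => Quiver.Hom.unop_inj
      ((Category.assoc _ _ _).trans (narrowComul_counit_left X.unop)).symm)
    (right_unitality := fun X => Quiver.Hom.unop_inj
      ((Category.assoc _ _ _).trans (narrowComul_counit_right X.unop)).symm)

end FiniteInterval

/-! ### Lists of augmented simplices as subdivided intervals -/

namespace FiniteInterval

/-- With `exists_narrow_obj_len`, augmented simplices correspond to positive integers, so a list of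
them is a composition of its total length into positive parts. -/
theorem narrow_obj_len_injective {x y : AugmentedSimplexCategory}
    (h : (narrow.obj x).len = (narrow.obj y).len) : x = y := by
  cases x with
  | star =>
    cases y with
    | star => rfl
    | of y =>
      have : 1 = y.len + 2 := h
      omega
  | of x =>
    cases y with
    | star =>
      have : x.len + 2 = 1 := h
      omega
    | of y =>
      have : x.len + 2 = y.len + 2 := h
      exact congrArg WithInitial.of (SimplexCategory.ext (by omega))

theorem exists_narrow_obj_len {n : ℕ} (h : 0 < n) :
    ∃ x : AugmentedSimplexCategory, (narrow.obj x).len = n := by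
  obtain _ | _ | n := n
  · omega
  · exact ⟨WithInitial.star, rfl⟩
  · exact ⟨WithInitial.of (SimplexCategory.mk n), rfl⟩

/-- The length of the concatenation of the intervals `[0] ⋆ x ⋆ [0]` for `x` in a list. -/
abbrev listLen (l : List AugmentedSimplexCategoryᵒᵖ) : ℕ := (listTensor narrow.op l).unop.len

theorem listLen_nil : listLen [] = 0 := rfl

theorem listLen_cons (x : AugmentedSimplexCategoryᵒᵖ) (l : List AugmentedSimplexCategoryᵒᵖ) :
    listLen (x :: l) = (narrow.obj x.unop).len + listLen l := rfl

theorem listLen_append (l₁ l₂ : List AugmentedSimplexCategoryᵒᵖ) :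
    listLen (l₁ ++ l₂) = listLen l₁ + listLen l₂ := by
  induction l₁ with
  | nil => simp [listLen_nil]
  | cons x l ih => rw [List.cons_append, listLen_cons, listLen_cons, ih, Nat.add_assoc]

theorem eq_nil_of_listLen_eq_zero {l : List AugmentedSimplexCategoryᵒᵖ} (h : listLen l = 0) :
    l = [] := by
  cases l with
  | nil => rfl
  | cons x l =>
    rw [listLen_cons] at h
    have := narrow_len_pos x.unop
    omega

/-- All parts are positive, so a prefix of a given list is determined by its total length. -/
theorem append_inj_of_listLen {l₁ l₂ l₁' l₂' : List AugmentedSimplexCategoryᵒᵖ}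
    (h : l₁ ++ l₂ = l₁' ++ l₂') (hl : listLen l₁ = listLen l₁') : l₁ = l₁' ∧ l₂ = l₂' := by
  induction l₁ generalizing l₁' with
  | nil =>
    obtain rfl := eq_nil_of_listLen_eq_zero hl.symm
    exact ⟨rfl, h⟩
  | cons x l ih =>
    cases l₁' with
    | nil => exact absurd (eq_nil_of_listLen_eq_zero hl) (List.cons_ne_nil _ _)
    | cons y l' =>
      simp only [List.cons_append, List.cons.injEq] at h
      obtain ⟨rfl, h⟩ := h
      rw [listLen_cons, listLen_cons] at hl
      obtain ⟨rfl, rfl⟩ := ih h (by omega)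
      exact ⟨rfl, rfl⟩

/-- The endpoints of the intervals `[0] ⋆ x ⋆ [0]`, for `x` in a list, in their concatenation. -/
def cuts : List AugmentedSimplexCategoryᵒᵖ → ℕ → Prop
  | [], i => i = 0
  | x :: l, i => i = 0 ∨ ((narrow.obj x.unop).len ≤ i ∧ cuts l (i - (narrow.obj x.unop).len))

theorem cuts_zero (l : List AugmentedSimplexCategoryᵒᵖ) : cuts l 0 := by
  cases l with
  | nil => rfl
  | cons x l => exact Or.inl rfl

theorem cuts_cons_add (x : AugmentedSimplexCategoryᵒᵖ) (l : List AugmentedSimplexCategoryᵒᵖ)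
    (i : ℕ) : cuts (x :: l) ((narrow.obj x.unop).len + i) ↔ cuts l i := by
  have hx := narrow_len_pos x.unop
  simp only [cuts, Nat.add_sub_cancel_left]
  constructor
  · rintro (h | h)
    · omega
    · exact h.2
  · intro h
    exact Or.inr ⟨by omega, h⟩

theorem not_cuts_cons {x : AugmentedSimplexCategoryᵒᵖ} {l : List AugmentedSimplexCategoryᵒᵖ}
    {i : ℕ} (h0 : 0 < i) (h : i < (narrow.obj x.unop).len) : ¬ cuts (x :: l) i := by
  rintro (h' | h')
  · omega
  · have := h'.1
    omega

theorem cuts_append_add (l₁ l₂ : List AugmentedSimplexCategoryᵒᵖ) (i : ℕ) :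
    cuts (l₁ ++ l₂) (listLen l₁ + i) ↔ cuts l₂ i := by
  induction l₁ with
  | nil => rw [listLen_nil, Nat.zero_add, List.nil_append]
  | cons x l ih => rw [listLen_cons, List.cons_append, Nat.add_assoc, cuts_cons_add, ih]

theorem cuts_append_of_le {l₁ l₂ : List AugmentedSimplexCategoryᵒᵖ} {i : ℕ} (h : i ≤ listLen l₁) :
    cuts (l₁ ++ l₂) i ↔ cuts l₁ i := by
  induction l₁ generalizing i with
  | nil =>
    obtain rfl : i = 0 := Nat.le_zero.1 h
    simp [cuts_zero]
  | cons x l ih =>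
    rcases Nat.lt_or_ge i (narrow.obj x.unop).len with hi | hi
    · rcases Nat.eq_zero_or_pos i with rfl | h0
      · simp [cuts_zero]
      · exact iff_of_false (not_cuts_cons h0 hi) (not_cuts_cons h0 hi)
    · obtain ⟨j, rfl⟩ := Nat.exists_eq_add_of_le hi
      rw [listLen_cons] at h
      rw [List.cons_append, cuts_cons_add, cuts_cons_add, ih (by omega)]

theorem cuts_listLen (l : List AugmentedSimplexCategoryᵒᵖ) : cuts l (listLen l) := by
  have := (cuts_append_add l [] 0).2 rfl
  simpa using this

theorem exists_append_of_cuts {l : List AugmentedSimplexCategoryᵒᵖ} {i : ℕ} (h : cuts l i) :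
    ∃ l₁ l₂, l = l₁ ++ l₂ ∧ listLen l₁ = i := by
  induction l generalizing i with
  | nil =>
    obtain rfl : i = 0 := h
    exact ⟨[], [], rfl, rfl⟩
  | cons x l ih =>
    rcases h with rfl | ⟨h₁, h₂⟩
    · exact ⟨[], x :: l, rfl, rfl⟩
    · obtain ⟨l₁, l₂, rfl, h₃⟩ := ih h₂
      refine ⟨x :: l₁, l₂, rfl, ?_⟩
      rw [listLen_cons]
      omega

/-- A composition is determined by its partial sums: the smallest positive cut is the first part,
and the rest follows by induction. -/
theorem eq_of_cuts {l l' : List AugmentedSimplexCategoryᵒᵖ} (hl : listLen l = listLen l')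
    (h : ∀ i ≤ listLen l, cuts l i ↔ cuts l' i) : l = l' := by
  induction l generalizing l' with
  | nil => exact (eq_nil_of_listLen_eq_zero hl.symm).symm
  | cons x l ih =>
    cases l' with
    | nil => exact eq_nil_of_listLen_eq_zero hl
    | cons y l' =>
      rw [listLen_cons, listLen_cons] at hl
      have hx := narrow_len_pos x.unop
      have hy := narrow_len_pos y.unop
      have hx' := (cuts_cons_add x l 0).2 (cuts_zero l)
      have hy' := (cuts_cons_add y l' 0).2 (cuts_zero l')
      rw [Nat.add_zero] at hx' hy'
      have hxy : (narrow.obj x.unop).len = (narrow.obj y.unop).len := by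
        rcases Nat.lt_trichotomy (narrow.obj x.unop).len (narrow.obj y.unop).len with h' | h' | h'
        · exact absurd ((h _ (by rw [listLen_cons]; omega)).1 hx') (not_cuts_cons hx h')
        · exact h'
        · exact absurd ((h _ (by rw [listLen_cons]; omega)).2 hy') (not_cuts_cons hy h')
      obtain rfl : x = y := Opposite.unop_injective (narrow_obj_len_injective hxy)
      rw [ih (l' := l') (by omega) fun i hi => ?_]
      have := h ((narrow.obj x.unop).len + i) (by rw [listLen_cons]; omega)
      rwa [cuts_cons_add, cuts_cons_add] at this

/-- The number of elements of `[0] ⋆ (x₁ ⋆ ... ⋆ xₙ) ⋆ [0]`, minus one. -/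
abbrev joinLen (l : List AugmentedSimplexCategoryᵒᵖ) : ℕ :=
  (narrow.obj (listTensor (𝟭 AugmentedSimplexCategoryᵒᵖ) l).unop).len

theorem joinLen_nil : joinLen [] = 1 := rfl

theorem joinLen_cons (x : AugmentedSimplexCategoryᵒᵖ) (l : List AugmentedSimplexCategoryᵒᵖ) :
    (narrow.obj x.unop).len + joinLen l = joinLen (x :: l) + 1 :=
  narrow_tensor_len' _ _

/-- The values of the comparison morphism from `[0] ⋆ (x₁ ⋆ ... ⋆ xₙ) ⋆ [0]` to the concatenation
of the intervals `[0] ⋆ xᵢ ⋆ [0]`. -/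
def joinVal (l : List AugmentedSimplexCategoryᵒᵖ) (i : ℕ) : ℕ :=
  Hom.val (listMul narrow.op l).unop i

theorem joinVal_zero (l : List AugmentedSimplexCategoryᵒᵖ) : joinVal l 0 = 0 := val_zero _

theorem joinVal_joinLen (l : List AugmentedSimplexCategoryᵒᵖ) :
    joinVal l (joinLen l) = listLen l := val_len _

theorem joinVal_le (l : List AugmentedSimplexCategoryᵒᵖ) (i : ℕ) : joinVal l i ≤ listLen l :=
  val_le _ _

theorem val_narrowComul_comp {x y : AugmentedSimplexCategory} {n : FiniteInterval}
    (d : narrow.obj y ⟶ n) {i : ℕ} (hi : i ≤ (narrow.obj (x ⊗ y)).len) :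
    Hom.val (narrowComul x y ≫ (𝟙 (narrow.obj x) ⊗ₘ d)) i = if i < (narrow.obj x).len then i else
      (narrow.obj x).len + Hom.val d (i + 1 - (narrow.obj x).len) := by
  rw [val_comp, val_narrowComul _ _ hi, val_tensorHom, val_id]
  by_cases hi' : i < (narrow.obj x).len
  · rw [if_pos hi', if_pos hi', if_pos hi'.le, min_eq_left hi'.le]
  · rw [if_neg hi', if_neg hi', if_neg (by omega)]

theorem joinVal_cons (x : AugmentedSimplexCategoryᵒᵖ) (l : List AugmentedSimplexCategoryᵒᵖ)
    {i : ℕ} (hi : i ≤ joinLen (x :: l)) :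
    joinVal (x :: l) i = if i < (narrow.obj x.unop).len then i else
      (narrow.obj x.unop).len + joinVal l (i + 1 - (narrow.obj x.unop).len) := by
  have h : (listMul narrow.op (x :: l)).unop =
      narrowComul x.unop (listTensor (𝟭 AugmentedSimplexCategoryᵒᵖ) l).unop ≫
        (𝟙 (narrow.obj x.unop) ⊗ₘ (listMul narrow.op l).unop) := by
    rw [listMul_cons, id_tensorHom]
    rfl
  exact (congrArg (Hom.val · i) h).trans (val_narrowComul_comp _ hi)

/-- With `exists_joinVal` and `joinVal_lt`, this gives an increasing bijection from the interior
points of the join to the points of the concatenation that are not cuts. -/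
theorem not_cuts_joinVal {l : List AugmentedSimplexCategoryᵒᵖ} {i : ℕ} (h0 : 0 < i)
    (hi : i < joinLen l) : ¬ cuts l (joinVal l i) := by
  induction l generalizing i with
  | nil =>
    rw [joinLen_nil] at hi
    omega
  | cons x l ih =>
    have h := joinLen_cons x l
    rw [joinVal_cons x l hi.le]
    split_ifs with hx
    · exact not_cuts_cons h0 hx
    · rw [cuts_cons_add]
      exact ih (by omega) (by omega)

theorem exists_joinVal {l : List AugmentedSimplexCategoryᵒᵖ} {j : ℕ} (hj : ¬ cuts l j)
    (h : j < listLen l) : ∃ i, 0 < i ∧ i < joinLen l ∧ joinVal l i = j := by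
  induction l generalizing j with
  | nil =>
    rw [listLen_nil] at h
    omega
  | cons x l ih =>
    have hl := joinLen_cons x l
    have hx0 := narrow_len_pos x.unop
    have h0 : 0 < j := by
      rcases Nat.eq_zero_or_pos j with rfl | h0
      · exact absurd (cuts_zero _) hj
      · exact h0
    have hl' : 0 < joinLen l := narrow_len_pos _
    rcases Nat.lt_or_ge j (narrow.obj x.unop).len with hx | hx
    · refine ⟨j, h0, by omega, ?_⟩
      rw [joinVal_cons x l (by omega), if_pos hx]
    · obtain ⟨k, rfl⟩ := Nat.exists_eq_add_of_le hx
      rw [cuts_cons_add] at hj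
      rw [listLen_cons] at h
      obtain ⟨i, hi0, hi, rfl⟩ := ih hj (by omega)
      -- Passing the first block shifts values by its length but indices by one less, since the cut
      -- at its end is omitted.
      refine ⟨(narrow.obj x.unop).len + i - 1, by omega, by omega, ?_⟩
      rw [joinVal_cons x l (by omega), if_neg (by omega)]
      congr 2
      omega

theorem joinVal_lt {l : List AugmentedSimplexCategoryᵒᵖ} {i j : ℕ} (h0 : 0 < i) (hij : i < j)
    (hj : j < joinLen l) : joinVal l i < joinVal l j := by
  induction l generalizing i j with
  | nil =>
    rw [joinLen_nil] at hj
    omega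
  | cons x l ih =>
    have hl := joinLen_cons x l
    rw [joinVal_cons x l (by omega), joinVal_cons x l hj.le]
    split_ifs
    · exact hij
    · omega
    · omega
    · exact Nat.add_lt_add_left (ih (by omega) (by omega) (by omega)) _

theorem eq_of_joinVal_eq {l : List AugmentedSimplexCategoryᵒᵖ} {i j : ℕ} (hi : 0 < i)
    (hi' : i < joinLen l) (hj : 0 < j) (hj' : j < joinLen l) (h : joinVal l i = joinVal l j) :
    i = j := by
  rcases Nat.lt_trichotomy i j with h' | h' | h'
  · have := joinVal_lt hi h' hj'
    omega
  · exact h'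
  · have := joinVal_lt hj h' hi'
    omega

/-- The values of the morphism of finite intervals underlying a morphism of lists of augmented
simplices. -/
def listHomVal {l l' : List AugmentedSimplexCategoryᵒᵖ} (e : ListHom l l') (i : ℕ) : ℕ :=
  Hom.val (e.map narrow.op).unop i

theorem listHomVal_zero {l l' : List AugmentedSimplexCategoryᵒᵖ} (e : ListHom l l') :
    listHomVal e 0 = 0 := val_zero _

theorem val_tensorHom_comp_isIso {a b b' c d e : FiniteInterval} (f : a ⟶ b) (f' : b ⟶ b')
    (g : c ⟶ d) (s : b' ⊗ d ⟶ e) [IsIso s] (i : ℕ) :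
    Hom.val (((f ≫ f') ⊗ₘ g) ≫ s) i = if i ≤ a.len then Hom.val f' (Hom.val f i) else
      b'.len + Hom.val g (i - a.len) := by
  rw [val_comp, val_of_isIso s, min_eq_left (val_le _ _), val_tensorHom, val_comp]

theorem listHomVal_cons {l₁ l₂ l' : List AugmentedSimplexCategoryᵒᵖ}
    {x : AugmentedSimplexCategoryᵒᵖ}
    (f : listTensor (𝟭 AugmentedSimplexCategoryᵒᵖ) l₁ ⟶ x) (g : ListHom l₂ l') (i : ℕ) :
    listHomVal (ListHom.cons f g) i = if i ≤ (narrow.obj x.unop).len then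
      joinVal l₁ (Hom.val (narrow.map f.unop) i) else
      listLen l₁ + listHomVal g (i - (narrow.obj x.unop).len) := by
  have h : ((ListHom.cons f g).map narrow.op).unop =
      ((narrow.map f.unop ≫ (listMul narrow.op l₁).unop) ⊗ₘ (g.map narrow.op).unop) ≫
        (listTensorAppend narrow.op l₁ l₂).hom.unop := rfl
  exact (congrArg (Hom.val · i) h).trans (val_tensorHom_comp_isIso _ _ _ _ _)

/-- The cuts of the target list are the preimage of the cuts of the source list: ends of blocks go
to ends of blocks, and interior points go to interior points of a join, hence to points that are not
cuts. This forces the target list of a lift. -/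
theorem cuts_listHomVal {l l' : List AugmentedSimplexCategoryᵒᵖ} (e : ListHom l l') {i : ℕ}
    (hi : i ≤ listLen l') : cuts l' i ↔ cuts l (listHomVal e i) := by
  induction e generalizing i with
  | nil =>
    obtain rfl : i = 0 := Nat.le_zero.1 hi
    rw [listHomVal_zero]
  | @cons l₁ l₂ l' x f g ih =>
    rw [listHomVal_cons]
    rw [listLen_cons] at hi
    rcases Nat.eq_zero_or_pos i with rfl | h0
    · rw [if_pos (Nat.zero_le _), val_zero, joinVal_zero]
      exact iff_of_true (cuts_zero _) (cuts_zero _)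
    rcases Nat.lt_or_ge i (narrow.obj x.unop).len with hx | hx
    · rw [if_pos hx.le, cuts_append_of_le (joinVal_le _ _)]
      have := narrow_val_interior f.unop h0 hx
      exact iff_of_false (not_cuts_cons h0 hx) (not_cuts_joinVal this.1 this.2)
    · obtain ⟨j, rfl⟩ := Nat.exists_eq_add_of_le hx
      rw [cuts_cons_add]
      split_ifs with h
      · obtain rfl : j = 0 := by omega
        rw [Nat.add_zero, val_len]
        refine iff_of_true (cuts_zero _) ?_
        have h' := (cuts_append_add l₁ l₂ 0).2 (cuts_zero _)
        rwa [Nat.add_zero, ← joinVal_joinLen] at h'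
      · rw [cuts_append_add, Nat.add_sub_cancel_left]
        exact ih (by omega)

theorem listHom_nil_eq {l : List AugmentedSimplexCategoryᵒᵖ} (e : ListHom l []) (h : [] = l) :
    ListHom.nil = ListHom.cast h e := by
  cases e
  rfl

/-- Separate sources `l₁` and `l₂` allow both maps to be destructed. The value at the end of the
first target block determines where the source is split, injectivity of `joinVal` on interior points
recovers the first component, and the remainder is handled by induction. -/
theorem listHom_ext_aux {l₁ l₂ l' : List AugmentedSimplexCategoryᵒᵖ} (h : l₁ = l₂)
    (e : ListHom l₁ l') (e' : ListHom l₂ l')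
    (he : ∀ i ≤ listLen l', listHomVal e i = listHomVal e' i) : e = ListHom.cast h e' := by
  induction e generalizing l₂ with
  | nil => exact listHom_nil_eq e' h
  | @cons l₁ l₂' l' x f g ih =>
    cases e' with
    | @cons m₁ m₂ _ _ f' g' =>
    have hx := he (narrow.obj x.unop).len (by rw [listLen_cons]; omega)
    rw [listHomVal_cons, listHomVal_cons, if_pos le_rfl, if_pos le_rfl, val_len, val_len] at hx
    have hx' : listLen l₁ = listLen m₁ :=
      (joinVal_joinLen l₁).symm.trans (hx.trans (joinVal_joinLen m₁))
    obtain ⟨rfl, rfl⟩ := append_inj_of_listLen h hx'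
    have hf : f = f' := by
      refine Quiver.Hom.unop_inj (narrow_map_injective (hom_ext_val fun i hi => ?_))
      have hv := he i (by rw [listLen_cons]; exact hi.trans (Nat.le_add_right _ _))
      rw [listHomVal_cons, listHomVal_cons, if_pos hi, if_pos hi] at hv
      rcases Nat.eq_zero_or_pos i with rfl | h0
      · rw [val_zero, val_zero]
      rcases Nat.eq_or_lt_of_le hi with rfl | hi
      · rw [val_len, val_len]
      · have h₁ := narrow_val_interior f.unop h0 hi
        have h₂ := narrow_val_interior f'.unop h0 hi
        exact eq_of_joinVal_eq h₁.1 h₁.2 h₂.1 h₂.2 hv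
    have hg : g = g' := by
      refine ih rfl g' fun i hi => ?_
      rcases Nat.eq_zero_or_pos i with rfl | h0
      · rw [listHomVal_zero, listHomVal_zero]
      have hv := he ((narrow.obj x.unop).len + i) (by rw [listLen_cons]; omega)
      rw [listHomVal_cons, listHomVal_cons, if_neg (by omega), if_neg (by omega),
        Nat.add_sub_cancel_left] at hv
      omega
    rw [hf, hg]
    rfl

theorem listHom_ext {l l' : List AugmentedSimplexCategoryᵒᵖ} {e e' : ListHom l l'}
    (he : ∀ i ≤ listLen l', listHomVal e i = listHomVal e' i) : e = e' :=
  listHom_ext_aux rfl e e' he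

/-- Lifting for a single block: interior values avoid the cuts, so they lift through the bijection
between interior points of the join and points that are not cuts, and the endpoints go to the
endpoints. -/
theorem exists_joinVal_factor {l : List AugmentedSimplexCategoryᵒᵖ} {x : AugmentedSimplexCategory}
    {F : ℕ → ℕ} (hF : ∀ i j, i ≤ j → j ≤ (narrow.obj x).len → F i ≤ F j) (h0 : F 0 = 0)
    (h1 : F (narrow.obj x).len = listLen l)
    (hc : ∀ i, 0 < i → i < (narrow.obj x).len → ¬ cuts l (F i)) :
    ∃ f : listTensor (𝟭 AugmentedSimplexCategoryᵒᵖ) l ⟶ op x,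
      ∀ i ≤ (narrow.obj x).len, joinVal l (Hom.val (narrow.map f.unop) i) = F i := by
  -- The lift is specified for every natural number, with the top endpoint as value from the end of
  -- the block onwards, so that it can be chosen as a total function.
  have hk : ∀ i, ∃ k, (i = 0 → k = 0) ∧ ((narrow.obj x).len ≤ i → k = joinLen l) ∧
      (0 < i → i < (narrow.obj x).len → 0 < k ∧ k < joinLen l ∧ joinVal l k = F i) := by
    have hx := narrow_len_pos x
    intro i
    rcases Nat.eq_zero_or_pos i with rfl | h
    · exact ⟨0, fun _ => rfl, fun _ => by omega, fun _ => by omega⟩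
    rcases Nat.lt_or_ge i (narrow.obj x).len with h' | h'
    · have hi := hc i h h'
      have hle := hF i _ h'.le le_rfl
      have hne : F i ≠ listLen l := fun e => hi (e ▸ cuts_listLen l)
      obtain ⟨k, hk⟩ := exists_joinVal hi (by omega)
      exact ⟨k, fun _ => by omega, fun _ => by omega, fun _ _ => hk⟩
    · exact ⟨joinLen l, fun _ => by omega, fun _ => rfl, fun _ _ => by omega⟩
  choose k hk0 hk1 hk using hk
  have hkle : ∀ i, k i ≤ joinLen l := by
    intro i
    rcases Nat.eq_zero_or_pos i with h | h
    · rw [hk0 i h]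
      exact Nat.zero_le _
    rcases Nat.lt_or_ge i (narrow.obj x).len with h' | h'
    · exact (hk i h h').2.1.le
    · exact (hk1 i h').le
  have hmono : ∀ i j, i ≤ j → j ≤ (narrow.obj x).len → k i ≤ k j := by
    intro i j hij hj
    rcases Nat.eq_zero_or_pos i with h | h
    · rw [hk0 i h]
      exact Nat.zero_le _
    rcases Nat.lt_or_ge j (narrow.obj x).len with h' | h'
    · have h₁ := hk i h (by omega)
      have h₂ := hk j (by omega) h'
      by_contra hlt
      have := joinVal_lt h₂.1 (not_le.1 hlt) h₁.2.1
      have := hF i j hij hj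
      omega
    · rw [hk1 j h']
      exact hkle i
  let h : narrow.obj x ⟶ narrow.obj (listTensor (𝟭 AugmentedSimplexCategoryᵒᵖ) l).unop :=
    mkHom k hmono (hk0 0 rfl) (hk1 _ le_rfl)
  have hh : ∀ i ≤ (narrow.obj x).len, Hom.val h i = k i := fun i hi => val_mkHom _ _ _ _ hi
  obtain ⟨f, hf⟩ := exists_narrow_map h (by
    intro i h₁ h₂
    rw [hh i h₂.le]
    exact ⟨(hk i h₁ h₂).1, (hk i h₁ h₂).2.1⟩)
  refine ⟨f.op, fun i hi => ?_⟩
  rw [Quiver.Hom.unop_op, hf, hh i hi]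
  rcases Nat.eq_zero_or_pos i with rfl | h₁
  · rw [hk0 0 rfl, h0, joinVal_zero]
  rcases Nat.eq_or_lt_of_le hi with rfl | h₂
  · rw [hk1 _ le_rfl, h1, joinVal_joinLen]
  · exact (hk i h₁ h₂).2.2

/-- Blocks are split off one at a time from the left, by strong induction on the length of the
source interval. -/
theorem exists_listHomVal_aux (m : ℕ) : ∀ {l : List AugmentedSimplexCategoryᵒᵖ} {F : ℕ → ℕ},
    (∀ i j, i ≤ j → j ≤ m → F i ≤ F j) → F 0 = 0 → F m = listLen l →
    ∃ (l' : List AugmentedSimplexCategoryᵒᵖ) (e : ListHom l l'), listLen l' = m ∧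
      ∀ i ≤ m, listHomVal e i = F i := by
  induction m using Nat.strong_induction_on with
  | h m ih =>
    intro l F hF h0 h1
    rcases Nat.eq_zero_or_pos m with rfl | hm
    · obtain rfl : l = [] := eq_nil_of_listLen_eq_zero (h1.symm.trans h0)
      refine ⟨[], ListHom.nil, rfl, fun i hi => ?_⟩
      obtain rfl : i = 0 := Nat.le_zero.1 hi
      rw [listHomVal_zero, h0]
    · classical
      -- The least positive point sent to a cut is the end of the first block; the top point `m`
      -- always qualifies.
      have hex : ∃ j, 0 < j ∧ j ≤ m ∧ cuts l (F j) := ⟨m, hm, le_rfl, h1 ▸ cuts_listLen l⟩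
      obtain ⟨hj0, hjm, hj⟩ := Nat.find_spec hex
      have hmin : ∀ i, 0 < i → i < Nat.find hex → ¬ cuts l (F i) := fun i h₁ h₂ h₃ =>
        Nat.find_min hex h₂ ⟨h₁, by omega, h₃⟩
      generalize Nat.find hex = j at hj0 hjm hj hmin
      obtain ⟨l₁, l₂, rfl, hl₁⟩ := exists_append_of_cuts hj
      obtain ⟨x, rfl⟩ := exists_narrow_obj_len hj0
      obtain ⟨f, hf⟩ := exists_joinVal_factor (l := l₁) (x := x)
        (fun i j hij hj => hF i j hij (by omega)) h0 hl₁.symm (fun i h₁ h₂ h₃ => by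
          have := hF i _ h₂.le hjm
          exact hmin i h₁ h₂ ((cuts_append_of_le (by omega)).2 h₃))
      rw [listLen_append] at h1
      -- The rest of the interval is translated so that it starts at `0`, both in the source and in
      -- the target.
      obtain ⟨l', e, hl', he⟩ := ih (m - (narrow.obj x).len) (by omega) (l := l₂)
        (F := fun i => F ((narrow.obj x).len + i) - F (narrow.obj x).len)
        (fun i j hij hj => Nat.sub_le_sub_right (hF _ _ (by omega) (by omega)) _)
        (by simp) (by
          rw [Nat.add_sub_cancel' hjm]
          omega)
      refine ⟨op x :: l', ListHom.cons f e, ?_, fun i hi => ?_⟩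
      · rw [listLen_cons]
        change (narrow.obj x).len + _ = _
        omega
      · rw [listHomVal_cons]
        change (if i ≤ (narrow.obj x).len then _ else _ + listHomVal e (i - (narrow.obj x).len)) = _
        split_ifs with hix
        · exact hf i hix
        · rw [he _ (by omega), hl₁, Nat.add_sub_cancel' (show (narrow.obj x).len ≤ i by omega)]
          have := hF (narrow.obj x).len i (by omega) hi
          omega

/-- Every morphism of finite intervals to the concatenation of a list lifts to a morphism of
lists. -/
theorem exists_listHomVal {l : List AugmentedSimplexCategoryᵒᵖ} {m n : FiniteInterval}
    (h : listLen l = n.len) (f : m ⟶ n) :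
    ∃ (l' : List AugmentedSimplexCategoryᵒᵖ) (e : ListHom l l'), listLen l' = m.len ∧
      ∀ i ≤ m.len, listHomVal e i = Hom.val f i :=
  exists_listHomVal_aux m.len (fun _ _ hij _ => val_mono f hij) (val_zero f)
    ((val_len f).trans h.symm)

/-- The lift of a morphism of finite intervals to a morphism of lists is unique. -/
theorem eq_of_listHomVal_eq {l l' l'' : List AugmentedSimplexCategoryᵒᵖ} {e : ListHom l l'}
    {e' : ListHom l l''} (h : listLen l' = listLen l'')
    (he : ∀ i ≤ listLen l', listHomVal e i = listHomVal e' i) : l' = l'' :=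
  eq_of_cuts h fun i hi => by
    rw [cuts_listHomVal e hi, cuts_listHomVal e' (hi.trans h.le), he i hi]

end FiniteInterval

/-! ### The Frobenius monoidal functor of a lax monoidal functor -/

namespace FiniteInterval

theorem listHomVal_id (l : List AugmentedSimplexCategoryᵒᵖ) (i : ℕ) :
    listHomVal (ListHom.id l) i = min i (listLen l) := by
  unfold listHomVal
  rw [ListHom.map_id]
  exact val_id _ _

theorem val_eq_of_isIso_comp {a b c d : FiniteInterval} {p : a ⟶ b} [IsIso p] {q : b ⟶ d}
    {r : a ⟶ c} {s : c ⟶ d} [IsIso s] (h : p ≫ q = r ≫ s) (i : ℕ) :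
    Hom.val q i = Hom.val r i := by
  have := congrArg (Hom.val · i) h
  simp only [val_comp, val_of_isIso p, val_of_isIso s, min_eq_left (val_le r i)] at this
  rw [← this]
  rcases le_total i a.len with hi | hi
  · rw [min_eq_left hi]
  · rw [min_eq_right hi, len_eq_of_isIso p, val_len, val_of_len_le q
      ((len_eq_of_isIso p).symm.le.trans hi)]

theorem listHomVal_append {l₁ l₂ l₁' l₂' : List AugmentedSimplexCategoryᵒᵖ} (e₁ : ListHom l₁ l₁')
    (e₂ : ListHom l₂ l₂') (i : ℕ) :
    listHomVal (e₁.append e₂) i = if i ≤ listLen l₁' then listHomVal e₁ i else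
      listLen l₁ + listHomVal e₂ (i - listLen l₁') := by
  have h := congrArg Quiver.Hom.unop (ListHom.map_append narrow.op e₁ e₂)
  refine (val_eq_of_isIso_comp h i).trans ?_
  exact val_tensorHom (e₁.map narrow.op).unop (e₂.map narrow.op).unop i

/-- The subdivisions of the interval `[n]` into intervals of the form `[0] ⋆ x ⋆ [0]`. -/
abbrev Subdivision (n : ℕ) : Type := { l : List AugmentedSimplexCategoryᵒᵖ // listLen l = n }

/-- A subdivision is determined by its set of cuts among the finitely many points of `[n]`. -/
instance (n : ℕ) : Finite (Subdivision n) :=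
  Finite.of_injective (fun (l : Subdivision n) (i : Fin (n + 1)) => cuts l.1 i) fun l l' h =>
    Subtype.ext (eq_of_cuts (l.2.trans l'.2.symm) fun i hi => by
      rw [l.2] at hi
      exact iff_of_eq (congrFun h ⟨i, Nat.lt_succ_of_le hi⟩))

noncomputable instance (n : ℕ) : Fintype (Subdivision n) := Fintype.ofFinite _

end FiniteInterval

open FiniteInterval

/-! ### Sums over subdivisions: functoriality, multiplication, comultiplication -/

noncomputable section Frob

variable {V : Type u} [Category.{v} V] [MonoidalCategory V] [Preadditive V] [HasFiniteBiproducts V]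
  (M : AugmentedSimplexCategoryᵒᵖ ⥤ V)

/-- The sum, over all subdivisions of `[n]`, of the tensor products of the values of a functor. -/
def frobObj (n : ℕ) : V := ⨁ fun l : Subdivision n => listTensor M l.1

/-- The inclusion of the summand of a subdivision. -/
def frobInc (n : ℕ) (l : List AugmentedSimplexCategoryᵒᵖ) (h : listLen l = n) :
    listTensor M l ⟶ frobObj M n :=
  biproduct.ι (fun l : Subdivision n => listTensor M l.1) ⟨l, h⟩

/-- The projection to the summand of a subdivision. -/
def frobPrj (n : ℕ) (l : List AugmentedSimplexCategoryᵒᵖ) (h : listLen l = n) :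
    frobObj M n ⟶ listTensor M l :=
  biproduct.π (fun l : Subdivision n => listTensor M l.1) ⟨l, h⟩

/-- The morphism induced by morphisms from all summands. -/
def frobDesc {n : ℕ} {Z : V} (p : ∀ l, listLen l = n → (listTensor M l ⟶ Z)) : frobObj M n ⟶ Z :=
  biproduct.desc fun l : Subdivision n => p l.1 l.2

variable {M}

@[simp]
theorem frobInc_desc {n : ℕ} {Z : V} (p : ∀ l, listLen l = n → (listTensor M l ⟶ Z))
    (l : List AugmentedSimplexCategoryᵒᵖ) (h : listLen l = n) :
    frobInc M n l h ≫ frobDesc M p = p l h :=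
  biproduct.ι_desc _ _

theorem frobObj_hom_ext {n : ℕ} {Z : V} {f g : frobObj M n ⟶ Z}
    (h : ∀ l (hl : listLen l = n), frobInc M n l hl ≫ f = frobInc M n l hl ≫ g) : f = g :=
  biproduct.hom_ext' _ _ fun l => h l.1 l.2

theorem frobInc_prj_self (n : ℕ) (l : List AugmentedSimplexCategoryᵒᵖ) (h h' : listLen l = n) :
    frobInc M n l h ≫ frobPrj M n l h' = 𝟙 _ :=
  biproduct.ι_π_self _ _

theorem frobInc_prj_of_ne {n : ℕ} {l l' : List AugmentedSimplexCategoryᵒᵖ} (h : listLen l = n)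
    (h' : listLen l' = n) (hne : l ≠ l') : frobInc M n l h ≫ frobPrj M n l' h' = 0 :=
  biproduct.ι_π_ne _ fun e => hne (congrArg Subtype.val e)

variable (M) in
theorem frobObj_total (n : ℕ) :
    ∑ l : Subdivision n, frobPrj M n l.1 l.2 ≫ frobInc M n l.1 l.2 = 𝟙 (frobObj M n) :=
  biproduct.total

@[simp]
theorem listTensorCast_frobInc {n : ℕ} {l l' : List AugmentedSimplexCategoryᵒᵖ} (hl : l = l')
    (h : listLen l' = n) :
    listTensorCast M hl ≫ frobInc M n l' h = frobInc M n l (by rw [hl, h]) := by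
  subst hl
  simp

section map

variable [M.LaxMonoidal]

variable (M) in
/-- The functoriality of the sums over subdivisions. -/
def frobMap {m n : FiniteInterval} (f : m ⟶ n) : frobObj M n.len ⟶ frobObj M m.len :=
  frobDesc M fun _ h => (exists_listHomVal h f).choose_spec.choose.map M ≫
    frobInc M m.len _ (exists_listHomVal h f).choose_spec.choose_spec.1

/-- `frobMap` uses a chosen lift of `f`; uniqueness of lifts, for the target list and then for the
map of lists, allows any other lift to replace it. -/
theorem frobInc_map {m n : FiniteInterval} (f : m ⟶ n) {l l' : List AugmentedSimplexCategoryᵒᵖ}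
    (h : listLen l = n.len) (h' : listLen l' = m.len) (e : ListHom l l')
    (he : ∀ i ≤ m.len, listHomVal e i = Hom.val f i) :
    frobInc M n.len l h ≫ frobMap M f = e.map M ≫ frobInc M m.len l' h' := by
  unfold frobMap
  rw [frobInc_desc]
  generalize_proofs h₁ h₂ h₃
  have hv := h₂.choose_spec.2
  generalize h₂.choose = e' at hv
  generalize h₁.choose = l'' at *
  obtain rfl : l' = l'' := eq_of_listHomVal_eq (e := e) (e' := e') (h'.trans h₃.symm) fun i hi => by
    rw [he i (by omega), hv i (by omega)]
  rw [listHom_ext (e := e) (e' := e') fun i hi => by rw [he i (by omega), hv i (by omega)]]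

/-- An isomorphism of intervals lifts to the identity of each list, so it merely relabels summands.
This supplies the hypothesis `hG` of the coherence lemmas below. -/
theorem frobInc_map_of_isIso {m n : FiniteInterval} (f : m ⟶ n) [IsIso f]
    {l : List AugmentedSimplexCategoryᵒᵖ} (h : listLen l = n.len) (h' : listLen l = m.len) :
    frobInc M n.len l h ≫ frobMap M f = frobInc M m.len l h' := by
  rw [frobInc_map f h h' (ListHom.id l) fun i _ => by rw [listHomVal_id, val_of_isIso, h'],
    ListHom.map_id, Category.id_comp]

variable (M) in
/-- The functor on finite intervals given by the sums over subdivisions. -/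
def frobFunctor : FiniteIntervalᵒᵖ ⥤ V where
  obj n := frobObj M n.unop.len
  map f := frobMap M f.unop
  map_id n := frobObj_hom_ext fun l hl => by
    rw [Category.comp_id]
    exact frobInc_map_of_isIso (𝟙 n.unop) hl hl
  map_comp {a b c} f g := frobObj_hom_ext fun l hl => by
    obtain ⟨l', e, hl', he⟩ := exists_listHomVal hl f.unop
    obtain ⟨l'', e', hl'', he'⟩ := exists_listHomVal hl' g.unop
    obtain ⟨e'', h₁, h₂⟩ := ListHom.exists_comp M narrow.op e e'
    rw [reassoc_of% (frobInc_map f.unop hl hl' e he), frobInc_map g.unop hl' hl'' e' he',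
      frobInc_map (f ≫ g).unop hl hl'' e'' fun i hi => ?_, h₁, Category.assoc]
    unfold listHomVal
    rw [h₂, unop_comp, unop_comp, val_comp, val_comp]
    exact (congrArg _ (he' i hi)).trans (he _ (val_le _ _))

end map

section mul

/-- The tensor product is biadditive, so tensoring two resolutions of the identity expresses every
morphism through its restrictions to pairs of summands. -/
theorem frobObj_tensor_hom_ext [MonoidalPreadditive V] {m n : ℕ} {Z : V} {f g : frobObj M m ⊗ frobObj M n ⟶ Z}
    (h : ∀ a (ha : listLen a = m) b (hb : listLen b = n),
      (frobInc M m a ha ⊗ₘ frobInc M n b hb) ≫ f = (frobInc M m a ha ⊗ₘ frobInc M n b hb) ≫ g) :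
    f = g := by
  have key : ∀ k : frobObj M m ⊗ frobObj M n ⟶ Z, k = ∑ a : Subdivision m, ∑ b : Subdivision n,
      (frobPrj M m a.1 a.2 ⊗ₘ frobPrj M n b.1 b.2) ≫
        (frobInc M m a.1 a.2 ⊗ₘ frobInc M n b.1 b.2) ≫ k := by
    intro k
    conv_lhs => rw [← Category.id_comp k, ← id_tensorHom_id, ← frobObj_total M m,
      ← frobObj_total M n, sum_tensor, Preadditive.sum_comp]
    refine Finset.sum_congr rfl fun a _ => ?_
    rw [tensor_sum, Preadditive.sum_comp]
    refine Finset.sum_congr rfl fun b _ => ?_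
    rw [← tensorHom_comp_tensorHom, Category.assoc]
  rw [key f, key g]
  exact Finset.sum_congr rfl fun a _ => Finset.sum_congr rfl fun b _ => by rw [h]

variable (M) in
/-- The multiplication: the concatenation of subdivisions. -/
def frobMul (m n : ℕ) : frobObj M m ⊗ frobObj M n ⟶ frobObj M (m + n) :=
  ∑ a : Subdivision m, ∑ b : Subdivision n, (frobPrj M m a.1 a.2 ⊗ₘ frobPrj M n b.1 b.2) ≫
    (listTensorAppend M a.1 b.1).inv ≫ frobInc M (m + n) (a.1 ++ b.1)
      (by rw [listLen_append, a.2, b.2])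

variable (M) in
/-- The comultiplication: the deconcatenation of subdivisions. -/
def frobComul (m n : ℕ) : frobObj M (m + n) ⟶ frobObj M m ⊗ frobObj M n :=
  ∑ a : Subdivision m, ∑ b : Subdivision n, frobPrj M (m + n) (a.1 ++ b.1)
    (by rw [listLen_append, a.2, b.2]) ≫ (listTensorAppend M a.1 b.1).hom ≫
      (frobInc M m a.1 a.2 ⊗ₘ frobInc M n b.1 b.2)

theorem frobInc_mul [MonoidalPreadditive V] {m n : ℕ} {a b : List AugmentedSimplexCategoryᵒᵖ} (ha : listLen a = m)
    (hb : listLen b = n) :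
    (frobInc M m a ha ⊗ₘ frobInc M n b hb) ≫ frobMul M m n =
      (listTensorAppend M a b).inv ≫ frobInc M (m + n) (a ++ b)
        (by rw [listLen_append, ha, hb]) := by
  unfold frobMul
  rw [Preadditive.comp_sum, Finset.sum_eq_single ⟨a, ha⟩, Preadditive.comp_sum,
    Finset.sum_eq_single ⟨b, hb⟩]
  · rw [tensorHom_comp_tensorHom_assoc, frobInc_prj_self, frobInc_prj_self, id_tensorHom_id,
      Category.id_comp]
  · intro b' _ hb'
    rw [tensorHom_comp_tensorHom_assoc, frobInc_prj_of_ne hb b'.2 fun e => hb' (Subtype.ext e.symm),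
      MonoidalPreadditive.tensor_zero, zero_comp]
  · exact fun h => absurd (Finset.mem_univ _) h
  · intro a' _ ha'
    rw [Preadditive.comp_sum]
    refine Finset.sum_eq_zero fun b' _ => ?_
    rw [tensorHom_comp_tensorHom_assoc, frobInc_prj_of_ne ha a'.2 fun e => ha' (Subtype.ext e.symm),
      MonoidalPreadditive.zero_tensor, zero_comp]
  · exact fun h => absurd (Finset.mem_univ _) h

theorem frobInc_comul {m n : ℕ} {a b : List AugmentedSimplexCategoryᵒᵖ} (ha : listLen a = m)
    (hb : listLen b = n) (h : listLen (a ++ b) = m + n) :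
    frobInc M (m + n) (a ++ b) h ≫ frobComul M m n =
      (listTensorAppend M a b).hom ≫ (frobInc M m a ha ⊗ₘ frobInc M n b hb) := by
  unfold frobComul
  rw [Preadditive.comp_sum, Finset.sum_eq_single ⟨a, ha⟩, Preadditive.comp_sum,
    Finset.sum_eq_single ⟨b, hb⟩]
  · rw [reassoc_of% frobInc_prj_self (M := M)]
  · intro b' _ hb'
    rw [reassoc_of% (frobInc_prj_of_ne h _ fun e => hb' (Subtype.ext (List.append_cancel_left e).symm)),
      zero_comp]
  · exact fun h => absurd (Finset.mem_univ _) h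
  · intro a' _ ha'
    rw [Preadditive.comp_sum]
    refine Finset.sum_eq_zero fun b' _ => ?_
    rw [reassoc_of% (frobInc_prj_of_ne h _ fun e => ha' (Subtype.ext
      (append_inj_of_listLen e (ha.trans a'.2.symm)).1.symm)), zero_comp]
  · exact fun h => absurd (Finset.mem_univ _) h

/-- Without a cut at `m` the list is not a concatenation `a ++ b` with `a` of length `m`, so no
projection in the sum sees it. With `frobInc_comul`, comultiplication is the projection to the
subdivisions cut at `m`. -/
theorem frobInc_comul_eq_zero {m n : ℕ} {l : List AugmentedSimplexCategoryᵒᵖ}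
    (h : listLen l = m + n) (hl : ¬ cuts l m) : frobInc M (m + n) l h ≫ frobComul M m n = 0 := by
  unfold frobComul
  rw [Preadditive.comp_sum]
  refine Finset.sum_eq_zero fun a _ => ?_
  rw [Preadditive.comp_sum]
  refine Finset.sum_eq_zero fun b _ => ?_
  rw [reassoc_of% (frobInc_prj_of_ne (M := M) h (l' := a.1 ++ b.1) (by rw [listLen_append, a.2, b.2]) fun e => hl ?_), zero_comp]
  have := (cuts_append_add a.1 b.1 0).2 (cuts_zero _)
  rwa [← e, Nat.add_zero, a.2] at this

theorem exists_append_of_cuts' {m n : ℕ} {l : List AugmentedSimplexCategoryᵒᵖ}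
    (h : listLen l = m + n) (hl : cuts l m) : ∃ a b, l = a ++ b ∧ listLen a = m ∧ listLen b = n := by
  obtain ⟨a, b, rfl, ha⟩ := exists_append_of_cuts hl
  rw [listLen_append] at h
  exact ⟨a, b, rfl, ha, by omega⟩

end mul

end Frob

open FiniteInterval

/-! ### The monoidal structures on sums over subdivisions and the Frobenius laws -/

noncomputable section FrobStructure

variable {V : Type u} [Category.{v} V] [MonoidalCategory V] [Preadditive V]
  [HasFiniteBiproducts V] {M : AugmentedSimplexCategoryᵒᵖ ⥤ V}

variable (M) in
/-- The unit of the lax structure: the inclusion of the empty subdivision. -/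
def frobUnit : 𝟙_ V ⟶ frobObj M 0 := frobInc M 0 [] rfl

variable (M) in
/-- The counit of the colax structure: the projection to the empty subdivision. -/
def frobCounit : frobObj M 0 ⟶ 𝟙_ V := frobPrj M 0 [] rfl

theorem frobUnit_counit : frobUnit M ≫ frobCounit M = 𝟙 _ := frobInc_prj_self 0 [] rfl rfl

/-- The empty list is the only subdivision of `[0]`, so the inclusion and the projection of its
summand are mutually inverse. This is the strong unitality. -/
theorem frobCounit_unit : frobCounit M ≫ frobUnit M = 𝟙 _ :=
  frobObj_hom_ext fun l hl => by
    have h : ∀ l' (hl' : listLen l' = 0), l = l' →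
        frobInc M 0 l hl ≫ frobPrj M 0 l' hl' ≫ frobInc M 0 l' hl' = frobInc M 0 l hl := by
      rintro l' hl' rfl
      rw [reassoc_of% (frobInc_prj_self (M := M))]
    exact (h [] rfl (eq_nil_of_listLen_eq_zero hl)).trans (Category.comp_id _).symm

theorem frobInc_comul_zero_left {n : ℕ} {l : List AugmentedSimplexCategoryᵒᵖ} (h : listLen l = n)
    (h' : listLen l = 0 + n) : frobInc M (0 + n) l h' ≫ frobComul M 0 n =
      (λ_ _).inv ≫ (frobUnit M ⊗ₘ frobInc M n l h) :=
  frobInc_comul (a := []) rfl h h'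

theorem frobInc_comul_zero_right {n : ℕ} {l : List AugmentedSimplexCategoryᵒᵖ} (h : listLen l = n)
    (h' : listLen l = n + 0) : frobInc M (n + 0) l h' ≫ frobComul M n 0 =
      (ρ_ _).inv ≫ (frobInc M n l h ⊗ₘ frobUnit M) := by
  have key : ∀ {A B C D : V} {i : A ⟶ C} {i' : B ⟶ C} {c : A ⟶ B} {c' : B ⟶ A} {k : C ⟶ D}
      {t : A ⟶ B ⊗ 𝟙_ V} {w : B ⊗ 𝟙_ V ⟶ D}, i ≫ k = t ≫ w → c ≫ i' = i → c' ≫ c = 𝟙 _ →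
      t = c ≫ (ρ_ B).inv → i' ≫ k = (ρ_ B).inv ≫ w := by
    intro A B C D i i' c c' k t w h₁ h₂ h₃ h₄
    rw [← cancel_epi (𝟙 B), ← h₃, Category.assoc, reassoc_of% h₂, h₁, h₄]
    simp only [Category.assoc]
  have hl : listLen (l ++ []) = n + 0 := by
    rw [List.append_nil]
    exact h'
  exact key (frobInc_comul (b := []) h rfl hl) (listTensorCast_frobInc (List.append_nil l) h')
    (listTensorCast_trans M (List.append_nil l).symm (List.append_nil l))
    (listTensorAppend_nil_right M l)

/-- Here and below, `G` stands for the action of a structural isomorphism of intervals. Only the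
fact that it relabels summands is used, which avoids comparing types indexed by different
expressions for one length. -/
theorem frobComul_counit_left {n : ℕ} {G : frobObj M n ⟶ frobObj M (0 + n)}
    (hG : ∀ l h h', frobInc M _ l h ≫ G = frobInc M _ l h') :
    (λ_ _).inv = G ≫ frobComul M 0 n ≫ frobCounit M ▷ frobObj M n :=
  frobObj_hom_ext fun l hl => by
    rw [reassoc_of% (hG l hl (by omega)), reassoc_of% (frobInc_comul_zero_left hl),
      ← tensorHom_id, tensorHom_comp_tensorHom, frobUnit_counit, Category.comp_id, id_tensorHom,
      leftUnitor_inv_naturality]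

theorem frobComul_counit_right {n : ℕ} {G : frobObj M n ⟶ frobObj M (n + 0)}
    (hG : ∀ l h h', frobInc M _ l h ≫ G = frobInc M _ l h') :
    (ρ_ _).inv = G ≫ frobComul M n 0 ≫ frobObj M n ◁ frobCounit M :=
  frobObj_hom_ext fun l hl => by
    rw [reassoc_of% (hG l hl (by omega)), reassoc_of% (frobInc_comul_zero_right hl),
      ← id_tensorHom, tensorHom_comp_tensorHom, frobUnit_counit, Category.comp_id, tensorHom_id,
      rightUnitor_inv_naturality]

/-- The point `m` is sent to `m'` by `f ⊗ₘ g`, so the pulled back subdivision is cut at `m` exactly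
when the original is cut at `m'`. If not, both sides vanish; otherwise the lift is the concatenation
of lifts of `f` and `g`. -/
theorem frobComul_natural [M.LaxMonoidal] {m n m' n' : FiniteInterval} (f : m ⟶ m') (g : n ⟶ n')
    {G : frobObj M (m'.len + n'.len) ⟶ frobObj M (m.len + n.len)}
    (hG : ∀ {l l'} h h' (e : ListHom l l'), (∀ i ≤ m.len + n.len, listHomVal e i =
      Hom.val (f ⊗ₘ g) i) → frobInc M _ l h ≫ G = e.map M ≫ frobInc M _ l' h') :
    G ≫ frobComul M m.len n.len = frobComul M m'.len n'.len ≫ (frobMap M f ⊗ₘ frobMap M g) := by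
  refine frobObj_hom_ext fun l hl => ?_
  by_cases hc : cuts l m'.len
  · obtain ⟨a, b, rfl, ha, hb⟩ := exists_append_of_cuts' hl hc
    obtain ⟨a', e₁, ha', he₁⟩ := exists_listHomVal ha f
    obtain ⟨b', e₂, hb', he₂⟩ := exists_listHomVal hb g
    rw [reassoc_of% (hG hl (by rw [listLen_append, ha', hb']) (e₁.append e₂) ?_),
      reassoc_of% (frobInc_comul ha hb hl), frobInc_comul ha' hb', tensorHom_comp_tensorHom,
      frobInc_map f ha ha' e₁ he₁, frobInc_map g hb hb' e₂ he₂, ← tensorHom_comp_tensorHom,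
      reassoc_of% (ListHom.map_append M e₁ e₂)]
    intro i hi
    rw [listHomVal_append, val_tensorHom, ha', ha]
    split_ifs
    · rw [he₁ i (by omega)]
    · rw [he₂ _ (by omega)]
  · obtain ⟨l', e, hl', he⟩ := exists_listHomVal (n := m' ⊗ n') hl (f ⊗ₘ g)
    have hm : Hom.val (f ⊗ₘ g) m.len = m'.len := by
      rw [val_tensorHom, if_pos le_rfl, val_len]
    have hc' : ¬ cuts l' m.len := by
      rwa [cuts_listHomVal e (by rw [hl', tensorObj_len]; omega),
        he _ (by rw [tensorObj_len]; omega), hm]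
    rw [reassoc_of% (hG hl hl' e he), frobInc_comul_eq_zero _ hc', comp_zero,
      reassoc_of% (frobInc_comul_eq_zero hl hc), zero_comp]

variable (M) in
theorem frobComul_natural_op [M.LaxMonoidal] {X Y X' Y' : FiniteIntervalᵒᵖ} (f : X ⟶ Y) (g : X' ⟶ Y') :
    frobComul M X.unop.len X'.unop.len ≫ ((frobFunctor M).map f ⊗ₘ (frobFunctor M).map g) =
      (frobFunctor M).map (f ⊗ₘ g) ≫ frobComul M Y.unop.len Y'.unop.len :=
  (frobComul_natural f.unop g.unop
      (G := frobMap M (f.unop ⊗ₘ g.unop)) fun h h' e he => frobInc_map _ h h' e he).symm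

variable [MonoidalPreadditive V]

theorem frobUnit_tensor_mul {n : ℕ} {l : List AugmentedSimplexCategoryᵒᵖ} (h : listLen l = n) :
    (frobUnit M ⊗ₘ frobInc M n l h) ≫ frobMul M 0 n =
      (λ_ _).hom ≫ frobInc M (0 + n) l (by omega) :=
  frobInc_mul (a := []) rfl h

theorem tensor_frobUnit_mul {n : ℕ} {l : List AugmentedSimplexCategoryᵒᵖ} (h : listLen l = n) :
    (frobInc M n l h ⊗ₘ frobUnit M) ≫ frobMul M n 0 =
      (ρ_ _).hom ≫ frobInc M (n + 0) l (by omega) := by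
  have key : ∀ {A B C D E : V} {a : A ⟶ B} {r : A ⟶ C} {c : C ⟶ B} {i : B ⟶ D} {j : C ⟶ D}
      {x : A ⟶ E} {y : E ⟶ D}, x ≫ y = a ≫ i → a = r ≫ c → c ≫ i = j → x ≫ y = r ≫ j := by
    intro A B C D E a r c i j x y h₁ h₂ h₃
    rw [h₁, h₂, Category.assoc, h₃]
  exact key (frobInc_mul (b := []) h rfl) (listTensorAppend_nil_right_inv M l)
    (listTensorCast_frobInc (List.append_nil l).symm
      (by rw [List.append_nil]; exact h))

theorem frobMul_unit_left {n : ℕ} {G : frobObj M (0 + n) ⟶ frobObj M n}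
    (hG : ∀ l h h', frobInc M _ l h ≫ G = frobInc M _ l h') :
    (λ_ _).hom = (frobUnit M ⊗ₘ 𝟙 (frobObj M n)) ≫ frobMul M 0 n ≫ G := by
  rw [tensorHom_id, ← cancel_epi (λ_ _).inv, Iso.inv_hom_id]
  refine frobObj_hom_ext fun l hl => ?_
  rw [leftUnitor_inv_naturality_assoc, ← tensorHom_def'_assoc,
    reassoc_of% (frobUnit_tensor_mul hl), hG _ _ hl, Iso.inv_hom_id_assoc, Category.comp_id]

theorem frobMul_unit_right {n : ℕ} {G : frobObj M (n + 0) ⟶ frobObj M n}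
    (hG : ∀ l h h', frobInc M _ l h ≫ G = frobInc M _ l h') :
    (ρ_ _).hom = (𝟙 (frobObj M n) ⊗ₘ frobUnit M) ≫ frobMul M n 0 ≫ G := by
  rw [id_tensorHom, ← cancel_epi (ρ_ _).inv, Iso.inv_hom_id]
  refine frobObj_hom_ext fun l hl => ?_
  rw [rightUnitor_inv_naturality_assoc, ← tensorHom_def_assoc,
    reassoc_of% (tensor_frobUnit_mul hl), hG _ _ hl, Iso.inv_hom_id_assoc, Category.comp_id]

theorem frobObj_tensor₃_hom_ext {m n p : ℕ} {Z : V}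
    {f g : (frobObj M m ⊗ frobObj M n) ⊗ frobObj M p ⟶ Z}
    (h : ∀ a (ha : listLen a = m) b (hb : listLen b = n) c (hc : listLen c = p),
      ((frobInc M m a ha ⊗ₘ frobInc M n b hb) ⊗ₘ frobInc M p c hc) ≫ f =
        ((frobInc M m a ha ⊗ₘ frobInc M n b hb) ⊗ₘ frobInc M p c hc) ≫ g) : f = g := by
  have key : ∀ k : (frobObj M m ⊗ frobObj M n) ⊗ frobObj M p ⟶ Z,
      k = (((∑ a : Subdivision m, frobPrj M m a.1 a.2 ≫ frobInc M m a.1 a.2) ⊗ₘ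
        (∑ b : Subdivision n, frobPrj M n b.1 b.2 ≫ frobInc M n b.1 b.2)) ⊗ₘ
        (∑ c : Subdivision p, frobPrj M p c.1 c.2 ≫ frobInc M p c.1 c.2)) ≫ k := by
    intro k
    rw [frobObj_total, frobObj_total, frobObj_total, id_tensorHom_id, id_tensorHom_id,
      Category.id_comp]
  rw [key f, key g]
  simp only [sum_tensor, tensor_sum, Preadditive.sum_comp, ← tensorHom_comp_tensorHom,
    Category.assoc, h]

theorem frobMul_natural [M.LaxMonoidal] {m n m' n' : FiniteInterval} (f : m ⟶ m') (g : n ⟶ n')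
    {G : frobObj M (m'.len + n'.len) ⟶ frobObj M (m.len + n.len)}
    (hG : ∀ {l l'} h h' (e : ListHom l l'), (∀ i ≤ m.len + n.len, listHomVal e i =
      Hom.val (f ⊗ₘ g) i) → frobInc M _ l h ≫ G = e.map M ≫ frobInc M _ l' h') :
    (frobMap M f ⊗ₘ frobMap M g) ≫ frobMul M m.len n.len = frobMul M m'.len n'.len ≫ G := by
  refine frobObj_tensor_hom_ext fun a ha b hb => ?_
  obtain ⟨a', e₁, ha', he₁⟩ := exists_listHomVal ha f
  obtain ⟨b', e₂, hb', he₂⟩ := exists_listHomVal hb g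
  rw [tensorHom_comp_tensorHom_assoc, frobInc_map f ha ha' e₁ he₁, frobInc_map g hb hb' e₂ he₂,
    ← tensorHom_comp_tensorHom_assoc, frobInc_mul, reassoc_of% (frobInc_mul ha hb),
    hG _ (by rw [listLen_append, ha', hb']) (e₁.append e₂) ?_, ← Category.assoc, ← Category.assoc]
  · congr 1
    rw [Iso.comp_inv_eq, Category.assoc, ListHom.map_append, Iso.inv_hom_id_assoc]
  · intro i hi
    rw [listHomVal_append, val_tensorHom, ha', ha]
    split_ifs
    · rw [he₁ i (by omega)]
    · rw [he₂ _ (by omega)]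

theorem frobMul_assoc {m n p : ℕ} {G : frobObj M (m + n + p) ⟶ frobObj M (m + (n + p))}
    (hG : ∀ l h h', frobInc M _ l h ≫ G = frobInc M _ l h') :
    (frobMul M m n ⊗ₘ 𝟙 (frobObj M p)) ≫ frobMul M (m + n) p ≫ G =
      (α_ _ _ _).hom ≫ (𝟙 (frobObj M m) ⊗ₘ frobMul M n p) ≫ frobMul M m (n + p) := by
  rw [tensorHom_id, id_tensorHom]
  refine frobObj_tensor₃_hom_ext fun a ha b hb c hc => ?_
  have h₁ : ((frobInc M m a ha ⊗ₘ frobInc M n b hb) ⊗ₘ frobInc M p c hc) ≫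
      frobMul M m n ▷ frobObj M p = (listTensorAppend M a b).inv ▷ listTensor M c ≫
        (frobInc M (m + n) (a ++ b) (by rw [listLen_append, ha, hb]) ⊗ₘ frobInc M p c hc) := by
    rw [← tensorHom_id, ← tensorHom_id, tensorHom_comp_tensorHom, tensorHom_comp_tensorHom,
      frobInc_mul ha hb, Category.comp_id, Category.id_comp]
  have h₂ : (frobInc M m a ha ⊗ₘ (frobInc M n b hb ⊗ₘ frobInc M p c hc)) ≫
      frobObj M m ◁ frobMul M n p = listTensor M a ◁ (listTensorAppend M b c).inv ≫
        (frobInc M m a ha ⊗ₘ frobInc M (n + p) (b ++ c) (by rw [listLen_append, hb, hc])) := by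
    rw [← id_tensorHom, ← id_tensorHom, tensorHom_comp_tensorHom, tensorHom_comp_tensorHom,
      frobInc_mul hb hc, Category.comp_id, Category.id_comp]
  rw [reassoc_of% h₁, reassoc_of% (frobInc_mul (M := M)), associator_naturality_assoc,
    reassoc_of% h₂, frobInc_mul, hG _ _ (by rw [listLen_append, listLen_append]; omega),
    reassoc_of% (listTensorAppend_assoc_inv M), listTensorCast_frobInc]

theorem frobInc_append_comul_comul {m n p : ℕ} {d c : List AugmentedSimplexCategoryᵒᵖ}
    (hd : listLen d = m + n) (hc : listLen c = p) (hm : ¬ cuts d m)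
    (h : listLen (d ++ c) = m + n + p) :
    frobInc M _ (d ++ c) h ≫ frobComul M (m + n) p ≫ frobComul M m n ▷ frobObj M p = 0 := by
  rw [reassoc_of% (frobInc_comul hd hc h), ← tensorHom_id, tensorHom_comp_tensorHom,
    frobInc_comul_eq_zero hd hm, MonoidalPreadditive.zero_tensor, comp_zero]

/-- Both composites project to the subdivisions cut at `m` and at `m + n`. The cases are whether
each cut is present; when both are, reassociating the concatenation gives the equality. -/
theorem frobComul_coassoc {m n p : ℕ} {G : frobObj M (m + n + p) ⟶ frobObj M (m + (n + p))}
    (hG : ∀ l h h', frobInc M _ l h ≫ G = frobInc M _ l h') :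
    frobComul M (m + n) p ≫ frobComul M m n ▷ frobObj M p ≫ (α_ _ _ _).hom =
      G ≫ frobComul M m (n + p) ≫ frobObj M m ◁ frobComul M n p := by
  refine frobObj_hom_ext fun l hl => ?_
  have hl' : listLen l = m + (n + p) := by omega
  rw [reassoc_of% (hG l hl hl')]
  by_cases hm : cuts l m
  · obtain ⟨a, d, rfl, ha, hd⟩ := exists_append_of_cuts' hl' hm
    rw [reassoc_of% (frobInc_comul ha hd hl')]
    have hmn : cuts (a ++ d) (m + n) ↔ cuts d n := by rw [← ha, cuts_append_add]
    by_cases hn : cuts d n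
    · obtain ⟨b, c, rfl, hb, hc⟩ := exists_append_of_cuts' hd hn
      have hab : listLen (a ++ b) = m + n := by rw [listLen_append, ha, hb]
      rw [← listTensorCast_frobInc (List.append_assoc a b c).symm
          (by rw [List.append_assoc]; exact hl), Category.assoc, reassoc_of% (frobInc_comul hab hc),
        ← tensorHom_id, tensorHom_comp_tensorHom_assoc, frobInc_comul ha hb,
        Category.comp_id, ← id_tensorHom, tensorHom_comp_tensorHom, frobInc_comul hb hc,
        Category.comp_id]
      have h : ∀ {A A' B P Q R S P' Q' R' : V} {s : A ⟶ B ⊗ R} {t : B ⟶ P ⊗ Q}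
          {c : A ⟶ A'} {c' : A' ⟶ A} {p : A' ⟶ P ⊗ S} {q : S ⟶ Q ⊗ R} {i : P ⟶ P'}
          {j : Q ⟶ Q'} {k : R ⟶ R'}, c' ≫ c = 𝟙 _ →
          s ≫ t ▷ R ≫ (α_ P Q R).hom = c ≫ p ≫ P ◁ q →
          c' ≫ s ≫ ((t ≫ (i ⊗ₘ j)) ⊗ₘ k) ≫ (α_ P' Q' R').hom =
            p ≫ (i ⊗ₘ (q ≫ (j ⊗ₘ k))) := by
        intro A A' B P Q R S P' Q' R' s t c c' p q i j k hc h
        rw [← whiskerRight_comp_tensorHom, ← whiskerLeft_comp_tensorHom, Category.assoc,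
          associator_naturality, reassoc_of% h, reassoc_of% hc]
      exact h (by simp) (listTensorAppend_assoc M a b c)
    · rw [reassoc_of% (frobInc_comul_eq_zero hl (mt hmn.1 hn)), zero_comp, ← id_tensorHom,
        tensorHom_comp_tensorHom, frobInc_comul_eq_zero hd hn, MonoidalPreadditive.tensor_zero,
        comp_zero]
  · rw [reassoc_of% (frobInc_comul_eq_zero hl' hm), zero_comp]
    by_cases hmn : cuts l (m + n)
    · obtain ⟨d, c, rfl, hd, hc⟩ := exists_append_of_cuts' hl hmn
      rw [reassoc_of% (frobInc_append_comul_comul hd hc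
        (mt (cuts_append_of_le (by omega)).2 hm) hl), zero_comp]
    · rw [reassoc_of% (frobInc_comul_eq_zero hl hmn), zero_comp]

/-- A concatenation `l ++ c` with `l` of length `m + n` is cut at `m` exactly when `l` is. Hence
either both sides vanish, or `l = a ++ b` and both sides regroup the blocks as `a` and `b ++ c`. -/
theorem frobMul_comul_left {m n p : ℕ} {G : frobObj M (m + n + p) ⟶ frobObj M (m + (n + p))}
    (hG : ∀ l h h', frobInc M _ l h ≫ G = frobInc M _ l h') :
    frobComul M m n ▷ frobObj M p ≫ (α_ _ _ _).hom ≫ frobObj M m ◁ frobMul M n p =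
      frobMul M (m + n) p ≫ G ≫ frobComul M m (n + p) := by
  refine frobObj_tensor_hom_ext fun l hl c hc => ?_
  have hlc : listLen (l ++ c) = m + (n + p) := by rw [listLen_append]; omega
  rw [reassoc_of% (frobInc_mul hl hc), reassoc_of% (hG _ _ hlc), ← tensorHom_id,
    tensorHom_comp_tensorHom_assoc, Category.comp_id]
  by_cases hm : cuts l m
  · obtain ⟨a, b, rfl, ha, hb⟩ := exists_append_of_cuts' hl hm
    have hbc : listLen (b ++ c) = n + p := by rw [listLen_append, hb, hc]
    rw [← listTensorCast_frobInc (List.append_assoc a b c)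
          (by rw [← List.append_assoc]; exact hlc), Category.assoc, frobInc_comul ha hbc,
        frobInc_comul ha hb]
    have h : ∀ {A A' B P Q R S P' Q' R' S' : V} {s : A ≅ B ⊗ R} {t : B ⟶ P ⊗ Q}
        {c : A ⟶ A'} {p : A' ⟶ P ⊗ S} {q : S ≅ Q ⊗ R} {i : P ⟶ P'}
        {j : Q ⟶ Q'} {k : R ⟶ R'} {z : Q' ⊗ R' ⟶ S'} {w : S ⟶ S'},
        s.hom ≫ t ▷ R ≫ (α_ P Q R).hom = c ≫ p ≫ P ◁ q.hom →
        (j ⊗ₘ k) ≫ z = q.inv ≫ w →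
        ((t ≫ (i ⊗ₘ j)) ⊗ₘ k) ≫ (α_ P' Q' R').hom ≫ P' ◁ z =
          s.inv ≫ c ≫ p ≫ (i ⊗ₘ w) := by
      intro A A' B P Q R S P' Q' R' S' s t c p q i j k z w h hz
      have h₁ : t ▷ R ≫ (α_ P Q R).hom = s.inv ≫ c ≫ p ≫ P ◁ q.hom := by
        rw [← h, Iso.inv_hom_id_assoc]
      rw [← whiskerRight_comp_tensorHom, Category.assoc, associator_naturality_assoc,
        reassoc_of% h₁, ← id_tensorHom P' z, tensorHom_comp_tensorHom, hz, Category.comp_id,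
        whiskerLeft_comp_tensorHom, Iso.hom_inv_id_assoc]
    exact h (listTensorAppend_assoc M a b c) (frobInc_mul hb hc)
  · rw [frobInc_comul_eq_zero hl hm, MonoidalPreadditive.zero_tensor, zero_comp,
      frobInc_comul_eq_zero hlc (mt (cuts_append_of_le (by omega)).1 hm), comp_zero]

theorem frobMul_comul_right {m n p : ℕ} {G : frobObj M (m + (n + p)) ⟶ frobObj M (m + n + p)}
    (hG : ∀ l h h', frobInc M _ l h ≫ G = frobInc M _ l h') :
    frobObj M m ◁ frobComul M n p ≫ (α_ _ _ _).inv ≫ frobMul M m n ▷ frobObj M p =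
      frobMul M m (n + p) ≫ G ≫ frobComul M (m + n) p := by
  refine frobObj_tensor_hom_ext fun a ha l hl => ?_
  have hal : listLen (a ++ l) = m + n + p := by rw [listLen_append]; omega
  rw [reassoc_of% (frobInc_mul ha hl), reassoc_of% (hG _ _ hal), ← id_tensorHom,
    tensorHom_comp_tensorHom_assoc, Category.comp_id]
  by_cases hn : cuts l n
  · obtain ⟨b, c, rfl, hb, hc⟩ := exists_append_of_cuts' hl hn
    have hab : listLen (a ++ b) = m + n := by rw [listLen_append, ha, hb]
    rw [← listTensorCast_frobInc (List.append_assoc a b c).symm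
          (by rw [List.append_assoc]; exact hal), Category.assoc, frobInc_comul hab hc,
        frobInc_comul hb hc]
    have h : ∀ {A A' B P Q R S P' Q' R' B' : V} {s : A ⟶ B ⊗ R} {t : B ≅ P ⊗ Q}
        {c : A ⟶ A'} {c' : A' ⟶ A} {p : A' ≅ P ⊗ S} {q : S ⟶ Q ⊗ R} {i : P ⟶ P'}
        {j : Q ⟶ Q'} {k : R ⟶ R'} {z : P' ⊗ Q' ⟶ B'} {w : B ⟶ B'}, c' ≫ c = 𝟙 _ →
        s ≫ t.hom ▷ R ≫ (α_ P Q R).hom = c ≫ p.hom ≫ P ◁ q →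
        (i ⊗ₘ j) ≫ z = t.inv ≫ w →
        (i ⊗ₘ (q ≫ (j ⊗ₘ k))) ≫ (α_ P' Q' R').inv ≫ z ▷ R' =
          p.inv ≫ c' ≫ s ≫ (w ⊗ₘ k) := by
      intro A A' B P Q R S P' Q' R' B' s t c c' p q i j k z w hc h hz
      have h₁ : P ◁ q ≫ (α_ P Q R).inv = p.inv ≫ c' ≫ s ≫ t.hom ▷ R := by
        rw [Iso.comp_inv_eq]
        simp only [Category.assoc]
        rw [h, reassoc_of% hc, Iso.inv_hom_id_assoc]
      rw [← whiskerLeft_comp_tensorHom, Category.assoc, associator_inv_naturality_assoc,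
        reassoc_of% h₁, ← tensorHom_id z, tensorHom_comp_tensorHom, hz, Category.comp_id,
        whiskerRight_comp_tensorHom, Iso.hom_inv_id_assoc]
    exact h (by simp) (listTensorAppend_assoc M a b c) (frobInc_mul ha hb)
  · rw [frobInc_comul_eq_zero hl hn, MonoidalPreadditive.tensor_zero, zero_comp,
      frobInc_comul_eq_zero hal (by rwa [← ha, cuts_append_add]), comp_zero]

variable (M) [M.LaxMonoidal]

instance frobFunctorLaxMonoidal : (frobFunctor M).LaxMonoidal :=
  Functor.LaxMonoidal.ofTensorHom
    (ε := frobUnit M)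
    (μ := fun X Y => frobMul M X.unop.len Y.unop.len)
    (μ_natural := fun f g => frobMul_natural f.unop g.unop
      (G := frobMap M (f.unop ⊗ₘ g.unop)) fun h h' e he => frobInc_map _ h h' e he)
    (associativity := fun X Y Z =>
      frobMul_assoc (G := frobMap M (α_ X Y Z).hom.unop) fun _ h h' =>
        frobInc_map_of_isIso _ h h')
    (left_unitality := fun X =>
      frobMul_unit_left (G := frobMap M (λ_ X).hom.unop) fun _ h h' =>
        frobInc_map_of_isIso _ h h')
    (right_unitality := fun X =>
      frobMul_unit_right (G := frobMap M (ρ_ X).hom.unop) fun _ h h' =>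
        frobInc_map_of_isIso _ h h')

instance frobFunctorOplaxMonoidal : (frobFunctor M).OplaxMonoidal where
  η := frobCounit M
  δ := fun X Y => frobComul M X.unop.len Y.unop.len
  δ_natural_left := fun f X => by
    have h : ∀ {A B P Q R : V} {a : A ⟶ P ⊗ R} {f : P ⟶ Q} {i : R ⟶ R} {b : A ⟶ B}
        {c : B ⟶ Q ⊗ R}, i = 𝟙 _ → a ≫ (f ⊗ₘ i) = b ≫ c → a ≫ f ▷ R = b ≫ c := by
      rintro A B P Q R a f i b c rfl h
      rw [← h, tensorHom_id]
    exact h ((frobFunctor M).map_id X) (frobComul_natural_op M f (𝟙 X))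
  δ_natural_right := fun X f => by
    have h : ∀ {A B P Q R : V} {a : A ⟶ R ⊗ P} {f : P ⟶ Q} {i : R ⟶ R} {b : A ⟶ B}
        {c : B ⟶ R ⊗ Q}, i = 𝟙 _ → a ≫ (i ⊗ₘ f) = b ≫ c → a ≫ R ◁ f = b ≫ c := by
      rintro A B P Q R a f i b c rfl h
      rw [← h, id_tensorHom]
    exact h ((frobFunctor M).map_id X) (frobComul_natural_op M (𝟙 X) f)
  oplax_associativity := fun X Y Z =>
    frobComul_coassoc (G := frobMap M (α_ X Y Z).hom.unop) fun _ h h' =>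
      frobInc_map_of_isIso _ h h'
  oplax_left_unitality := fun X =>
    frobComul_counit_left (G := frobMap M (λ_ X).inv.unop) fun _ h h' =>
      frobInc_map_of_isIso _ h h'
  oplax_right_unitality := fun X =>
    frobComul_counit_right (G := frobMap M (ρ_ X).inv.unop) fun _ h h' =>
      frobInc_map_of_isIso _ h h'

/-- The strongly unital Frobenius monoidal functor on finite intervals given by the sums over
subdivisions of the tensor products of the values of a lax monoidal functor. -/
def frobObject : FrobeniusFunctor FiniteIntervalᵒᵖ V where
  functor := frobFunctor M
  frobenius_left X Y Z := frobMul_comul_left (G := frobMap M (α_ X Y Z).hom.unop) fun _ h h' =>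
    frobInc_map_of_isIso _ h h'
  frobenius_right X Y Z := frobMul_comul_right (G := frobMap M (α_ X Y Z).inv.unop) fun _ h h' =>
    frobInc_map_of_isIso _ h h'
  counit_unit := frobCounit_unit
  unit_counit := frobUnit_counit

end FrobStructure

/-! ### Kernel cones -/

open FiniteInterval

namespace ListHom

open Functor.LaxMonoidal

variable {C : Type u₁} [Category.{v₁} C] [MonoidalCategory C]
  {V : Type u} [Category.{v} V] [MonoidalCategory V] (M : C ⥤ V) [M.LaxMonoidal]

/-- The morphism of lists to a list with one element given by a morphism from a tensor product. -/
def toSingle {l : List C} {x : C} (f : listTensor (𝟭 C) l ⟶ x) : ListHom l [x] :=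
  cast (List.append_nil l).symm (cons f nil)

theorem map_toSingle {l : List C} {x : C} (f : listTensor (𝟭 C) l ⟶ x) :
    (toSingle f).map M = (listMul M l ≫ M.map f) ≫ (ρ_ (M.obj x)).inv := by
  have h : ∀ {A B D : V} {c : A ⟶ B} {c' : B ⟶ A} {t : B ⟶ A ⊗ 𝟙_ V} {a : A ⟶ D}
      {n : 𝟙_ V ⟶ 𝟙_ V}, c ≫ c' = 𝟙 _ → t = c' ≫ (ρ_ A).inv → n = 𝟙 _ →
      c ≫ t ≫ (a ⊗ₘ n) = a ≫ (ρ_ D).inv := by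
    rintro A B D c c' t a n hc rfl rfl
    rw [Category.assoc, reassoc_of% hc, tensorHom_id, rightUnitor_inv_naturality]
  exact (map_cast M (List.append_nil l).symm (cons f nil)).trans
    (h (listTensorCast_trans M (List.append_nil l).symm (List.append_nil l))
      (listTensorAppend_nil_right M l) rfl)

theorem listMul_singleton (x : C) :
    listMul M [x] ≫ M.map (ρ_ x).hom = (ρ_ (M.obj x)).hom := by
  exact (congrArg (· ≫ M.map (ρ_ x).hom) (listMul_cons M x [])).trans
    ((Category.assoc _ _ _).trans (right_unitality M x).symm)

/-- The morphism of lists with one element given by a morphism. -/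
def single {x y : C} (f : x ⟶ y) : ListHom [x] [y] := toSingle ((ρ_ x).hom ≫ f)

theorem map_single {x y : C} (f : x ⟶ y) :
    (single f).map M = (ρ_ (M.obj x)).hom ≫ M.map f ≫ (ρ_ (M.obj y)).inv := by
  have h : ∀ {A B : V} {z : C} {a : A ⟶ M.obj z} {r : z ⟶ x} {s : A ⟶ M.obj x} {t : M.obj y ⟶ B},
      a ≫ M.map r = s → (a ≫ M.map (r ≫ f)) ≫ t = s ≫ M.map f ≫ t := by
    rintro A B z a r _ t rfl
    simp
  exact (map_toSingle M _).trans (h (listMul_singleton M x))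

/-- The morphism of lists from a list with two elements to their tensor product. -/
def pair (x y : C) : ListHom [x, y] [x ⊗ y] := toSingle (x ◁ (ρ_ y).hom)

theorem map_pair (x y : C) :
    (pair x y).map M = M.obj x ◁ (ρ_ (M.obj y)).hom ≫ μ M x y ≫ (ρ_ (M.obj (x ⊗ y))).inv := by
  have h : ∀ {A : V} {z : C} {a : A ⟶ M.obj z} {r : z ⟶ y} {s : A ⟶ M.obj y},
      a ≫ M.map r = s → (M.obj x ◁ a ≫ μ M x z) ≫ M.map (x ◁ r) = M.obj x ◁ s ≫ μ M x y := by
    rintro A z a r _ rfl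
    rw [Category.assoc, ← μ_natural_right, MonoidalCategory.whiskerLeft_comp_assoc]
  exact (map_toSingle M _).trans ((congrArg (· ≫ (ρ_ (M.obj (x ⊗ y))).inv)
    ((congrArg (· ≫ M.map (x ◁ (ρ_ y).hom)) (listMul_cons M x [y])).trans
      (h (listMul_singleton M y)))).trans (Category.assoc _ _ _))

variable (C) in
/-- The morphism of lists from the empty list to the unit. -/
def unit : ListHom ([] : List C) [𝟙_ C] := toSingle (l := []) (𝟙 _)

theorem map_unit : (unit C).map M = ε M ≫ (ρ_ (M.obj (𝟙_ C))).inv := by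
  have h : ∀ {A B D : V} {e : A ⟶ B} {i : B ⟶ B} {r : B ⟶ D}, i = 𝟙 _ → (e ≫ i) ≫ r = e ≫ r := by
    rintro A B D e i r rfl
    rw [Category.comp_id]
  exact (map_toSingle M (l := []) (𝟙 _)).trans (h (M.map_id _))

end ListHom

variable {V : Type u} [Category.{v} V] [MonoidalCategory V]

namespace FrobeniusFunctor

open Functor.LaxMonoidal Functor.OplaxMonoidal

/-- A morphism to a value of a Frobenius monoidal functor on finite intervals is primitive if
it is annihilated by all nontrivial comultiplications. -/
def IsPrimitive [HasZeroMorphisms V] (X : FrobeniusFunctor FiniteIntervalᵒᵖ V) {n : FiniteInterval}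
    {W : V} (g : W ⟶ X.functor.obj (op n)) : Prop :=
  ∀ k l : FiniteInterval, 0 < k.len → 0 < l.len → ∀ h : (k ⊗ l).len = n.len,
    g ≫ X.functor.map (isoOfEq h).hom.op ≫ δ X.functor (op k) (op l) = 0

/-- A family of morphisms is a kernel cone if its members are universal among the primitive
morphisms. -/
structure IsKernelCone [HasZeroMorphisms V] (X : FrobeniusFunctor FiniteIntervalᵒᵖ V)
    {M : AugmentedSimplexCategoryᵒᵖ ⥤ V} (ι : M ⟶ narrow.op ⋙ X.functor) : Prop where
  primitive : ∀ n : AugmentedSimplexCategory, X.IsPrimitive (n := narrow.obj n) (ι.app (op n))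
  existsUnique_lift : ∀ (n : AugmentedSimplexCategory) (W : V)
    (g : W ⟶ X.functor.obj (op (narrow.obj n))), X.IsPrimitive g →
      ∃! g' : W ⟶ M.obj (op n), g' ≫ ι.app (op n) = g

end FrobeniusFunctor

/-! ### The trivial subdivision as a kernel cone -/

noncomputable section FrobCone

variable [Preadditive V] [HasFiniteBiproducts V] {M : AugmentedSimplexCategoryᵒᵖ ⥤ V}

variable (M) in
/-- The inclusion of the trivial subdivision. -/
def frobSingle (x : AugmentedSimplexCategoryᵒᵖ) : M.obj x ⟶ frobObj M (narrow.obj x.unop).len :=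
  (ρ_ (M.obj x)).inv ≫ frobInc M _ [x] (Nat.add_zero _)

theorem frobSingle_prj (x : AugmentedSimplexCategoryᵒᵖ) : frobSingle M x ≫
    frobPrj M (narrow.obj x.unop).len [x] (Nat.add_zero _) ≫ (ρ_ (M.obj x)).hom = 𝟙 _ := by
  have h : ∀ {D E : V} {p : E ⟶ D ⊗ 𝟙_ V} {i : D ⊗ 𝟙_ V ⟶ E}, i ≫ p = 𝟙 _ →
      ((ρ_ D).inv ≫ i) ≫ p ≫ (ρ_ D).hom = 𝟙 _ := by
    intro D E p i h
    rw [Category.assoc, reassoc_of% h, Iso.inv_hom_id]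
  exact h (frobInc_prj_self _ [x] _ _)

/-- The dual of `frobInc_comul`. It reads the component at a concatenation off a comultiplication,
which is how primitivity kills components. -/
theorem frobComul_prj [MonoidalPreadditive V] {m n : ℕ} {a b : List AugmentedSimplexCategoryᵒᵖ}
    (ha : listLen a = m) (hb : listLen b = n) (h : listLen (a ++ b) = m + n) :
    frobComul M m n ≫ (frobPrj M m a ha ⊗ₘ frobPrj M n b hb) =
      frobPrj M (m + n) (a ++ b) h ≫ (listTensorAppend M a b).hom := by
  refine frobObj_hom_ext fun l hl => ?_
  by_cases hm : cuts l m
  · obtain ⟨a', b', rfl, ha', hb'⟩ := exists_append_of_cuts' hl hm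
    rw [reassoc_of% (frobInc_comul ha' hb' hl), tensorHom_comp_tensorHom]
    by_cases haa : a' = a
    · subst haa
      by_cases hbb : b' = b
      · subst hbb
        rw [frobInc_prj_self, frobInc_prj_self, id_tensorHom_id, Category.comp_id,
          reassoc_of% (frobInc_prj_self (M := M))]
      · rw [frobInc_prj_of_ne hb' hb hbb, MonoidalPreadditive.tensor_zero, comp_zero,
          reassoc_of% (frobInc_prj_of_ne (M := M) hl h fun e => hbb (List.append_cancel_left e)),
          zero_comp]
    · rw [frobInc_prj_of_ne ha' ha haa, MonoidalPreadditive.zero_tensor, comp_zero,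
        reassoc_of% (frobInc_prj_of_ne (M := M) hl h fun e =>
          haa (append_inj_of_listLen e (ha'.trans ha.symm)).1), zero_comp]
  · rw [reassoc_of% (frobInc_comul_eq_zero hl hm), zero_comp,
      reassoc_of% (frobInc_prj_of_ne (M := M) hl h ?_), zero_comp]
    rintro rfl
    refine hm ?_
    have := (cuts_append_add a b 0).2 (cuts_zero _)
    rwa [Nat.add_zero, ha] at this

theorem frobPrj_eq_of_isIso [M.LaxMonoidal] {m n : FiniteInterval} (f : m ⟶ n) [IsIso f]
    {l : List AugmentedSimplexCategoryᵒᵖ} (h : listLen l = n.len) (h' : listLen l = m.len) :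
    frobMap M f ≫ frobPrj M m.len l h' = frobPrj M n.len l h := by
  refine frobObj_hom_ext fun l' hl' => ?_
  rw [reassoc_of% (frobInc_map_of_isIso f hl' (hl'.trans (h.symm.trans h')))]
  by_cases hl : l' = l
  · subst hl
    rw [frobInc_prj_self, frobInc_prj_self]
  · rw [frobInc_prj_of_ne _ _ hl, frobInc_prj_of_ne _ _ hl]

variable [M.LaxMonoidal]

open Functor.LaxMonoidal

theorem val_isIso_comp_comp_isIso {a b c d : FiniteInterval} (p : a ⟶ b) (q : b ⟶ c) (r : c ⟶ d)
    [IsIso p] [IsIso r] {i : ℕ} (hi : i ≤ b.len) : Hom.val (p ≫ q ≫ r) i = Hom.val q i := by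
  rw [val_comp, val_comp, val_of_isIso p, val_of_isIso r, len_eq_of_isIso p,
    min_eq_left hi, min_eq_left (val_le _ _)]

theorem frobSingle_natural {x y : AugmentedSimplexCategoryᵒᵖ} (f : x ⟶ y) :
    M.map f ≫ frobSingle M y = frobSingle M x ≫ frobMap M (narrow.map f.unop) := by
  have h := frobInc_map (M := M) (narrow.map f.unop) (Nat.add_zero _) (Nat.add_zero _)
    (ListHom.single f) fun i hi => by
      unfold listHomVal
      rw [ListHom.map_single]
      exact val_isIso_comp_comp_isIso (ρ_ (narrow.obj y.unop)).hom (narrow.map f.unop)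
        (ρ_ (narrow.obj x.unop)).inv hi
  rw [ListHom.map_single] at h
  have key : ∀ {A B D E : V} {a : A ⊗ 𝟙_ V ⟶ D} {b : B ⊗ 𝟙_ V ⟶ E} {m : D ⟶ E} {f : A ⟶ B},
      a ≫ m = ((ρ_ A).hom ≫ f ≫ (ρ_ B).inv) ≫ b → f ≫ (ρ_ B).inv ≫ b = ((ρ_ A).inv ≫ a) ≫ m := by
    intro A B D E a b m f h
    rw [Category.assoc, h]
    simp
  exact key h

theorem frobSingle_unit : ε M ≫ frobSingle M (𝟙_ AugmentedSimplexCategoryᵒᵖ) =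
    frobUnit M ≫ frobMap M (toUnit (narrow.obj (𝟙_ AugmentedSimplexCategory))) := by
  have h := frobInc_map (M := M) (toUnit (narrow.obj (𝟙_ AugmentedSimplexCategory))) (l := [])
    (l' := [𝟙_ AugmentedSimplexCategoryᵒᵖ]) rfl rfl (ListHom.unit _)
    fun i hi => by
      unfold listHomVal
      rw [ListHom.map_unit]
      have h : ∀ {a b c : FiniteInterval} (p : a ⟶ b) (q : b ⟶ c) [IsIso p],
          i ≤ b.len → Hom.val (p ≫ q) i = Hom.val q i := by
        intro a b c p q _ hi
        rw [val_comp, val_of_isIso p, len_eq_of_isIso p, min_eq_left hi]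
      exact h (ρ_ (narrow.obj (𝟙_ AugmentedSimplexCategory))).hom
        (toUnit (narrow.obj (𝟙_ AugmentedSimplexCategory))) hi
  rw [ListHom.map_unit] at h
  exact ((Category.assoc _ _ _).symm.trans h.symm)

variable [MonoidalPreadditive V]

/-- The product of two trivial subdivisions lies in the summand of `[x, y]`, whose only interior cut
is the point omitted by `narrowComul`. Pulling back therefore merges the two blocks, and the lift
`ListHom.pair` acts by the multiplication of `M`. -/
theorem frobSingle_mul (x y : AugmentedSimplexCategoryᵒᵖ) :
    μ M x y ≫ frobSingle M (x ⊗ y) = (frobSingle M x ⊗ₘ frobSingle M y) ≫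
      frobMul M (narrow.obj x.unop).len (narrow.obj y.unop).len ≫
        frobMap M (narrowComul x.unop y.unop) := by
  have h₁ := frobInc_mul (M := M) (m := (narrow.obj x.unop).len) (n := (narrow.obj y.unop).len)
    (a := [x]) (b := [y]) (Nat.add_zero _) (Nat.add_zero _)
  have h₂ := frobInc_map (M := M) (narrowComul x.unop y.unop) (l := [x, y]) (l' := [x ⊗ y])
    (by rw [listLen_cons, listLen_cons, listLen_nil]; rfl) (Nat.add_zero _) (ListHom.pair x y)
    fun i hi => by
      unfold listHomVal
      rw [ListHom.map_pair]
      exact val_isIso_comp_comp_isIso (ρ_ (narrow.obj (x.unop ⊗ y.unop))).hom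
        (narrowComul x.unop y.unop) (narrow.obj x.unop ◁ (ρ_ (narrow.obj y.unop)).inv) hi
  rw [ListHom.map_pair] at h₂
  have key : ∀ {A B D A' B' E F : V} {a : A ⊗ 𝟙_ V ⟶ A'} {b : B ⊗ 𝟙_ V ⟶ B'} {z : A' ⊗ B' ⟶ E}
      {q : E ⟶ F} {m : A ⊗ B ⟶ D} {c : D ⊗ 𝟙_ V ⟶ F} {w : A ⊗ B ⊗ 𝟙_ V ⟶ E},
      (a ⊗ₘ b) ≫ z = ((α_ A (𝟙_ V) (B ⊗ 𝟙_ V)).hom ≫ A ◁ (λ_ (B ⊗ 𝟙_ V)).hom) ≫ w →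
      w ≫ q = (A ◁ (ρ_ B).hom ≫ m ≫ (ρ_ D).inv) ≫ c →
      m ≫ (ρ_ D).inv ≫ c = (((ρ_ A).inv ≫ a) ⊗ₘ ((ρ_ B).inv ≫ b)) ≫ z ≫ q := by
    intro A B D A' B' E F a b z q m c w h₁ h₂
    rw [← tensorHom_comp_tensorHom, Category.assoc, reassoc_of% h₁]
    simp only [Category.assoc] at h₂ ⊢
    rw [h₂]
    have h : ((ρ_ A).inv ⊗ₘ (ρ_ B).inv) ≫ (α_ A (𝟙_ V) (B ⊗ 𝟙_ V)).hom ≫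
        A ◁ (λ_ (B ⊗ 𝟙_ V)).hom ≫ A ◁ (ρ_ B).hom = 𝟙 _ := by monoidal
    rw [reassoc_of% h]
  exact key h₁ h₂

variable (M) in
/-- The inclusion of the trivial subdivisions. -/
def frobCone : M ⟶ narrow.op ⋙ (frobObject M).functor where
  app := frobSingle M
  naturality _ _ f := frobSingle_natural f

instance : NatTrans.IsMonoidal (frobCone M) where
  unit := frobSingle_unit
  tensor := frobSingle_mul

/-- A list with at least two entries is cut at the end of the first one into parts of positive
length. Its component is, up to an isomorphism, a component of the comultiplication at that cut. -/
theorem frobPrj_eq_zero_of_isPrimitive {n : FiniteInterval} {W : V}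
    {g : W ⟶ (frobObject M).functor.obj (op n)} (hg : (frobObject M).IsPrimitive g)
    {x y : AugmentedSimplexCategoryᵒᵖ} {l : List AugmentedSimplexCategoryᵒᵖ}
    (h : listLen (x :: y :: l) = n.len) : g ≫ frobPrj M n.len (x :: y :: l) h = 0 := by
  have hx : listLen [x] = (narrow.obj x.unop).len := Nat.add_zero _
  have h₁ := hg ⟨(narrow.obj x.unop).len⟩ ⟨listLen (y :: l)⟩ (narrow_len_pos _)
    (by
      have := narrow_len_pos y.unop
      rw [listLen_cons]
      exact Nat.add_pos_left this _) h
  have key : ∀ {A B C D : V} {g : W ⟶ A} {m : A ⟶ B} {c : B ⟶ C} {p : C ⟶ D} {q : B ⟶ D}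
      {r : A ⟶ D}, g ≫ m ≫ c = 0 → c ≫ p = q → m ≫ q = r → g ≫ r = 0 := by
    rintro A B C D g m c p _ _ h rfl rfl
    rw [← Category.assoc m, ← Category.assoc g, h, zero_comp]
  have h₂ := frobComul_prj (M := M) (a := [x]) (b := y :: l) hx rfl rfl
  have h₃ := key h₁ h₂ (r := frobPrj M n.len _ h ≫ (listTensorAppend M [x] (y :: l)).hom)
    ((Category.assoc _ _ _).symm.trans
      (congrArg (· ≫ _) (frobPrj_eq_of_isIso (isoOfEq h).hom h rfl)))
  exact (cancel_mono (listTensorAppend M [x] (y :: l)).hom).1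
    ((Category.assoc _ _ _).trans (h₃.trans zero_comp.symm))

/-- In the resolution of the identity only the term of `[op x]` survives: the empty list has length
`0`, a singleton is determined by its length, and longer lists contribute zero. -/
theorem eq_frobPrj_singleton_of_isPrimitive {x : AugmentedSimplexCategory} {W : V}
    {g : W ⟶ (frobObject M).functor.obj (op (narrow.obj x))} (hg : (frobObject M).IsPrimitive g) :
    g = (g ≫ frobPrj M (narrow.obj x).len [op x] (Nat.add_zero _) ≫ (ρ_ (M.obj (op x))).hom) ≫
      frobSingle M (op x) := by
  have h : ∀ l (hl : listLen l = (narrow.obj x).len), l ≠ [op x] →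
      g ≫ frobPrj M (narrow.obj x).len l hl = 0 := by
    intro l hl hne
    match l with
    | [] =>
      have := narrow_len_pos x
      rw [listLen_nil] at hl
      omega
    | [y] =>
      exact absurd (congrArg (fun z => [z]) (unop_injective (narrow_obj_len_injective
        (x := y.unop) (y := x) ((Nat.add_zero _).symm.trans hl)))) hne
    | y :: z :: l => exact frobPrj_eq_zero_of_isPrimitive hg hl
  have key : ∀ {k : W ⟶ frobObj M (narrow.obj x).len}, (∀ l hl, l ≠ [op x] →
      k ≫ frobPrj M (narrow.obj x).len l hl = 0) →
      k = k ≫ frobPrj M (narrow.obj x).len [op x] (Nat.add_zero _) ≫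
        frobInc M (narrow.obj x).len [op x] (Nat.add_zero _) := by
    intro k hk
    conv_lhs => rw [← Category.comp_id k, ← frobObj_total, Preadditive.comp_sum,
      Finset.sum_eq_single (⟨[op x], Nat.add_zero _⟩ : Subdivision (narrow.obj x).len)
        (fun l _ hl => by
          rw [← Category.assoc, hk l.1 l.2 fun e => hl (Subtype.ext e), zero_comp])
        (fun h => absurd (Finset.mem_univ _) h)]
  refine (key h).trans ?_
  have h' : ∀ {A B D E : V} {g : A ⟶ B} {p : B ⟶ D ⊗ 𝟙_ V} {i : D ⊗ 𝟙_ V ⟶ E},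
      g ≫ p ≫ i = (g ≫ p ≫ (ρ_ D).hom) ≫ (ρ_ D).inv ≫ i := by simp
  exact h'

/-- The trivial subdivision has no interior cut, so every nontrivial comultiplication annihilates
its summand. -/
theorem isPrimitive_frobSingle (x : AugmentedSimplexCategory) :
    (frobObject M).IsPrimitive (n := narrow.obj x) (frobSingle M (op x)) := by
  intro k l hk hl h
  have h' : k.len + l.len = (narrow.obj x).len := h
  have hx : listLen [op x] = k.len + l.len := (Nat.add_zero _).trans h'.symm
  have key : ∀ {A B C D E : V} {r : A ⟶ B} {i : B ⟶ C} {j : B ⟶ D} {m : C ⟶ D} {c : D ⟶ E},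
      i ≫ m = j → j ≫ c = 0 → (r ≫ i) ≫ m ≫ c = 0 := by
    rintro A B C D E r i _ m c rfl h
    rw [Category.assoc, ← Category.assoc i, h, comp_zero]
  exact key (frobInc_map_of_isIso (isoOfEq h).hom (Nat.add_zero _) hx)
    (frobInc_comul_eq_zero hx (not_cuts_cons hk (show k.len < (narrow.obj x).len by omega)))

variable (M) in
theorem isKernelCone_frobCone : (frobObject M).IsKernelCone (frobCone M) where
  primitive := isPrimitive_frobSingle
  existsUnique_lift x W g hg := by
    refine ⟨_, (eq_frobPrj_singleton_of_isPrimitive hg).symm, fun g' hg' => ?_⟩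
    have hg'' : g' ≫ frobSingle M (op x) = g := hg'
    have := frobSingle_prj (M := M) (op x)
    rw [← hg'']
    have h : ∀ {A B C D : V} {g : A ⟶ B} {s : B ⟶ C} {p : C ⟶ D} {r : D ⟶ B}, s ≫ p ≫ r = 𝟙 _ →
        g = (g ≫ s) ≫ p ≫ r := by
      intro A B C D g s p r h
      rw [Category.assoc, h, Category.comp_id]
    exact h this

end FrobCone

/-! ### The comparison morphism of a cone -/

open FiniteInterval Functor.LaxMonoidal Functor.OplaxMonoidal

namespace FrobeniusFunctor

section

variable {U : Type u₁} [Category.{v₁} U] [MonoidalCategory U]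
  {V : Type u} [Category.{v} V] [MonoidalCategory V] (X : FrobeniusFunctor U V)

theorem δ_unit_right (A : U) : δ X.functor A (𝟙_ U) =
    X.functor.map (ρ_ A).hom ≫ (ρ_ (X.functor.obj A)).inv ≫ X.functor.obj A ◁ ε X.functor := by
  rw [Functor.OplaxMonoidal.right_unitality X.functor A]
  simp only [Category.assoc]
  rw [← MonoidalCategory.whiskerLeft_comp, X.counit_unit, MonoidalCategory.whiskerLeft_id,
    Category.comp_id, ← X.functor.map_comp_assoc, Iso.hom_inv_id, X.functor.map_id,
    Category.id_comp]

theorem μ_unit_left (A : U) : μ X.functor (𝟙_ U) A =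
    η X.functor ▷ X.functor.obj A ≫ (λ_ (X.functor.obj A)).hom ≫ X.functor.map (λ_ A).inv := by
  rw [Functor.LaxMonoidal.left_unitality X.functor A]
  simp only [Category.assoc]
  rw [← comp_whiskerRight_assoc, X.counit_unit, id_whiskerRight, Category.id_comp,
    ← X.functor.map_comp, Iso.hom_inv_id, X.functor.map_id, Category.comp_id]

/-- The first Frobenius law at `A`, `𝟙_ U`, `B`. By strong unitality its left side reduces to
unitors, while naturality turns its right side into `μ` followed by `δ`. -/
theorem μ_δ (A B : U) : μ X.functor A B ≫ δ X.functor A B = 𝟙 _ := by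
  have h : X.functor.map (ρ_ A).inv ▷ X.functor.obj B ≫
      (δ X.functor A (𝟙_ U) ▷ X.functor.obj B ≫ (α_ _ _ _).hom ≫
        X.functor.obj A ◁ μ X.functor (𝟙_ U) B) ≫
        X.functor.obj A ◁ X.functor.map (λ_ B).hom = 𝟙 _ := by
    rw [δ_unit_right, μ_unit_left]
    have key : ∀ {P P' Q Q' E : V} {r' : P ⟶ P'} {r : P' ⟶ P} {e : 𝟙_ V ⟶ E} {n : E ⟶ 𝟙_ V}
        {l' : Q ⟶ Q'} {l : Q' ⟶ Q}, r' ≫ r = 𝟙 _ → e ≫ n = 𝟙 _ → l' ≫ l = 𝟙 _ →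
        r' ▷ Q ≫ ((r ≫ (ρ_ P).inv ≫ P ◁ e) ▷ Q ≫ (α_ _ _ _).hom ≫
          P ◁ (n ▷ Q ≫ (λ_ Q).hom ≫ l')) ≫ P ◁ l = 𝟙 _ := by
      intro P P' Q Q' E r' r e n l' l hr he hl
      simp only [Category.assoc, ← MonoidalCategory.whiskerLeft_comp, hl, Category.comp_id]
      rw [← comp_whiskerRight_assoc, reassoc_of% hr, comp_whiskerRight, Category.assoc,
        associator_naturality_middle_assoc, ← MonoidalCategory.whiskerLeft_comp,
        ← comp_whiskerRight_assoc, he]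
      simp
    exact key (by rw [← X.functor.map_comp, Iso.inv_hom_id, X.functor.map_id]) X.unit_counit
      (by rw [← X.functor.map_comp, Iso.inv_hom_id, X.functor.map_id])
  rw [X.frobenius_left] at h
  simp only [Category.assoc] at h
  rw [δ_natural_right, μ_natural_left_assoc, ← X.functor.map_comp_assoc,
    ← X.functor.map_comp_assoc] at h
  simpa using h

/-- The case of a cut inside the first factor: the Frobenius law carries the comultiplication across
the product to that factor, where it vanishes. The next lemma treats a cut inside the second factor.
-/
theorem lax_comp_colax_eq_zero_left [Preadditive V] [MonoidalPreadditive V] {P L A B B' : U}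
    (u : P ⟶ A ⊗ B') (w : B' ⊗ L ⟶ B)
    {W W' : V} (i : W ⟶ X.functor.obj P) (d : W' ⟶ X.functor.obj L)
    (h : i ≫ X.functor.map u ≫ δ X.functor A B' = 0) :
    ((i ⊗ₘ d) ≫ μ X.functor P L) ≫ X.functor.map (u ▷ L ≫ (α_ A B' L).hom ≫ A ◁ w) ≫
      δ X.functor A B = 0 := by
  rw [X.functor.map_comp, X.functor.map_comp]
  simp only [Category.assoc]
  rw [← δ_natural_right, ← μ_natural_left_assoc, ← reassoc_of% (X.frobenius_left A B' L)]
  have h' : (i ⊗ₘ d) ≫ X.functor.map u ▷ X.functor.obj L ≫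
      δ X.functor A B' ▷ X.functor.obj L = 0 := by
    rw [← tensorHom_id, ← tensorHom_id, tensorHom_comp_tensorHom, tensorHom_comp_tensorHom, h,
      MonoidalPreadditive.zero_tensor]
  rw [reassoc_of% h', zero_comp]

theorem lax_comp_colax_eq_zero_right [Preadditive V] [MonoidalPreadditive V] {P L A A' B : U}
    (u : L ⟶ A' ⊗ B) (w : P ⊗ A' ⟶ A)
    {W W' : V} (i : W ⟶ X.functor.obj P) (d : W' ⟶ X.functor.obj L)
    (h : d ≫ X.functor.map u ≫ δ X.functor A' B = 0) :
    ((i ⊗ₘ d) ≫ μ X.functor P L) ≫ X.functor.map (P ◁ u ≫ (α_ P A' B).inv ≫ w ▷ B) ≫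
      δ X.functor A B = 0 := by
  rw [X.functor.map_comp, X.functor.map_comp]
  simp only [Category.assoc]
  rw [← δ_natural_left, ← μ_natural_right_assoc, ← reassoc_of% (X.frobenius_right P A' B)]
  have h' : (i ⊗ₘ d) ≫ X.functor.obj P ◁ X.functor.map u ≫
      X.functor.obj P ◁ δ X.functor A' B = 0 := by
    rw [← id_tensorHom, ← id_tensorHom, tensorHom_comp_tensorHom, tensorHom_comp_tensorHom, h,
      MonoidalPreadditive.tensor_zero]
  rw [reassoc_of% h', zero_comp]

end

section

variable {V : Type u} [Category.{v} V] [MonoidalCategory V] [Preadditive V]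
  {X : FrobeniusFunctor FiniteIntervalᵒᵖ V} {M : AugmentedSimplexCategoryᵒᵖ ⥤ V}
  {ι : M ⟶ narrow.op ⋙ X.functor}

/-- Isomorphisms of intervals are identity functions, so any diagram of structural isomorphisms
between them commutes. -/
theorem _root_.FiniteInterval.op_hom_eq_of_isIso {P Q : FiniteIntervalᵒᵖ} {f g : P ⟶ Q} (_ : IsIso f)
    (_ : IsIso g) : f = g :=
  Quiver.Hom.unop_inj (hom_ext_val fun i _ => by rw [val_of_isIso, val_of_isIso])

theorem listDesc_comul_eq_zero [MonoidalPreadditive V]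
    (hι : ∀ n : AugmentedSimplexCategory, X.IsPrimitive (n := narrow.obj n) (ι.app (op n)))
    {l : List AugmentedSimplexCategoryᵒᵖ} {A B : FiniteIntervalᵒᵖ}
    (f : listTensor narrow.op l ⟶ A ⊗ B) [IsIso f] (hl : ¬ cuts l A.unop.len) :
    listDesc ι l ≫ X.functor.map f ≫ δ X.functor A B = 0 := by
  have hlen : A.unop.len + B.unop.len = listLen l := len_eq_of_isIso f.unop
  induction l generalizing A B with
  | nil =>
    rw [listLen_nil] at hlen
    exact absurd (show A.unop.len = 0 by omega) hl
  | cons x l ih =>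
    have h0 : 0 < A.unop.len := by
      rcases Nat.eq_zero_or_pos A.unop.len with h | h
      · exact absurd (h ▸ cuts_zero _) hl
      · exact h
    rw [listLen_cons] at hlen
    have key₁ : ∀ {P L A B B' : FiniteIntervalᵒᵖ} {u : P ⟶ A ⊗ B'} {w : B' ⊗ L ⟶ B}
        {f : P ⊗ L ⟶ A ⊗ B}, IsIso f → IsIso u → IsIso w →
          f = u ▷ L ≫ (α_ A B' L).hom ≫ A ◁ w := fun _ _ _ =>
      op_hom_eq_of_isIso inferInstance inferInstance
    have key₂ : ∀ {P L A A' B : FiniteIntervalᵒᵖ} {u : L ⟶ A' ⊗ B} {w : P ⊗ A' ⟶ A}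
        {f : P ⊗ L ⟶ A ⊗ B}, IsIso f → IsIso u → IsIso w →
          f = P ◁ u ≫ (α_ P A' B).inv ≫ w ▷ B := fun _ _ _ =>
      op_hom_eq_of_isIso inferInstance inferInstance
    -- If the cut is inside the first block, primitivity of `ι` applies to that block. Otherwise the
    -- cut belongs to the rest of the list and the induction hypothesis applies there.
    rcases Nat.lt_or_ge A.unop.len (narrow.obj x.unop).len with h | h
    · let B' : FiniteIntervalᵒᵖ := op ⟨(narrow.obj x.unop).len - A.unop.len⟩
      have h₁ : (A.unop ⊗ B'.unop).len = (narrow.obj x.unop).len :=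
        Nat.add_sub_of_le h.le
      have h₂ : B.unop.len = (B'.unop ⊗ (listTensor narrow.op l).unop).len := by
        change _ = (narrow.obj x.unop).len - A.unop.len + listLen l
        omega
      let u : narrow.op.obj x ⟶ A ⊗ B' := (isoOfEq h₁).hom.op
      let w : B' ⊗ listTensor narrow.op l ⟶ B := (isoOfEq h₂).hom.op
      have : IsIso u := inferInstanceAs (IsIso (isoOfEq h₁).hom.op)
      have : IsIso w := inferInstanceAs (IsIso (isoOfEq h₂).hom.op)
      have hf : f = u ▷ listTensor narrow.op l ≫ (α_ A B' (listTensor narrow.op l)).hom ≫ A ◁ w :=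
        key₁ ‹_› ‹_› ‹_›
      exact (congrArg (fun t => listDesc ι (x :: l) ≫ X.functor.map t ≫ δ X.functor A B) hf).trans
        (X.lax_comp_colax_eq_zero_left u w (ι.app x) (listDesc ι l)
          (hι x.unop A.unop B'.unop h0 (Nat.sub_pos_of_lt h) h₁))
    · let A' : FiniteIntervalᵒᵖ := op ⟨A.unop.len - (narrow.obj x.unop).len⟩
      have h₁ : (A'.unop ⊗ B.unop).len = (listTensor narrow.op l).unop.len := by
        change A.unop.len - (narrow.obj x.unop).len + B.unop.len = listLen l
        omega
      have h₂ : A.unop.len = (narrow.obj x.unop ⊗ A'.unop).len :=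
        (Nat.add_sub_of_le h).symm
      let u : listTensor narrow.op l ⟶ A' ⊗ B := (isoOfEq h₁).hom.op
      let w : narrow.op.obj x ⊗ A' ⟶ A := (isoOfEq h₂).hom.op
      have : IsIso u := inferInstanceAs (IsIso (isoOfEq h₁).hom.op)
      have : IsIso w := inferInstanceAs (IsIso (isoOfEq h₂).hom.op)
      have hf : f = narrow.op.obj x ◁ u ≫ (α_ (narrow.op.obj x) A' B).inv ≫ w ▷ B :=
        key₂ ‹_› ‹_› ‹_›
      have hl' : ¬ cuts l A'.unop.len := by
        rw [← cuts_cons_add x]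
        change ¬ cuts (x :: l) ((narrow.obj x.unop).len + (A.unop.len - (narrow.obj x.unop).len))
        rwa [Nat.add_sub_of_le h]
      exact (congrArg (fun t => listDesc ι (x :: l) ≫ X.functor.map t ≫ δ X.functor A B) hf).trans
        (X.lax_comp_colax_eq_zero_right u w (ι.app x) (listDesc ι l) (ih u hl' h₁))

end

noncomputable section

variable {V : Type u} [Category.{v} V] [MonoidalCategory V] [Preadditive V]
  [HasFiniteBiproducts V] {X : FrobeniusFunctor FiniteIntervalᵒᵖ V}
  {M : AugmentedSimplexCategoryᵒᵖ ⥤ V} (ι : M ⟶ narrow.op ⋙ X.functor)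

/-- The isomorphism from `[n]` to the concatenation of a list. -/
abbrev castList (n : FiniteIntervalᵒᵖ) (l : List AugmentedSimplexCategoryᵒᵖ)
    (h : listLen l = n.unop.len) : listTensor narrow.op l ⟶ n :=
  (isoOfEq (m := n.unop) (n := (listTensor narrow.op l).unop) h.symm).hom.op

instance (n : FiniteIntervalᵒᵖ) (l : List AugmentedSimplexCategoryᵒᵖ)
    (h : listLen l = n.unop.len) : IsIso (castList n l h) :=
  inferInstanceAs (IsIso (isoOfEq (n := (listTensor narrow.op l).unop) h.symm).hom.op)

/-- The components of the comparison morphism of a cone. -/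
def comparisonApp (n : FiniteIntervalᵒᵖ) : frobObj M n.unop.len ⟶ X.functor.obj n :=
  frobDesc M fun l h => listDesc ι l ≫ X.functor.map (castList n l h)

theorem frobInc_comparisonApp (n : FiniteIntervalᵒᵖ) (l : List AugmentedSimplexCategoryᵒᵖ)
    (h : listLen l = n.unop.len) :
    frobInc M n.unop.len l h ≫ comparisonApp ι n =
      listDesc ι l ≫ X.functor.map (castList n l h) :=
  frobInc_desc _ l h

theorem comparisonApp_natural [M.LaxMonoidal] [NatTrans.IsMonoidal ι] {m n : FiniteIntervalᵒᵖ}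
    (f : m ⟶ n) : frobMap M f.unop ≫ comparisonApp ι n =
      comparisonApp ι m ≫ X.functor.map f := by
  refine frobObj_hom_ext fun l hl => ?_
  obtain ⟨l', e, hl', he⟩ := exists_listHomVal hl f.unop
  rw [reassoc_of% (frobInc_map f.unop hl hl' e he), frobInc_comparisonApp,
    reassoc_of% (frobInc_comparisonApp ι m l hl), reassoc_of% (ListHom.map_listDesc ι e),
    ← X.functor.map_comp, ← X.functor.map_comp]
  congr 2
  refine Quiver.Hom.unop_inj (hom_ext_val fun i hi => ?_)
  refine (val_comp _ _ i).trans (Eq.trans ?_ (val_comp _ _ i).symm)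
  have h₁ : Hom.val (castList n l' hl').unop i = i :=
    (val_of_isIso _ i).trans (min_eq_left hi)
  have h₂ : Hom.val (castList m l hl).unop (Hom.val f.unop i) = Hom.val f.unop i :=
    (val_of_isIso _ _).trans (min_eq_left (val_le _ _))
  rw [h₁, h₂]
  exact he i hi

theorem comparisonApp_tensor [MonoidalPreadditive V] (A B : FiniteIntervalᵒᵖ) :
    frobMul M A.unop.len B.unop.len ≫ comparisonApp ι (A ⊗ B) =
      (comparisonApp ι A ⊗ₘ comparisonApp ι B) ≫ μ X.functor A B := by
  refine frobObj_tensor_hom_ext fun a ha b hb => ?_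
  have hab : listLen (a ++ b) = A.unop.len + B.unop.len := by rw [listLen_append, ha, hb]
  have h₁ : frobInc M (A.unop.len + B.unop.len) (a ++ b) hab ≫ comparisonApp ι (A ⊗ B) =
      listDesc ι (a ++ b) ≫ X.functor.map (castList (A ⊗ B) (a ++ b) hab) :=
    frobInc_comparisonApp ι (A ⊗ B) (a ++ b) hab
  have h₂ : castList (A ⊗ B) (a ++ b) hab = (listTensorAppend narrow.op a b).hom ≫
      (castList A a ha ⊗ₘ castList B b hb) := op_hom_eq_of_isIso inferInstance inferInstance
  rw [reassoc_of% (frobInc_mul ha hb), h₁, h₂, X.functor.map_comp,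
    reassoc_of% (listDesc_append ι a b), Iso.inv_hom_id_assoc, tensorHom_comp_tensorHom_assoc,
    frobInc_comparisonApp, frobInc_comparisonApp, ← μ_natural, tensorHom_comp_tensorHom_assoc]

/-- At a subdivision cut at `A`, the iterated product is the product of two iterated products and
`μ_δ` cancels. At any other subdivision both sides vanish, because the cone is primitive. -/
theorem comparisonApp_comul [MonoidalPreadditive V]
    (hι : ∀ n : AugmentedSimplexCategory, X.IsPrimitive (n := narrow.obj n) (ι.app (op n)))
    (A B : FiniteIntervalᵒᵖ) :
    comparisonApp ι (A ⊗ B) ≫ δ X.functor A B =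
      frobComul M A.unop.len B.unop.len ≫ (comparisonApp ι A ⊗ₘ comparisonApp ι B) := by
  refine frobObj_hom_ext fun l hl => ?_
  by_cases hc : cuts l A.unop.len
  · obtain ⟨a, b, rfl, ha, hb⟩ := exists_append_of_cuts' hl hc
    have h₂ : castList (A ⊗ B) (a ++ b) hl = (listTensorAppend narrow.op a b).hom ≫
        (castList A a ha ⊗ₘ castList B b hb) := op_hom_eq_of_isIso inferInstance inferInstance
    have h₃ : frobInc M (A.unop.len + B.unop.len) (a ++ b) hl ≫ comparisonApp ι (A ⊗ B) ≫
        δ X.functor A B = (listTensorAppend M a b).hom ≫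
          ((listDesc ι a ≫ X.functor.map (castList A a ha)) ⊗ₘ
            (listDesc ι b ≫ X.functor.map (castList B b hb))) := by
      refine ((Category.assoc _ _ _).symm.trans (congrArg (· ≫ δ X.functor A B)
        (frobInc_comparisonApp ι (A ⊗ B) (a ++ b) hl))).trans ?_
      rw [h₂, X.functor.map_comp, reassoc_of% (listDesc_append ι a b), Category.assoc,
        Category.assoc, Category.assoc, ← μ_natural_assoc, μ_δ, Category.comp_id,
        tensorHom_comp_tensorHom]
    have h₄ : frobInc M (A.unop.len + B.unop.len) (a ++ b) hl ≫
        frobComul M A.unop.len B.unop.len ≫ (comparisonApp ι A ⊗ₘ comparisonApp ι B) =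
          (listTensorAppend M a b).hom ≫ ((listDesc ι a ≫ X.functor.map (castList A a ha)) ⊗ₘ
            (listDesc ι b ≫ X.functor.map (castList B b hb))) := by
      rw [reassoc_of% (frobInc_comul (M := M) ha hb hl), tensorHom_comp_tensorHom,
        frobInc_comparisonApp, frobInc_comparisonApp]
    exact h₃.trans h₄.symm
  · refine ((Category.assoc _ _ _).symm.trans (congrArg (· ≫ δ X.functor A B)
      (frobInc_comparisonApp ι (A ⊗ B) l hl))).trans ?_
    have h₄ : frobInc M (A.unop.len + B.unop.len) l hl ≫
        frobComul M A.unop.len B.unop.len ≫ (comparisonApp ι A ⊗ₘ comparisonApp ι B) = 0 := by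
      rw [reassoc_of% (frobInc_comul_eq_zero (M := M) hl hc), zero_comp]
    exact ((Category.assoc _ _ _).trans
      (listDesc_comul_eq_zero hι (castList (A ⊗ B) l hl) hc)).trans h₄.symm

theorem comparisonApp_unit : frobUnit M ≫ comparisonApp ι (𝟙_ FiniteIntervalᵒᵖ) = ε X.functor := by
  refine (frobInc_comparisonApp ι (𝟙_ FiniteIntervalᵒᵖ) [] rfl).trans ?_
  have h : castList (𝟙_ FiniteIntervalᵒᵖ) [] rfl = 𝟙 (𝟙_ FiniteIntervalᵒᵖ) :=
    op_hom_eq_of_isIso (P := 𝟙_ FiniteIntervalᵒᵖ)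
      (inferInstanceAs (IsIso (isoOfEq (m := 𝟙_ FiniteInterval) rfl).hom.op)) inferInstance
  refine (congrArg (fun t => ε X.functor ≫ X.functor.map t) h).trans ?_
  rw [X.functor.map_id, Category.comp_id]

theorem comparisonApp_zero :
    comparisonApp ι (𝟙_ FiniteIntervalᵒᵖ) = frobCounit M ≫ ε X.functor := by
  rw [← comparisonApp_unit ι, ← Category.assoc, frobCounit_unit]
  exact (Category.id_comp _).symm

theorem frobSingle_comparisonApp (x : AugmentedSimplexCategoryᵒᵖ) :
    frobSingle M x ≫ comparisonApp ι (op (narrow.obj x.unop)) = ι.app x := by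
  have h₁ : castList (op (narrow.obj x.unop)) [x] (Nat.add_zero _) = (ρ_ (narrow.op.obj x)).hom :=
    op_hom_eq_of_isIso inferInstance (Iso.isIso_hom (ρ_ (narrow.op.obj x)))
  have h₂ : frobInc M (narrow.obj x.unop).len [x] (Nat.add_zero _) ≫
      comparisonApp ι (op (narrow.obj x.unop)) =
        ((ι.app x ⊗ₘ ε X.functor) ≫ μ X.functor (narrow.op.obj x) (𝟙_ FiniteIntervalᵒᵖ)) ≫
          X.functor.map (ρ_ (narrow.op.obj x)).hom :=
    (frobInc_comparisonApp ι (op (narrow.obj x.unop)) [x] (Nat.add_zero _)).trans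
      (congrArg (fun t => listDesc ι [x] ≫ X.functor.map t) h₁)
  have key : ∀ {A B : V} {P : FiniteIntervalᵒᵖ} {i : A ⊗ 𝟙_ V ⟶ B} {c : B ⟶ X.functor.obj P}
      {t : A ⟶ X.functor.obj P}, i ≫ c = ((t ⊗ₘ ε X.functor) ≫ μ X.functor P (𝟙_ _)) ≫
        X.functor.map (ρ_ P).hom → ((ρ_ A).inv ≫ i) ≫ c = t := by
    intro A B P i c t h
    rw [Category.assoc, h, MonoidalCategory.tensorHom_def]
    simp only [Category.assoc]
    rw [← Functor.LaxMonoidal.right_unitality, rightUnitor_naturality, Iso.inv_hom_id_assoc]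
  exact key h₂

variable [MonoidalPreadditive V] [M.LaxMonoidal] [NatTrans.IsMonoidal ι]

/-- The comparison morphism of a cone of primitive morphisms. -/
def comparison
    (hι : ∀ n : AugmentedSimplexCategory, X.IsPrimitive (n := narrow.obj n) (ι.app (op n))) :
    frobObject M ⟶ X where
  natTrans := { app := comparisonApp ι, naturality := fun _ _ f => comparisonApp_natural ι f }
  lax_unit := comparisonApp_unit ι
  lax_tensor := comparisonApp_tensor ι
  colax_unit := by
    have h : comparisonApp ι (𝟙_ FiniteIntervalᵒᵖ) ≫ η X.functor = frobCounit M := by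
      rw [comparisonApp_zero, Category.assoc, X.unit_counit, Category.comp_id]
    exact h
  colax_tensor := comparisonApp_comul ι hι

end

end FrobeniusFunctor

/-! ### The comparison morphism of a kernel cone is an isomorphism -/

open FiniteInterval Functor.LaxMonoidal Functor.OplaxMonoidal

namespace FrobeniusFunctor

section

variable {U : Type u₁} [Category.{v₁} U] [MonoidalCategory U]
  {V : Type u} [Category.{v} V] [MonoidalCategory V] (X : FrobeniusFunctor U V)

/-- By the Frobenius law and coassociativity, splitting at the later cut and then comultiplying at
the earlier one factors through the earlier comultiplication. Hence a later idempotent preserves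
vanishing at earlier cuts. -/
theorem δ_μ_δ (A B C : U) : δ X.functor (A ⊗ B) C ≫ μ X.functor (A ⊗ B) C ≫
    X.functor.map (α_ A B C).hom ≫ δ X.functor A (B ⊗ C) =
      X.functor.map (α_ A B C).hom ≫ δ X.functor A (B ⊗ C) ≫
        X.functor.obj A ◁ (δ X.functor B C ≫ μ X.functor B C) := by
  rw [← X.frobenius_left, MonoidalCategory.whiskerLeft_comp, ← Functor.OplaxMonoidal.associativity_assoc]

/-- The idempotent endomorphism given by a decomposition. -/
def splitting {P K L : U} (f : P ≅ K ⊗ L) : X.functor.obj P ⟶ X.functor.obj P :=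
  X.functor.map f.hom ≫ δ X.functor K L ≫ μ X.functor K L ≫ X.functor.map f.inv

/-- A consequence of `μ_δ`. It makes the complement of the idempotent vanish under its own
comultiplication. -/
theorem splitting_comul {P K L : U} (f : P ≅ K ⊗ L) :
    X.splitting f ≫ X.functor.map f.hom ≫ δ X.functor K L =
      X.functor.map f.hom ≫ δ X.functor K L := by
  unfold splitting
  simp only [Category.assoc]
  rw [← X.functor.map_comp_assoc f.inv, Iso.inv_hom_id, X.functor.map_id, Category.id_comp, μ_δ,
    Category.comp_id]

theorem comp_splitting_comul [Preadditive V] {P A B C : U} (f : P ≅ (A ⊗ B) ⊗ C) {W : V}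
    {g : W ⟶ X.functor.obj P}
    (h : g ≫ X.functor.map (f.hom ≫ (α_ A B C).hom) ≫ δ X.functor A (B ⊗ C) = 0) :
    (g ≫ X.splitting f) ≫ X.functor.map (f.hom ≫ (α_ A B C).hom) ≫ δ X.functor A (B ⊗ C) = 0 := by
  unfold splitting
  simp only [Category.assoc]
  rw [← X.functor.map_comp_assoc f.inv, Iso.inv_hom_id_assoc, δ_μ_δ]
  rw [X.functor.map_comp, Category.assoc] at h
  rw [reassoc_of% h, zero_comp]

end

noncomputable section

variable {V : Type u} [Category.{v} V] [MonoidalCategory V] [Preadditive V]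
  {X : FrobeniusFunctor FiniteIntervalᵒᵖ V}

theorem comp_splitting_comul_of_lt {n k l K L : FiniteInterval} (h : (k ⊗ l).len = n.len)
    (h' : (K ⊗ L).len = n.len) (hk : k.len ≤ K.len) {W : V} {g : W ⟶ X.functor.obj (op n)}
    (hg : g ≫ X.functor.map (isoOfEq h).hom.op ≫ δ X.functor (op k) (op l) = 0) :
    (g ≫ X.splitting (K := op K) (L := op L) (isoOfEq h').op) ≫
      X.functor.map (isoOfEq h).hom.op ≫ δ X.functor (op k) (op l) = 0 := by
  obtain ⟨n⟩ := n
  obtain ⟨k⟩ := k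
  obtain ⟨l⟩ := l
  obtain ⟨K⟩ := K
  obtain ⟨L⟩ := L
  obtain ⟨b, rfl⟩ := Nat.exists_eq_add_of_le (show k ≤ K from hk)
  have h₁ : k + l = n := h
  have h₂ : k + b + L = n := h'
  obtain rfl : l = b + L := by omega
  have h₃ : (isoOfEq h).hom.op = (isoOfEq h').op.hom ≫
      (α_ (op (⟨k⟩ : FiniteInterval)) (op ⟨b⟩) (op ⟨L⟩)).hom :=
    op_hom_eq_of_isIso (inferInstanceAs (IsIso (isoOfEq h).hom.op)) (by
      have : IsIso (isoOfEq h').op.hom := Iso.isIso_hom _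
      have : IsIso (α_ (op (⟨k⟩ : FiniteInterval)) (op ⟨b⟩) (op ⟨L⟩)).hom := Iso.isIso_hom _
      exact IsIso.comp_isIso)
  have hg' := (congrArg (fun t => g ≫ X.functor.map t ≫
    δ X.functor (op (⟨k⟩ : FiniteInterval)) (op ⟨b⟩ ⊗ op ⟨L⟩)) h₃).symm.trans hg
  refine (congrArg (fun t => (g ≫ X.splitting (isoOfEq h').op) ≫ X.functor.map t ≫
    δ X.functor (op (⟨k⟩ : FiniteInterval)) (op ⟨b⟩ ⊗ op ⟨L⟩)) h₃).trans ?_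
  exact X.comp_splitting_comul (P := op ⟨n⟩) (A := op ⟨k⟩) (B := op ⟨b⟩) (C := op ⟨L⟩)
    (isoOfEq h').op hg'

variable [HasFiniteBiproducts V] [MonoidalPreadditive V]
  {M : AugmentedSimplexCategoryᵒᵖ ⥤ V} [M.LaxMonoidal] (ι : M ⟶ narrow.op ⋙ X.functor)
  [NatTrans.IsMonoidal ι]

/-- The idempotent passes through the tensor product of the values at `K` and `L`. There the
comparison is inverted, and the product is formed in the sum over subdivisions instead. -/
theorem exists_comp_comparisonApp_eq_splitting {n K L : FiniteInterval}
    (h : (K ⊗ L).len = n.len) [IsIso (comparisonApp ι (op K))] [IsIso (comparisonApp ι (op L))] :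
    ∃ d, d ≫ comparisonApp ι (op n) = X.splitting (K := op K) (L := op L) (isoOfEq h).op := by
  refine ⟨X.functor.map (isoOfEq h).hom.op ≫ δ X.functor (op K) (op L) ≫
    (inv (comparisonApp ι (op K)) ⊗ₘ inv (comparisonApp ι (op L))) ≫ frobMul M K.len L.len ≫
      frobMap M (isoOfEq h).inv, ?_⟩
  have h₁ := comparisonApp_natural ι (isoOfEq h).inv.op
  have h₂ := comparisonApp_tensor ι (op K) (op L)
  have key : ∀ {A B C C' D E F G E' : V} {a : A ⟶ B} {b : B ⟶ C} {i : C ⟶ C'} {j : C' ⟶ C} {m : C' ⟶ D}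
      {p : D ⟶ E} {c : E ⟶ F} {c' : D ⟶ G} {m' : C ⟶ G} {p' : G ⟶ F}, p ≫ c = c' ≫ p' →
      m ≫ c' = j ≫ m' → i ≫ j = 𝟙 _ → (a ≫ b ≫ i ≫ m ≫ p) ≫ c = a ≫ b ≫ m' ≫ p' := by
    intro A B C C' D E F G E' a b i j m p c c' m' p' h₁ h₂ h₃
    simp only [Category.assoc]
    rw [h₁, reassoc_of% h₂, reassoc_of% h₃]
  exact key (E' := 𝟙_ V) h₁ h₂ (by
    rw [tensorHom_comp_tensorHom, IsIso.inv_hom_id, IsIso.inv_hom_id, id_tensorHom_id])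

/-- The morphism `q` is the product of the complements of the idempotents at the cuts `1, ..., m`,
taken in increasing order so that each new factor preserves the vanishing already achieved. -/
theorem exists_comp_comparisonApp_eq_sub {n : FiniteInterval}
    (hn : ∀ k : FiniteInterval, k.len < n.len → IsIso (comparisonApp ι (op k))) (m : ℕ) :
    ∃ (q : X.functor.obj (op n) ⟶ X.functor.obj (op n)) (d : _),
      d ≫ comparisonApp ι (op n) = 𝟙 _ - q ∧
      ∀ k l : FiniteInterval, 0 < k.len → 0 < l.len → k.len ≤ m → ∀ h : (k ⊗ l).len = n.len,
        q ≫ X.functor.map (isoOfEq h).hom.op ≫ δ X.functor (op k) (op l) = 0 := by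
  induction m with
  | zero => exact ⟨𝟙 _, 0, by simp, fun k l hk _ hk' => by omega⟩
  | succ m ih =>
    obtain ⟨q, d, hd, hq⟩ := ih
    rcases Nat.lt_or_ge (m + 1) n.len with hm | hm
    · have h : ((⟨m + 1⟩ : FiniteInterval) ⊗ (⟨n.len - (m + 1)⟩ : FiniteInterval)).len = n.len :=
        Nat.add_sub_of_le hm.le
      have := hn ⟨m + 1⟩ hm
      have := hn ⟨n.len - (m + 1)⟩ (Nat.sub_lt (by omega) (by omega))
      obtain ⟨d', hd'⟩ := exists_comp_comparisonApp_eq_splitting ι h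
      -- With `e` the new idempotent, `1 - q (1 - e) = (1 - q) + q e`, and both summands factor
      -- through the comparison.
      refine ⟨q - q ≫ X.splitting (K := op ⟨m + 1⟩) (L := op ⟨n.len - (m + 1)⟩) (isoOfEq h).op,
        d + q ≫ d', ?_, fun k l hk hl hkm hkl => ?_⟩
      · rw [Preadditive.add_comp, hd, Category.assoc, hd']
        abel
      · have hkl' : k.len + l.len = n.len := hkl
        rw [Preadditive.sub_comp]
        rcases Nat.lt_or_ge m k.len with hk' | hk'
        · obtain ⟨k⟩ := k
          obtain ⟨l⟩ := l
          obtain rfl : k = m + 1 := by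
            change k ≤ m + 1 at hkm
            change m < k at hk'
            omega
          obtain rfl : l = n.len - (m + 1) := by
            change m + 1 + l = n.len at hkl'
            omega
          rw [sub_eq_zero, Category.assoc]
          exact (congrArg (q ≫ ·) (X.splitting_comul (isoOfEq h).op)).symm
        · rw [hq k l hk hl hk' hkl, zero_sub, neg_eq_zero]
          exact comp_splitting_comul_of_lt hkl h hkm (hq k l hk hl hk' hkl)
    -- Once `m + 1` reaches the length of the interval there is no new cut, since `l` must be
    -- positive.
    · exact ⟨q, d, hd, fun k l hk hl hkm h => hq k l hk hl (by
        have h' : k.len + l.len = n.len := h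
        omega) h⟩

variable {ι}

/-- The comparison respects comultiplication and is invertible on shorter intervals, so a morphism
that it kills is primitive. It then factors through the trivial summand, where the comparison is
`ι`, and `0` lifts uniquely along `ι`. -/
theorem eq_zero_of_comp_comparisonApp (hι : X.IsKernelCone ι) {x : AugmentedSimplexCategory}
    (hx : ∀ k : FiniteInterval, k.len < (narrow.obj x).len → IsIso (comparisonApp ι (op k)))
    {W : V} {g : W ⟶ frobObj M (narrow.obj x).len}
    (hg : g ≫ comparisonApp ι (op (narrow.obj x)) = 0) : g = 0 := by
  have hg' : (frobObject M).IsPrimitive (n := narrow.obj x) g := by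
    intro k l hk hl h
    have hkl : k.len + l.len = (narrow.obj x).len := h
    have := hx k (by omega)
    have := hx l (by omega)
    have h₁ := comparisonApp_natural ι (isoOfEq h).hom.op
    have h₂ := comparisonApp_comul ι hι.primitive (op k) (op l)
    have key : ∀ {B C D E F G : V} {g : W ⟶ B} {a : B ⟶ C} {b : C ⟶ D} {c : B ⟶ E} {i : D ⟶ G}
        {c' : C ⟶ F} {a' : E ⟶ F} {b' : F ⟶ G}, IsIso i → g ≫ c = 0 → a ≫ c' = c ≫ a' →
        c' ≫ b' = b ≫ i → g ≫ a ≫ b = 0 := by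
      intro B C D E F G g a b c i c' a' b' hi hg h₁ h₂
      rw [← cancel_mono i, Category.assoc, Category.assoc, ← h₂, reassoc_of% h₁, reassoc_of% hg]
      simp
    exact key (MonoidalCategory.tensor_isIso (comparisonApp ι (op k)) (comparisonApp ι (op l))) hg h₁ h₂
  obtain ⟨g', hg', -⟩ := (isKernelCone_frobCone M).existsUnique_lift x W g hg'
  have hg'' : g' ≫ frobSingle M (op x) = g := hg'
  have h0 : g' ≫ ι.app (op x) = 0 := by
    rw [← frobSingle_comparisonApp ι (op x), ← hg, ← hg'', Category.assoc]
  obtain ⟨_, -, hu⟩ := hι.existsUnique_lift x W 0 fun k l _ _ h => zero_comp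
  rw [← hg'', hu g' h0, ← hu 0 zero_comp, zero_comp]

/-- Strong induction on the length, with strong unitality as the base case. For positive length the
comparison has a section and kills only zero, hence is invertible. -/
theorem isIso_comparisonApp (hι : X.IsKernelCone ι) (n : ℕ) :
    IsIso (comparisonApp ι (op (⟨n⟩ : FiniteInterval))) := by
  induction n using Nat.strong_induction_on with
  | h n ih =>
    rcases Nat.eq_zero_or_pos n with rfl | hn
    · refine ⟨η X.functor ≫ frobUnit M, ?_, ?_⟩
      · have h := comparisonApp_zero ι
        have key : ∀ {A B C : V} {c : A ⟶ C} {a : A ⟶ B} {b : B ⟶ C} {b' : C ⟶ B} {a' : B ⟶ A},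
            c = a ≫ b → b ≫ b' = 𝟙 _ → a ≫ a' = 𝟙 _ → c ≫ b' ≫ a' = 𝟙 _ := by
          rintro A B C _ a b b' a' rfl h₁ h₂
          rw [Category.assoc, reassoc_of% h₁, h₂]
        exact key h X.unit_counit frobCounit_unit
      · have h := comparisonApp_unit ι
        exact (Category.assoc _ _ _).trans ((congrArg (η X.functor ≫ ·) h).trans X.counit_unit)
    · obtain ⟨x, rfl⟩ := exists_narrow_obj_len hn
      have hx : ∀ k : FiniteInterval, k.len < (narrow.obj x).len →
          IsIso (comparisonApp ι (op k)) := fun k hk => ih k.len hk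
      -- Taken up to the full length, `q` is primitive and so lifts to the kernel. Adding this lift
      -- to `d`, which accounts for `1 - q`, yields the section.
      obtain ⟨q, d, hd, hq⟩ := exists_comp_comparisonApp_eq_sub ι (n := narrow.obj x) hx
        (narrow.obj x).len
      obtain ⟨g, hg, -⟩ := hι.existsUnique_lift x _ q fun k l hk hl h => hq k l hk hl (by
        have h' : k.len + l.len = (narrow.obj x).len := h
        omega) h
      have h₁ : (d + g ≫ frobSingle M (op x)) ≫ comparisonApp ι (op (narrow.obj x)) = 𝟙 _ := by
        have h := frobSingle_comparisonApp ι (op x)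
        have h' : (g ≫ frobSingle M (op x)) ≫ comparisonApp ι (op (narrow.obj x)) = q :=
          (Category.assoc _ _ _).trans ((congrArg (g ≫ ·) h).trans hg)
        rw [Preadditive.add_comp, hd, h', sub_add_cancel]
      refine ⟨_, ?_, h₁⟩
      rw [← sub_eq_zero]
      refine eq_zero_of_comp_comparisonApp hι hx ?_
      rw [Preadditive.sub_comp, Category.assoc]
      exact sub_eq_zero.2 ((congrArg (comparisonApp ι (op (narrow.obj x)) ≫ ·) h₁).trans
        ((Category.comp_id _).trans (Category.id_comp _).symm))

end

end FrobeniusFunctor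

/-! ### The universal property of kernel cones -/

open FiniteInterval Functor.LaxMonoidal Functor.OplaxMonoidal

namespace FrobeniusFunctor

/-- The inverse of a bimonoidal natural transformation whose components are isomorphisms. -/
noncomputable def homInv {U : Type u₁} [Category.{v₁} U] [MonoidalCategory U] {V : Type u}
    [Category.{v} V] [MonoidalCategory V] {X Y : FrobeniusFunctor U V} (α : X ⟶ Y)
    [∀ A, IsIso (α.natTrans.app A)] : Y ⟶ X where
  natTrans :=
    { app := fun A => inv (α.natTrans.app A)
      naturality := fun A B f => by
        rw [IsIso.comp_inv_eq, Category.assoc, α.natTrans.naturality, IsIso.inv_hom_id_assoc] }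
  lax_unit := by rw [IsIso.comp_inv_eq, α.lax_unit]
  lax_tensor A B := by
    rw [IsIso.comp_inv_eq, Category.assoc, α.lax_tensor, tensorHom_comp_tensorHom_assoc,
      IsIso.inv_hom_id, IsIso.inv_hom_id, id_tensorHom_id, Category.id_comp]
  colax_unit := by rw [IsIso.inv_comp_eq, α.colax_unit]
  colax_tensor A B := by
    rw [IsIso.inv_comp_eq, reassoc_of% (α.colax_tensor A B), tensorHom_comp_tensorHom,
      IsIso.hom_inv_id, IsIso.hom_inv_id, id_tensorHom_id, Category.comp_id]

variable {V : Type u} [Category.{v} V] [MonoidalCategory V] [Preadditive V]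
  [HasFiniteBiproducts V] [MonoidalPreadditive V] {X Y : FrobeniusFunctor FiniteIntervalᵒᵖ V}
  {M : AugmentedSimplexCategoryᵒᵖ ⥤ V} [M.LaxMonoidal] {ι : M ⟶ narrow.op ⋙ X.functor}
  [NatTrans.IsMonoidal ι]

/-- Since the comparison is an isomorphism, `X` is generated by its kernel under multiplication, and
compatibility with the lax structures propagates equality from the generators. -/
theorem hom_ext_of_isKernelCone (hι : X.IsKernelCone ι) {α α' : X ⟶ Y}
    (h : ∀ x : AugmentedSimplexCategoryᵒᵖ, ι.app x ≫ α.natTrans.app (narrow.op.obj x) =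
      ι.app x ≫ α'.natTrans.app (narrow.op.obj x)) : α = α' := by
  have key : ∀ l, listDesc ι l ≫ α.natTrans.app (listTensor narrow.op l) =
      listDesc ι l ≫ α'.natTrans.app (listTensor narrow.op l) := by
    intro l
    induction l with
    | nil => exact α.lax_unit.trans α'.lax_unit.symm
    | cons x l ih =>
      have h' : ∀ {W : V} {A : FiniteIntervalᵒᵖ} {d : W ⟶ X.functor.obj A},
          d ≫ α.natTrans.app A = d ≫ α'.natTrans.app A →
          ((ι.app x ⊗ₘ d) ≫ μ X.functor (narrow.op.obj x) A) ≫ α.natTrans.app (narrow.op.obj x ⊗ A) =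
            ((ι.app x ⊗ₘ d) ≫ μ X.functor (narrow.op.obj x) A) ≫
              α'.natTrans.app (narrow.op.obj x ⊗ A) := by
        intro W A d hd
        rw [Category.assoc, α.lax_tensor, tensorHom_comp_tensorHom_assoc, h, hd, Category.assoc,
          α'.lax_tensor, tensorHom_comp_tensorHom_assoc]
      exact h' ih
  refine Hom.ext (NatTrans.ext (funext fun n => ?_))
  have := isIso_comparisonApp hι n.unop.len
  refine (cancel_epi (comparisonApp ι n)).1 (frobObj_hom_ext fun l hl => ?_)
  rw [reassoc_of% (frobInc_comparisonApp ι n l hl), reassoc_of% (frobInc_comparisonApp ι n l hl),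
    α.natTrans.naturality, α'.natTrans.naturality, reassoc_of% (key l)]

/-- The comparison of `ι` is invertible, so the comparison of `ι'` can be composed with its inverse.
For this `ι'` only has to be monoidal and primitive, not universal. -/
theorem exists_hom_of_isKernelCone (hι : X.IsKernelCone ι) (ι' : M ⟶ narrow.op ⋙ Y.functor)
    [NatTrans.IsMonoidal ι'] (hι' : ∀ n : AugmentedSimplexCategory,
      Y.IsPrimitive (n := narrow.obj n) (ι'.app (op n))) :
    ∃ α : X ⟶ Y, ∀ x : AugmentedSimplexCategoryᵒᵖ,
      ι.app x ≫ α.natTrans.app (narrow.op.obj x) = ι'.app x := by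
  have : ∀ A, IsIso ((comparison ι hι.primitive).natTrans.app A) := fun A =>
    isIso_comparisonApp hι A.unop.len
  refine ⟨homInv (comparison ι hι.primitive) ≫ comparison ι' hι', fun x => ?_⟩
  have h₁ := frobSingle_comparisonApp ι x
  have h₂ := frobSingle_comparisonApp ι' x
  have key : ∀ {A B C D : V} {s : A ⟶ B} {c : B ⟶ C} {c' : C ⟶ B} {d : B ⟶ D} {i : A ⟶ C}
      {i' : A ⟶ D}, s ≫ c = i → s ≫ d = i' → c ≫ c' = 𝟙 _ → i ≫ c' ≫ d = i' := by
    rintro A B C D s c c' d _ _ rfl rfl h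
    rw [Category.assoc, reassoc_of% h]
  exact key h₁ h₂ (IsIso.hom_inv_id ((comparison ι hι.primitive).natTrans.app (narrow.op.obj x)))

end FrobeniusFunctor

/-! ### Monoids for Day convolution as lax monoidal functors -/

namespace DayMonoid

variable {C : Type u₁} [Category.{v₁} C] {V : Type u} [Category.{v} V]
  [MonoidalCategory C] [MonoidalCategory V]

theorem comp_app {F G H : C ⊛⥤ V} (f : F ⟶ G) (g : G ⟶ H) (x : C) :
    (f ≫ g).natTrans.app x = f.natTrans.app x ≫ g.natTrans.app x := rfl

variable
  [∀ (F G : C ⥤ V), (tensor C).HasPointwiseLeftKanExtension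
    (externalProduct F G)]
  [(Functor.fromPUnit.{0} <| 𝟙_ C).HasPointwiseLeftKanExtension
    (Functor.fromPUnit.{0} <| 𝟙_ V)]
  [∀ (v : V) (d : C), PreservesColimitsOfShape (CostructuredArrow (tensor C) d) (tensorLeft v)]
  [∀ (v : V) (d : C), PreservesColimitsOfShape (CostructuredArrow (tensor C) d) (tensorRight v)]
  [∀ (v : V) (d : C), PreservesColimitsOfShape
    (CostructuredArrow (Functor.fromPUnit.{0} <| 𝟙_ C) d) (tensorLeft v)]
  [∀ (v : V) (d : C), PreservesColimitsOfShape
    (CostructuredArrow (Functor.fromPUnit.{0} <| 𝟙_ C) d) (tensorRight v)]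
  [∀ (v : V) (d : C × C), PreservesColimitsOfShape
    (CostructuredArrow ((𝟭 C).prod <| Functor.fromPUnit.{0} <| 𝟙_ C) d) (tensorRight v)]
  [∀ (v : V) (d : C × C), PreservesColimitsOfShape
    (CostructuredArrow ((tensor C).prod (𝟭 C)) d) (tensorRight v)]

open LawfulDayConvolutionMonoidalCategoryStruct

/-- The components of the universal transformation into a Day convolution. -/
noncomputable def unitApp (F G : C ⊛⥤ V) (x y : C) :
    F.functor.obj x ⊗ G.functor.obj y ⟶ (F ⊗ G).functor.obj (x ⊗ y) :=
  (DayFunctor.η F G).app (x, y)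

theorem unitApp_naturality (F G : C ⊛⥤ V) {x x' y y' : C} (f : x ⟶ x') (g : y ⟶ y') :
    (F.functor.map f ⊗ₘ G.functor.map g) ≫ unitApp F G x' y' =
      unitApp F G x y ≫ (F ⊗ G).functor.map (f ⊗ₘ g) := by
  have h := (DayFunctor.η F G).naturality (X := (x, y)) (Y := (x', y')) (Prod.mkHom f g)
  rw [MonoidalCategory.tensorHom_def]
  exact h

theorem unitApp_tensorHom {F F' G G' : C ⊛⥤ V} (f : F ⟶ F') (g : G ⟶ G') (x y : C) :
    unitApp F G x y ≫ (f ⊗ₘ g).natTrans.app (x ⊗ y) =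
      (f.natTrans.app x ⊗ₘ g.natTrans.app y) ≫ unitApp F' G' x y :=
  convolutionExtensionUnit_comp_ι_map_tensorHom_app C V f g x y

theorem unitApp_whiskerLeft (F : C ⊛⥤ V) {G G' : C ⊛⥤ V} (g : G ⟶ G') (x y : C) :
    unitApp F G x y ≫ (F ◁ g).natTrans.app (x ⊗ y) =
      F.functor.obj x ◁ g.natTrans.app y ≫ unitApp F G' x y :=
  convolutionExtensionUnit_comp_ι_map_whiskerLeft_app V F g x y

theorem unitApp_whiskerRight {F F' : C ⊛⥤ V} (f : F ⟶ F') (G : C ⊛⥤ V) (x y : C) :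
    unitApp F G x y ≫ (f ▷ G).natTrans.app (x ⊗ y) =
      f.natTrans.app x ▷ G.functor.obj y ≫ unitApp F' G x y :=
  convolutionExtensionUnit_comp_ι_map_whiskerRight_app C V f G x y

theorem unitApp_associator (F G H : C ⊛⥤ V) (x y z : C) :
    unitApp F G x y ▷ H.functor.obj z ≫ unitApp (F ⊗ G) H (x ⊗ y) z ≫
        (α_ F G H).hom.natTrans.app ((x ⊗ y) ⊗ z) =
      (α_ _ _ _).hom ≫ F.functor.obj x ◁ unitApp G H y z ≫ unitApp F (G ⊗ H) x (y ⊗ z) ≫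
        (F ⊗ G ⊗ H).functor.map (α_ x y z).inv :=
  associator_hom_unit_unit V F G H x y z

theorem unitApp_leftUnitor (F : C ⊛⥤ V) (x : C) :
    DayFunctor.ν C V ▷ F.functor.obj x ≫ unitApp (𝟙_ (C ⊛⥤ V)) F (𝟙_ C) x ≫
        (λ_ F).hom.natTrans.app (𝟙_ C ⊗ x) =
      (λ_ (F.functor.obj x)).hom ≫ F.functor.map (λ_ x).inv :=
  leftUnitor_hom_unit_app V F x

theorem unitApp_rightUnitor (F : C ⊛⥤ V) (x : C) :
    F.functor.obj x ◁ DayFunctor.ν C V ≫ unitApp F (𝟙_ (C ⊛⥤ V)) x (𝟙_ C) ≫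
        (ρ_ F).hom.natTrans.app (x ⊗ 𝟙_ C) =
      (ρ_ (F.functor.obj x)).hom ≫ F.functor.map (ρ_ x).inv :=
  rightUnitor_hom_unit_app V F x

theorem tensor_hom_ext {F G H : C ⊛⥤ V} {α β : F ⊗ G ⟶ H}
    (h : ∀ x y : C, unitApp F G x y ≫ α.natTrans.app (x ⊗ y) =
      unitApp F G x y ≫ β.natTrans.app (x ⊗ y)) : α = β :=
  DayFunctor.tensor_hom_ext h

/-- Tensoring with `W` preserves the colimit that computes the Day convolution at `c`, so equality
can be tested on the colimit injections, one for each `t : x ⊗ y ⟶ c`. -/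
theorem tensorObj_tensor_hom_ext (F G : C ⊛⥤ V) {c : C} {W Z : V}
    {f g : (F ⊗ G).functor.obj c ⊗ W ⟶ Z}
    (h : ∀ (x y : C) (t : x ⊗ y ⟶ c),
      (unitApp F G x y ≫ (F ⊗ G).functor.map t) ▷ W ≫ f =
        (unitApp F G x y ≫ (F ⊗ G).functor.map t) ▷ W ≫ g) : f = g :=
  (isColimitOfPreserves (tensorRight W)
    (isPointwiseLeftKanExtensionConvolutionExtensionUnit (C := C) (V := V) F G c)).hom_ext
      fun j => h j.left.1 j.left.2 j.hom

theorem unitObj_tensor_hom_ext {c : C} {W Z : V}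
    {f g : (𝟙_ (C ⊛⥤ V)).functor.obj c ⊗ W ⟶ Z}
    (h : ∀ t : 𝟙_ C ⟶ c,
      (DayFunctor.ν C V ≫ (𝟙_ (C ⊛⥤ V)).functor.map t) ▷ W ≫ f =
        (DayFunctor.ν C V ≫ (𝟙_ (C ⊛⥤ V)).functor.map t) ▷ W ≫ g) : f = g :=
  (isColimitOfPreserves (tensorRight W)
    (isPointwiseLeftKanExtensionUnitUnit C V (C ⊛⥤ V) c)).hom_ext fun j => h j.hom

theorem tensor_unitObj_hom_ext {c : C} {W Z : V}
    {f g : W ⊗ (𝟙_ (C ⊛⥤ V)).functor.obj c ⟶ Z}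
    (h : ∀ t : 𝟙_ C ⟶ c,
      W ◁ (DayFunctor.ν C V ≫ (𝟙_ (C ⊛⥤ V)).functor.map t) ≫ f =
        W ◁ (DayFunctor.ν C V ≫ (𝟙_ (C ⊛⥤ V)).functor.map t) ≫ g) : f = g :=
  (isColimitOfPreserves (tensorLeft W)
    (isPointwiseLeftKanExtensionUnitUnit C V (C ⊛⥤ V) c)).hom_ext fun j => h j.hom

theorem tensor_tensor_hom_ext {F G H K : C ⊛⥤ V} {α β : (F ⊗ G) ⊗ H ⟶ K}
    (h : ∀ x y z : C,
      unitApp F G x y ▷ H.functor.obj z ≫ unitApp (F ⊗ G) H (x ⊗ y) z ≫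
          α.natTrans.app ((x ⊗ y) ⊗ z) =
        unitApp F G x y ▷ H.functor.obj z ≫ unitApp (F ⊗ G) H (x ⊗ y) z ≫
          β.natTrans.app ((x ⊗ y) ⊗ z)) : α = β := by
  refine tensor_hom_ext fun c z => tensorObj_tensor_hom_ext F G fun x y t => ?_
  -- Naturality moves `t` to the end of the composite, which reduces the test to the universal maps
  -- themselves.
  have key : ∀ γ : (F ⊗ G) ⊗ H ⟶ K,
      (unitApp F G x y ≫ (F ⊗ G).functor.map t) ▷ H.functor.obj z ≫ unitApp (F ⊗ G) H c z ≫
          γ.natTrans.app (c ⊗ z) =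
        (unitApp F G x y ▷ H.functor.obj z ≫ unitApp (F ⊗ G) H (x ⊗ y) z ≫
          γ.natTrans.app ((x ⊗ y) ⊗ z)) ≫ K.functor.map (t ▷ z) := fun γ => by
    have h₁ := unitApp_naturality (F ⊗ G) H t (𝟙 z)
    rw [CategoryTheory.Functor.map_id, tensorHom_id, tensorHom_id] at h₁
    rw [comp_whiskerRight, Category.assoc, reassoc_of% h₁, NatTrans.naturality]
    simp only [Category.assoc]
  rw [key, key, h]

theorem unit_tensor_hom_ext {F K : C ⊛⥤ V} {α β : 𝟙_ (C ⊛⥤ V) ⊗ F ⟶ K}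
    (h : ∀ x : C,
      DayFunctor.ν C V ▷ F.functor.obj x ≫ unitApp (𝟙_ (C ⊛⥤ V)) F (𝟙_ C) x ≫
          α.natTrans.app (𝟙_ C ⊗ x) =
        DayFunctor.ν C V ▷ F.functor.obj x ≫ unitApp (𝟙_ (C ⊛⥤ V)) F (𝟙_ C) x ≫
          β.natTrans.app (𝟙_ C ⊗ x)) : α = β := by
  refine tensor_hom_ext fun c z => unitObj_tensor_hom_ext fun t => ?_
  have key : ∀ γ : 𝟙_ (C ⊛⥤ V) ⊗ F ⟶ K,
      (DayFunctor.ν C V ≫ (𝟙_ (C ⊛⥤ V)).functor.map t) ▷ F.functor.obj z ≫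
          unitApp (𝟙_ (C ⊛⥤ V)) F c z ≫ γ.natTrans.app (c ⊗ z) =
        (DayFunctor.ν C V ▷ F.functor.obj z ≫ unitApp (𝟙_ (C ⊛⥤ V)) F (𝟙_ C) z ≫
          γ.natTrans.app (𝟙_ C ⊗ z)) ≫ K.functor.map (t ▷ z) := fun γ => by
    have h₁ := unitApp_naturality (𝟙_ (C ⊛⥤ V)) F t (𝟙 z)
    rw [CategoryTheory.Functor.map_id, tensorHom_id, tensorHom_id] at h₁
    rw [comp_whiskerRight, Category.assoc, reassoc_of% h₁, NatTrans.naturality]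
    simp only [Category.assoc]
  rw [key, key, h]

theorem tensor_unit_hom_ext {F K : C ⊛⥤ V} {α β : F ⊗ 𝟙_ (C ⊛⥤ V) ⟶ K}
    (h : ∀ x : C,
      F.functor.obj x ◁ DayFunctor.ν C V ≫ unitApp F (𝟙_ (C ⊛⥤ V)) x (𝟙_ C) ≫
          α.natTrans.app (x ⊗ 𝟙_ C) =
        F.functor.obj x ◁ DayFunctor.ν C V ≫ unitApp F (𝟙_ (C ⊛⥤ V)) x (𝟙_ C) ≫
          β.natTrans.app (x ⊗ 𝟙_ C)) : α = β := by
  refine tensor_hom_ext fun z c => tensor_unitObj_hom_ext fun t => ?_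
  have key : ∀ γ : F ⊗ 𝟙_ (C ⊛⥤ V) ⟶ K,
      F.functor.obj z ◁ (DayFunctor.ν C V ≫ (𝟙_ (C ⊛⥤ V)).functor.map t) ≫
          unitApp F (𝟙_ (C ⊛⥤ V)) z c ≫ γ.natTrans.app (z ⊗ c) =
        (F.functor.obj z ◁ DayFunctor.ν C V ≫ unitApp F (𝟙_ (C ⊛⥤ V)) z (𝟙_ C) ≫
          γ.natTrans.app (z ⊗ 𝟙_ C)) ≫ K.functor.map (z ◁ t) := fun γ => by
    have h₁ := unitApp_naturality F (𝟙_ (C ⊛⥤ V)) (𝟙 z) t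
    rw [CategoryTheory.Functor.map_id, id_tensorHom, id_tensorHom] at h₁
    rw [MonoidalCategory.whiskerLeft_comp, Category.assoc, reassoc_of% h₁, NatTrans.naturality]
    simp only [Category.assoc]
  rw [key, key, h]

/-- The multiplication of a monoid for Day convolution, as a family of morphisms. -/
noncomputable def mulApp (M : Mon (C ⊛⥤ V)) (x y : C) :
    M.X.functor.obj x ⊗ M.X.functor.obj y ⟶ M.X.functor.obj (x ⊗ y) :=
  unitApp M.X M.X x y ≫ (MonObj.mul (X := M.X)).natTrans.app (x ⊗ y)

/-- The unit of a monoid for Day convolution, as a morphism of the target category. -/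
noncomputable def oneApp (M : Mon (C ⊛⥤ V)) : 𝟙_ V ⟶ M.X.functor.obj (𝟙_ C) :=
  DayFunctor.ν C V ≫ (MonObj.one (X := M.X)).natTrans.app (𝟙_ C)

theorem mulApp_naturality (M : Mon (C ⊛⥤ V)) {x x' y y' : C} (f : x ⟶ x') (g : y ⟶ y') :
    (M.X.functor.map f ⊗ₘ M.X.functor.map g) ≫ mulApp M x' y' =
      mulApp M x y ≫ M.X.functor.map (f ⊗ₘ g) := by
  rw [mulApp, reassoc_of% unitApp_naturality M.X M.X f g, NatTrans.naturality, mulApp,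
    Category.assoc]

/-- The associativity axiom of the monoid is evaluated at `(x ⊗ y) ⊗ z` and precomposed with the
universal maps, whose compatibility with whiskering and the associator turns it into the lax axiom.
-/
theorem mulApp_assoc (M : Mon (C ⊛⥤ V)) (x y z : C) :
    mulApp M x y ▷ M.X.functor.obj z ≫ mulApp M (x ⊗ y) z ≫ M.X.functor.map (α_ x y z).hom =
      (α_ _ _ _).hom ≫ M.X.functor.obj x ◁ mulApp M y z ≫ mulApp M x (y ⊗ z) := by
  have h₁ : ((MonObj.mul (X := M.X)) ▷ M.X ≫ MonObj.mul).natTrans.app ((x ⊗ y) ⊗ z) =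
      ((α_ M.X M.X M.X).hom ≫ M.X ◁ MonObj.mul ≫ MonObj.mul).natTrans.app ((x ⊗ y) ⊗ z) := by
    rw [MonObj.mul_assoc]
  rw [comp_app, comp_app, comp_app] at h₁
  have h₂ := congrArg (fun t => unitApp M.X M.X x y ▷ M.X.functor.obj z ≫
    unitApp (M.X ⊗ M.X) M.X (x ⊗ y) z ≫ t) h₁
  rw [reassoc_of% unitApp_whiskerRight (MonObj.mul (X := M.X)) M.X (x ⊗ y) z,
    reassoc_of% unitApp_associator M.X M.X M.X x y z,
    NatTrans.naturality_assoc, NatTrans.naturality,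
    reassoc_of% unitApp_whiskerLeft M.X (MonObj.mul (X := M.X)) x (y ⊗ z)] at h₂
  simp only [mulApp, comp_whiskerRight, MonoidalCategory.whiskerLeft_comp, Category.assoc]
  rw [reassoc_of% h₂, ← Functor.map_comp, Iso.inv_hom_id, CategoryTheory.Functor.map_id, Category.comp_id]

theorem one_mulApp (M : Mon (C ⊛⥤ V)) (x : C) :
    oneApp M ▷ M.X.functor.obj x ≫ mulApp M (𝟙_ C) x ≫ M.X.functor.map (λ_ x).hom =
      (λ_ (M.X.functor.obj x)).hom := by
  have h₁ : ((MonObj.one (X := M.X)) ▷ M.X ≫ MonObj.mul).natTrans.app (𝟙_ C ⊗ x) =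
      (λ_ M.X).hom.natTrans.app (𝟙_ C ⊗ x) := by
    rw [MonObj.one_mul]
  rw [comp_app] at h₁
  have h₂ := congrArg (fun t => DayFunctor.ν C V ▷ M.X.functor.obj x ≫
    unitApp (𝟙_ (C ⊛⥤ V)) M.X (𝟙_ C) x ≫ t) h₁
  rw [reassoc_of% unitApp_whiskerRight (MonObj.one (X := M.X)) M.X (𝟙_ C) x,
    unitApp_leftUnitor] at h₂
  simp only [mulApp, oneApp, comp_whiskerRight, Category.assoc]
  rw [reassoc_of% h₂, ← Functor.map_comp, Iso.inv_hom_id, CategoryTheory.Functor.map_id, Category.comp_id]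

theorem mulApp_one (M : Mon (C ⊛⥤ V)) (x : C) :
    M.X.functor.obj x ◁ oneApp M ≫ mulApp M x (𝟙_ C) ≫ M.X.functor.map (ρ_ x).hom =
      (ρ_ (M.X.functor.obj x)).hom := by
  have h₁ : (M.X ◁ (MonObj.one (X := M.X)) ≫ MonObj.mul).natTrans.app (x ⊗ 𝟙_ C) =
      (ρ_ M.X).hom.natTrans.app (x ⊗ 𝟙_ C) := by
    rw [MonObj.mul_one]
  rw [comp_app] at h₁
  have h₂ := congrArg (fun t => M.X.functor.obj x ◁ DayFunctor.ν C V ≫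
    unitApp M.X (𝟙_ (C ⊛⥤ V)) x (𝟙_ C) ≫ t) h₁
  rw [reassoc_of% unitApp_whiskerLeft M.X (MonObj.one (X := M.X)) x (𝟙_ C),
    unitApp_rightUnitor] at h₂
  simp only [mulApp, oneApp, MonoidalCategory.whiskerLeft_comp, Category.assoc]
  rw [reassoc_of% h₂, ← Functor.map_comp, Iso.inv_hom_id, CategoryTheory.Functor.map_id, Category.comp_id]

/-- The lax monoidal functor underlying a monoid for Day convolution. -/
@[reducible]
noncomputable def laxMonoidal (M : Mon (C ⊛⥤ V)) : M.X.functor.LaxMonoidal :=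
  Functor.LaxMonoidal.ofTensorHom
    (ε := oneApp M)
    (μ := mulApp M)
    (μ_natural := fun f g => mulApp_naturality M f g)
    (associativity := fun x y z => by
      rw [tensorHom_id, id_tensorHom]
      exact mulApp_assoc M x y z)
    (left_unitality := fun x => by
      rw [tensorHom_id]
      exact (one_mulApp M x).symm)
    (right_unitality := fun x => by
      rw [id_tensorHom]
      exact (mulApp_one M x).symm)

/-- The multiplication on Day convolution given by a lax monoidal functor. -/
noncomputable def mulOfLax (F : C ⥤ V) [F.LaxMonoidal] :
    DayFunctor.mk F ⊗ DayFunctor.mk F ⟶ DayFunctor.mk F :=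
  DayFunctor.tensorDesc
    { app := fun p => Functor.LaxMonoidal.μ F p.1 p.2
      naturality := fun _ _ f => (congrArg (· ≫ _)
        (MonoidalCategory.tensorHom_def (F.map f.1) (F.map f.2)).symm).trans
          (Functor.LaxMonoidal.μ_natural F f.1 f.2) }

theorem unitApp_mulOfLax (F : C ⥤ V) [F.LaxMonoidal] (x y : C) :
    unitApp (DayFunctor.mk F) (DayFunctor.mk F) x y ≫ (mulOfLax F).natTrans.app (x ⊗ y) =
      Functor.LaxMonoidal.μ F x y :=
  DayFunctor.η_comp_tensorDesc_app _ x y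

/-- The unit on Day convolution given by a lax monoidal functor. -/
noncomputable def oneOfLax (F : C ⥤ V) [F.LaxMonoidal] : 𝟙_ (C ⊛⥤ V) ⟶ DayFunctor.mk F :=
  DayFunctor.unitDesc (Functor.LaxMonoidal.ε F)

theorem ν_oneOfLax (F : C ⥤ V) [F.LaxMonoidal] :
    DayFunctor.ν C V ≫ (oneOfLax F).natTrans.app (𝟙_ C) = Functor.LaxMonoidal.ε F :=
  DayFunctor.ν_comp_unitDesc _

theorem unitApp_mulOfLax' (F : C ⥤ V) [F.LaxMonoidal] (x y : C) {Z : V}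
    (h : F.obj (x ⊗ y) ⟶ Z) :
    unitApp (DayFunctor.mk F) (DayFunctor.mk F) x y ≫ (mulOfLax F).natTrans.app (x ⊗ y) ≫ h =
      Functor.LaxMonoidal.μ F x y ≫ h :=
  (Category.assoc _ _ _).symm.trans (congrArg (· ≫ h) (unitApp_mulOfLax F x y))

/-- The monoid for Day convolution given by a lax monoidal functor. -/
noncomputable instance monObjOfLax (F : C ⥤ V) [F.LaxMonoidal] : MonObj (DayFunctor.mk F) where
  one := oneOfLax F
  mul := mulOfLax F
  one_mul := unit_tensor_hom_ext fun x => by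
    rw [comp_app, reassoc_of% unitApp_whiskerRight (oneOfLax F) (DayFunctor.mk F) (𝟙_ C) x,
      unitApp_leftUnitor, unitApp_mulOfLax, ← comp_whiskerRight_assoc, ν_oneOfLax]
    have := Functor.LaxMonoidal.left_unitality F x
    dsimp only [DayFunctor.mk_functor]
    rw [this, Category.assoc, Category.assoc, ← Functor.map_comp, Iso.hom_inv_id,
      CategoryTheory.Functor.map_id, Category.comp_id]
  mul_one := tensor_unit_hom_ext fun x => by
    rw [comp_app, reassoc_of% unitApp_whiskerLeft (DayFunctor.mk F) (oneOfLax F) x (𝟙_ C),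
      unitApp_rightUnitor, unitApp_mulOfLax, ← whiskerLeft_comp_assoc, ν_oneOfLax]
    have := Functor.LaxMonoidal.right_unitality F x
    dsimp only [DayFunctor.mk_functor]
    rw [this, Category.assoc, Category.assoc, ← Functor.map_comp, Iso.hom_inv_id,
      CategoryTheory.Functor.map_id, Category.comp_id]
  mul_assoc := tensor_tensor_hom_ext fun x y z => by
    rw [comp_app, comp_app, comp_app,
      reassoc_of% unitApp_whiskerRight (mulOfLax F) (DayFunctor.mk F) (x ⊗ y) z,
      reassoc_of% unitApp_associator (DayFunctor.mk F) (DayFunctor.mk F) (DayFunctor.mk F) x y z,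
      NatTrans.naturality_assoc, NatTrans.naturality,
      reassoc_of% unitApp_whiskerLeft (DayFunctor.mk F) (mulOfLax F) x (y ⊗ z),
      unitApp_mulOfLax, ← comp_whiskerRight_assoc, unitApp_mulOfLax,
      ← whiskerLeft_comp_assoc, unitApp_mulOfLax, unitApp_mulOfLax']
    have := Functor.LaxMonoidal.associativity F x y z
    dsimp only [DayFunctor.mk_functor]
    rw [← reassoc_of% this, ← Functor.map_comp, Iso.hom_inv_id, CategoryTheory.Functor.map_id, Category.comp_id]

/-- The monoid for Day convolution given by a lax monoidal functor. -/
@[reducible]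
noncomputable def ofLax (F : C ⥤ V) [F.LaxMonoidal] : Mon (C ⊛⥤ V) := ⟨DayFunctor.mk F⟩

theorem mulApp_ofLax (F : C ⥤ V) [F.LaxMonoidal] (x y : C) :
    mulApp (ofLax F) x y = Functor.LaxMonoidal.μ F x y :=
  unitApp_mulOfLax F x y

theorem oneApp_ofLax (F : C ⥤ V) [F.LaxMonoidal] :
    oneApp (ofLax F) = Functor.LaxMonoidal.ε F :=
  ν_oneOfLax F

theorem mulApp_hom {M N : Mon (C ⊛⥤ V)} (f : M ⟶ N) (x y : C) :
    mulApp M x y ≫ f.hom.natTrans.app (x ⊗ y) =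
      (f.hom.natTrans.app x ⊗ₘ f.hom.natTrans.app y) ≫ mulApp N x y := by
  have h : (MonObj.mul (X := M.X) ≫ f.hom).natTrans.app (x ⊗ y) =
      ((f.hom ⊗ₘ f.hom) ≫ MonObj.mul).natTrans.app (x ⊗ y) := by
    rw [IsMonHom.mul_hom]
  rw [comp_app, comp_app] at h
  rw [mulApp, Category.assoc, h, reassoc_of% unitApp_tensorHom f.hom f.hom x y]
  rfl

theorem oneApp_hom {M N : Mon (C ⊛⥤ V)} (f : M ⟶ N) :
    oneApp M ≫ f.hom.natTrans.app (𝟙_ C) = oneApp N := by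
  have h : (MonObj.one (X := M.X) ≫ f.hom).natTrans.app (𝟙_ C) =
      (MonObj.one (X := N.X)).natTrans.app (𝟙_ C) := by
    rw [IsMonHom.one_hom]
  rw [comp_app] at h
  rw [oneApp, Category.assoc, h]
  rfl

/-- A morphism of monoids for Day convolution, given by a monoidal natural transformation. -/
noncomputable def homMk {M N : Mon (C ⊛⥤ V)} (f : M.X.functor ⟶ N.X.functor)
    (hmul : ∀ x y, mulApp M x y ≫ f.app (x ⊗ y) = (f.app x ⊗ₘ f.app y) ≫ mulApp N x y)
    (hone : oneApp M ≫ f.app (𝟙_ C) = oneApp N) : M ⟶ N :=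
  Mon.Hom.mk' (DayFunctor.Hom.mk f)
    (one_f := DayFunctor.unit_hom_ext ((Category.assoc _ _ _).symm.trans hone))
    (mul_f := tensor_hom_ext fun x y => by
      rw [comp_app, comp_app]
      refine (Category.assoc _ _ _).symm.trans ((hmul x y).trans ?_)
      exact (Category.assoc _ _ _).symm.trans ((congrArg (· ≫ _)
        (unitApp_tensorHom (DayFunctor.Hom.mk f) (DayFunctor.Hom.mk f) x y).symm).trans
          (Category.assoc _ _ _)))

theorem hom_ext {M N : Mon (C ⊛⥤ V)} {f g : M ⟶ N}
    (h : ∀ x, f.hom.natTrans.app x = g.hom.natTrans.app x) : f = g :=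
  Mon.Hom.ext (DayFunctor.hom_ext (NatTrans.ext (funext h)))

/-- An isomorphism of monoids for Day convolution, given by a monoidal natural isomorphism. -/
noncomputable def isoMk {M N : Mon (C ⊛⥤ V)} (e : M.X.functor ≅ N.X.functor)
    (hmul : ∀ x y, mulApp M x y ≫ e.hom.app (x ⊗ y) = (e.hom.app x ⊗ₘ e.hom.app y) ≫ mulApp N x y)
    (hone : oneApp M ≫ e.hom.app (𝟙_ C) = oneApp N) : M ≅ N where
  hom := homMk e.hom hmul hone
  inv := homMk e.inv
    (fun x y => by
      rw [← cancel_mono (e.hom.app (x ⊗ y)), Category.assoc, Category.assoc, e.inv_hom_id_app,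
        hmul, tensorHom_comp_tensorHom_assoc, e.inv_hom_id_app, e.inv_hom_id_app,
        id_tensorHom_id, Category.id_comp, Category.comp_id])
    (by rw [← hone, Category.assoc, e.hom_inv_id_app, Category.comp_id])
  hom_inv_id := hom_ext fun x => e.hom_inv_id_app x
  inv_hom_id := hom_ext fun x => e.inv_hom_id_app x

/-- A monoidal natural transformation of lax monoidal functors as a morphism of monoids. -/
noncomputable def homOfLax {F G : C ⥤ V} [F.LaxMonoidal]
    [G.LaxMonoidal] (f : F ⟶ G) [NatTrans.IsMonoidal f] :
    ofLax F ⟶ ofLax G :=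
  homMk f
    (fun x y => by
      rw [mulApp_ofLax, mulApp_ofLax]
      exact NatTrans.IsMonoidal.tensor (τ := f) x y)
    (by
      rw [oneApp_ofLax, oneApp_ofLax]
      exact NatTrans.IsMonoidal.unit (τ := f))

theorem isMonoidal_natTrans {F G : C ⥤ V}
    [F.LaxMonoidal] [G.LaxMonoidal] (f : ofLax F ⟶ ofLax G) :
    NatTrans.IsMonoidal (F₁ := F) (F₂ := G) f.hom.natTrans where
  unit := by
    have := oneApp_hom f
    rwa [oneApp_ofLax, oneApp_ofLax] at this
  tensor x y := by
    have := mulApp_hom f x y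
    rwa [mulApp_ofLax, mulApp_ofLax] at this

end DayMonoid

/-! ### Closure properties of primitive morphisms -/

namespace FiniteInterval

/-- The target is cut at the image of the gluing point, and the two factors are the restrictions of
`f`. That image may be an endpoint, so one of the new pieces may have length `0`. -/
theorem exists_eq_tensorHom_comp {k l n : FiniteInterval} (f : k ⊗ l ⟶ n) :
    ∃ (k' l' : FiniteInterval) (h : (k' ⊗ l').len = n.len) (f₁ : k ⟶ k') (f₂ : l ⟶ l'),
      k'.len = Hom.val f k.len ∧ f = (f₁ ⊗ₘ f₂) ≫ (isoOfEq h).hom := by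
  have hk := val_le f k.len
  have hlen : Hom.val f (k.len + l.len) = n.len := val_len f
  let f₁ : k ⟶ ⟨Hom.val f k.len⟩ :=
    mkHom (fun i => Hom.val f i) (fun i j hij _ => val_mono f hij) (val_zero f) rfl
  let f₂ : l ⟶ ⟨n.len - Hom.val f k.len⟩ :=
    mkHom (fun i => Hom.val f (k.len + i) - Hom.val f k.len)
      (fun i j hij _ => Nat.sub_le_sub_right (val_mono f (Nat.add_le_add_left hij _)) _)
      (Nat.sub_self _) (congrArg (· - Hom.val f k.len) hlen)
  have h : ((⟨Hom.val f k.len⟩ : FiniteInterval) ⊗ ⟨n.len - Hom.val f k.len⟩).len = n.len :=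
    Nat.add_sub_of_le hk
  refine ⟨⟨Hom.val f k.len⟩, ⟨n.len - Hom.val f k.len⟩, h, f₁, f₂, rfl,
    hom_ext_val fun i hi => ?_⟩
  have hi' : i ≤ k.len + l.len := hi
  rw [val_comp, val_isoOfEq_hom, min_eq_left (val_le _ _), val_tensorHom]
  split_ifs with hik
  · exact (val_mkHom _ _ _ _ hik).symm
  · refine Eq.trans ?_ (congrArg (Hom.val f k.len + ·) (val_mkHom _ _ _ _
      (show i - k.len ≤ l.len by omega)).symm)
    have h₁ : k.len + (i - k.len) = i := by omega
    have h₂ : Hom.val f k.len ≤ Hom.val f i := val_mono f (by omega)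
    rw [h₁]
    omega

end FiniteInterval

open FiniteInterval Functor.LaxMonoidal Functor.OplaxMonoidal

namespace FrobeniusFunctor

variable {V : Type u} [Category.{v} V] [MonoidalCategory V]
  {X Y : FrobeniusFunctor FiniteIntervalᵒᵖ V}

theorem map_isoOfEq_comul {m k l : FiniteInterval} {n k' l' : FiniteInterval} (f : m ⟶ n)
    (h : (k ⊗ l).len = m.len) (h' : (k' ⊗ l').len = n.len) (f₁ : k ⟶ k') (f₂ : l ⟶ l')
    (hf : (isoOfEq h).hom ≫ f = (f₁ ⊗ₘ f₂) ≫ (isoOfEq h').hom) :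
    X.functor.map f.op ≫ X.functor.map (isoOfEq h).hom.op ≫ δ X.functor (op k) (op l) =
      X.functor.map (isoOfEq h').hom.op ≫ δ X.functor (op k') (op l') ≫
        (X.functor.map f₁.op ⊗ₘ X.functor.map f₂.op) := by
  rw [δ_natural, ← X.functor.map_comp_assoc, ← X.functor.map_comp_assoc]
  exact congrArg (fun t => X.functor.map t ≫ δ X.functor (op k) (op l)) (congrArg Quiver.Hom.op hf)

variable [Preadditive V]

theorem IsPrimitive.comp {n : FiniteInterval} {W W' : V} {g : W ⟶ X.functor.obj (op n)}
    (hg : X.IsPrimitive g) (f : W' ⟶ W) : X.IsPrimitive (f ≫ g) := fun k l hk hl h => by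
  rw [Category.assoc, hg k l hk hl h, comp_zero]

theorem isPrimitive_of_len_le_one {n : FiniteInterval} (hn : n.len ≤ 1) {W : V}
    (g : W ⟶ X.functor.obj (op n)) : X.IsPrimitive g := fun k l hk hl h => by
  rw [tensorObj_len] at h
  omega

/-- A comultiplication at `k` after restriction along `f` factors through the one at the image of
`k`; by hypothesis this image is interior, so primitivity applies. -/
theorem IsPrimitive.map {m n : FiniteInterval} (f : m ⟶ n)
    (hf : ∀ i, 0 < i → i < m.len → 0 < Hom.val f i ∧ Hom.val f i < n.len) {W : V}
    {g : W ⟶ X.functor.obj (op n)} (hg : X.IsPrimitive g) :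
    X.IsPrimitive (g ≫ X.functor.map f.op) := fun k l hk hl h => by
  obtain ⟨k', l', h', f₁, f₂, hk', e⟩ := exists_eq_tensorHom_comp ((isoOfEq h).hom ≫ f)
  have hkl : k.len + l.len = m.len := h
  have hkl' : k'.len + l'.len = n.len := h'
  rw [val_comp, val_isoOfEq_hom,
    min_eq_left (show k.len ≤ (k ⊗ l).len from Nat.le_add_right _ _)] at hk'
  have := hf k.len hk (by omega)
  rw [Category.assoc, map_isoOfEq_comul f h h' f₁ f₂ e,
    reassoc_of% (hg k' l' (by omega) (by omega) h'), zero_comp]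

/-- A cut other than the gluing point lies inside one of the two factors, and the Frobenius law
moves the comultiplication to that factor. -/
theorem lax_comul_eq_zero [MonoidalPreadditive V] {p q k l : FiniteInterval} {W W' : V}
    {g : W ⟶ X.functor.obj (op p)} {g' : W' ⟶ X.functor.obj (op q)} (hg : X.IsPrimitive g)
    (hg' : X.IsPrimitive g') (hk : 0 < k.len) (hl : 0 < l.len)
    (h : (k ⊗ l).len = (p ⊗ q).len) (hkp : k.len ≠ p.len) :
    ((g ⊗ₘ g') ≫ μ X.functor (op p) (op q)) ≫ X.functor.map (isoOfEq h).hom.op ≫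
      δ X.functor (op k) (op l) = 0 := by
  have hlen : k.len + l.len = p.len + q.len := h
  rcases Nat.lt_or_gt_of_ne hkp with hlt | hlt
  · let b : FiniteInterval := ⟨p.len - k.len⟩
    have h₁ : (k ⊗ b).len = p.len := Nat.add_sub_of_le hlt.le
    have h₂ : l.len = (b ⊗ q).len := by
      change _ = p.len - k.len + q.len
      omega
    have e : (isoOfEq h).hom.op = (isoOfEq h₁).hom.op ▷ op q ≫
        (α_ (op k) (op b) (op q)).hom ≫ op k ◁ (isoOfEq h₂).hom.op :=
      op_hom_eq_of_isIso inferInstance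
        (inferInstanceAs (IsIso (((isoOfEq h₁).hom.op ▷ op q) ≫
          (α_ (op k) (op b) (op q)).hom ≫ op k ◁ (isoOfEq h₂).hom.op)))
    exact (congrArg (fun t => ((g ⊗ₘ g') ≫ μ X.functor (op p) (op q)) ≫ X.functor.map t ≫
      δ X.functor (op k) (op l)) e).trans (X.lax_comp_colax_eq_zero_left (isoOfEq h₁).hom.op
        (isoOfEq h₂).hom.op g g' (hg k b hk (Nat.sub_pos_of_lt hlt) h₁))
  · let b : FiniteInterval := ⟨k.len - p.len⟩
    have h₁ : (b ⊗ l).len = q.len := by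
      change k.len - p.len + l.len = _
      omega
    have h₂ : k.len = (p ⊗ b).len := (Nat.add_sub_of_le hlt.le).symm
    have e : (isoOfEq h).hom.op = op p ◁ (isoOfEq h₁).hom.op ≫
        (α_ (op p) (op b) (op l)).inv ≫ (isoOfEq h₂).hom.op ▷ op l :=
      op_hom_eq_of_isIso inferInstance
        (inferInstanceAs (IsIso (op p ◁ (isoOfEq h₁).hom.op ≫
          (α_ (op p) (op b) (op l)).inv ≫ (isoOfEq h₂).hom.op ▷ op l)))
    exact (congrArg (fun t => ((g ⊗ₘ g') ≫ μ X.functor (op p) (op q)) ≫ X.functor.map t ≫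
      δ X.functor (op k) (op l)) e).trans (X.lax_comp_colax_eq_zero_right (isoOfEq h₁).hom.op
        (isoOfEq h₂).hom.op g g' (hg' b l (Nat.sub_pos_of_lt hlt) hl h₁))

/-- The only comultiplication that need not annihilate the product is the one at the gluing point.
The coface omits this point, so that comultiplication never arises. -/
theorem IsPrimitive.mul [MonoidalPreadditive V] {x y : AugmentedSimplexCategory} {W W' : V}
    {g : W ⟶ X.functor.obj (op (narrow.obj x))} {g' : W' ⟶ X.functor.obj (op (narrow.obj y))}
    (hg : X.IsPrimitive g) (hg' : X.IsPrimitive g') :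
    X.IsPrimitive (n := narrow.obj (x ⊗ y))
      (((g ⊗ₘ g') ≫ μ X.functor (op (narrow.obj x)) (op (narrow.obj y))) ≫
        X.functor.map (narrowComul x y).op) := fun k l hk hl h => by
  obtain ⟨k', l', h', f₁, f₂, hk', e⟩ :=
    exists_eq_tensorHom_comp ((isoOfEq h).hom ≫ narrowComul x y)
  have hkl : k.len + l.len = (narrow.obj (x ⊗ y)).len := h
  have hkl' : k'.len + l'.len = (narrow.obj x).len + (narrow.obj y).len := h'
  have hxy := narrow_tensor_len' x y
  rw [val_comp, val_isoOfEq_hom,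
    min_eq_left (show k.len ≤ (k ⊗ l).len from Nat.le_add_right _ _),
    val_narrowComul x y (by omega)] at hk'
  refine (Category.assoc _ _ _).trans ((congrArg (_ ≫ ·)
    (map_isoOfEq_comul (narrowComul x y) h h' f₁ f₂ e)).trans ?_)
  have key : ∀ {A B E D : V} {a : A ⟶ B} {b : B ⟶ E} {c : E ⟶ D} {D' : V} {d : D ⟶ D'},
      a ≫ b ≫ c = 0 → a ≫ b ≫ c ≫ d = 0 := by
    intro A B E D a b c D' d hz
    rw [reassoc_of% hz, zero_comp]
  refine key (lax_comul_eq_zero hg hg' ?_ ?_ h' ?_)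
  all_goals
    split_ifs at hk' <;> omega

theorem IsPrimitive.hom {n : FiniteInterval} {W : V} {g : W ⟶ X.functor.obj (op n)}
    (hg : X.IsPrimitive g) (α : X ⟶ Y) :
    Y.IsPrimitive (g ≫ α.natTrans.app (op n)) := fun k l hk hl h => by
  rw [Category.assoc, ← α.natTrans.naturality_assoc]
  have := α.colax_tensor (op k) (op l)
  have key : ∀ {A B E D F : V} {a : A ⟶ B} {b : B ⟶ E} {c : E ⟶ D} {d : D ⟶ F} {s : E ⟶ F},
      s = c ≫ d → a ≫ b ≫ c = 0 → a ≫ b ≫ s = 0 := by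
    rintro A B E D F a b c d s rfl hz
    rw [reassoc_of% hz, zero_comp]
  exact key this (hg k l hk hl h)

end FrobeniusFunctor

/-! ### The kernel functor -/

open FiniteInterval Functor.LaxMonoidal Functor.OplaxMonoidal

/-- A functor with a monomorphism to a lax monoidal functor is lax monoidal if the monomorphism
is closed under unit and multiplication. -/
@[reducible]
def laxMonoidalOfMono {C : Type u₁} [Category.{v₁} C] [MonoidalCategory C] {V : Type u}
    [Category.{v} V] [MonoidalCategory V] {F G : C ⥤ V} [G.LaxMonoidal] (ι : F ⟶ G)
    [∀ x, Mono (ι.app x)] (e : 𝟙_ V ⟶ F.obj (𝟙_ C)) (he : e ≫ ι.app (𝟙_ C) = ε G)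
    (m : ∀ x y, F.obj x ⊗ F.obj y ⟶ F.obj (x ⊗ y))
    (hm : ∀ x y, m x y ≫ ι.app (x ⊗ y) = (ι.app x ⊗ₘ ι.app y) ≫ μ G x y) : F.LaxMonoidal :=
  Functor.LaxMonoidal.ofTensorHom
    (ε := e)
    (μ := m)
    (μ_natural := fun {x y x' y'} f g => by
      rw [← cancel_mono (ι.app (y ⊗ y')), Category.assoc, Category.assoc, hm, ι.naturality,
        reassoc_of% hm, ← μ_natural, tensorHom_comp_tensorHom_assoc, tensorHom_comp_tensorHom_assoc,
        ι.naturality, ι.naturality])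
    (associativity := fun x y z => by
      rw [← cancel_mono (ι.app (x ⊗ y ⊗ z))]
      simp only [Category.assoc]
      rw [ι.naturality, reassoc_of% hm, hm, tensorHom_comp_tensorHom_assoc,
        tensorHom_comp_tensorHom_assoc, hm, hm, Category.id_comp, Category.id_comp]
      have h := associativity G x y z
      rw [← tensorHom_id, ← id_tensorHom] at h
      have h₁ := congrArg (fun t => ((ι.app x ⊗ₘ ι.app y) ⊗ₘ ι.app z) ≫ t) h
      simp only [tensorHom_comp_tensorHom_assoc, Category.comp_id,
        associator_naturality_assoc] at h₁
      exact h₁)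
    (left_unitality := fun x => by
      rw [← cancel_mono (ι.app x)]
      simp only [Category.assoc]
      rw [ι.naturality, reassoc_of% hm, tensorHom_comp_tensorHom_assoc, he, Category.id_comp]
      have h := left_unitality G x
      rw [← leftUnitor_naturality, h, ← tensorHom_id, ← id_tensorHom,
        tensorHom_comp_tensorHom_assoc, Category.id_comp, Category.comp_id])
    (right_unitality := fun x => by
      rw [← cancel_mono (ι.app x)]
      simp only [Category.assoc]
      rw [ι.naturality, reassoc_of% hm, tensorHom_comp_tensorHom_assoc, he, Category.id_comp]
      have h := right_unitality G x
      rw [← rightUnitor_naturality, h, ← id_tensorHom, ← tensorHom_id,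
        tensorHom_comp_tensorHom_assoc, Category.id_comp, Category.comp_id])

noncomputable section

namespace FrobeniusFunctor

variable {V : Type u} [Category.{v} V] [MonoidalCategory V] [Preadditive V]
  [HasFiniteBiproducts V] (X : FrobeniusFunctor FiniteIntervalᵒᵖ V)

theorem splitting_len {n : FiniteInterval} (i : Fin (n.len - 1)) :
    ((⟨i + 1⟩ : FiniteInterval) ⊗ ⟨n.len - 1 - i⟩).len = n.len := by
  have := i.2
  change i + 1 + (n.len - 1 - i) = n.len
  omega

/-- The family of all nontrivial comultiplications. -/
def comulFamily (n : FiniteInterval) : X.functor.obj (op n) ⟶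
    ⨁ fun i : Fin (n.len - 1) =>
      X.functor.obj (op ⟨i + 1⟩) ⊗ X.functor.obj (op ⟨n.len - 1 - i⟩) :=
  biproduct.lift fun i => X.functor.map (isoOfEq (splitting_len i)).hom.op ≫
    δ X.functor (op ⟨i + 1⟩) (op ⟨n.len - 1 - i⟩)

/-- The nontrivial decompositions `k + l` of the length are those with `k = i + 1` and `i` below the
length minus one, so a single kernel computes the joint kernel. For lengths `0` and `1` the family
is empty. -/
theorem isPrimitive_iff {n : FiniteInterval} {W : V} (g : W ⟶ X.functor.obj (op n)) :
    X.IsPrimitive g ↔ g ≫ X.comulFamily n = 0 := by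
  constructor
  · intro hg
    refine biproduct.hom_ext _ _ fun i => ?_
    rw [Category.assoc, comulFamily, biproduct.lift_π, zero_comp]
    exact hg _ _ (Nat.succ_pos _) (by have := i.2; change 0 < n.len - 1 - i; omega) _
  · rintro hg ⟨k⟩ ⟨l⟩ hk hl h
    have hkl : k + l = n.len := h
    have hk' : 0 < k := hk
    have hl' : 0 < l := hl
    obtain ⟨k, rfl⟩ := Nat.exists_eq_succ_of_ne_zero hk'.ne'
    obtain rfl : l = n.len - 1 - k := by omega
    have := congrArg (· ≫ biproduct.π _ (⟨k, by omega⟩ : Fin (n.len - 1))) hg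
    dsimp only at this
    rw [Category.assoc, comulFamily, biproduct.lift_π, zero_comp] at this
    exact this

variable [HasKernels V]

/-- The object of primitives. -/
def primitives (n : FiniteInterval) : V := kernel (X.comulFamily n)

/-- The inclusion of the object of primitives. -/
def primitivesι (n : FiniteInterval) : X.primitives n ⟶ X.functor.obj (op n) :=
  kernel.ι (X.comulFamily n)

instance (n : FiniteInterval) : Mono (X.primitivesι n) :=
  inferInstanceAs (Mono (kernel.ι (X.comulFamily n)))

theorem isPrimitive_primitivesι (n : FiniteInterval) : X.IsPrimitive (X.primitivesι n) :=
  (X.isPrimitive_iff _).2 (kernel.condition _)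

variable {X} in
/-- The factorization of a primitive morphism through the object of primitives. -/
def IsPrimitive.lift {n : FiniteInterval} {W : V} {g : W ⟶ X.functor.obj (op n)}
    (hg : X.IsPrimitive g) : W ⟶ X.primitives n :=
  kernel.lift _ g ((X.isPrimitive_iff g).1 hg)

variable {X} in
theorem IsPrimitive.lift_ι {n : FiniteInterval} {W : V} {g : W ⟶ X.functor.obj (op n)}
    (hg : X.IsPrimitive g) : hg.lift ≫ X.primitivesι n = g :=
  kernel.lift_ι _ _ _

theorem isPrimitive_narrow_map {x y : AugmentedSimplexCategory} (f : x ⟶ y) :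
    X.IsPrimitive (X.primitivesι (narrow.obj y) ≫ X.functor.map (narrow.map f).op) :=
  (X.isPrimitive_primitivesι _).map _ fun _ h0 hi => narrow_val_interior f h0 hi

/-- The functor of primitives. -/
def kernelFunctor : AugmentedSimplexCategoryᵒᵖ ⥤ V where
  obj x := X.primitives (narrow.obj x.unop)
  map f := (X.isPrimitive_narrow_map f.unop).lift
  map_id x := by
    rw [← cancel_mono (X.primitivesι (narrow.obj x.unop)), IsPrimitive.lift_ι, unop_id,
      narrow.map_id, op_id, X.functor.map_id, Category.comp_id, Category.id_comp]
  map_comp {x y z} f g := by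
    rw [← cancel_mono (X.primitivesι (narrow.obj z.unop)), IsPrimitive.lift_ι, Category.assoc,
      IsPrimitive.lift_ι, ← Category.assoc, IsPrimitive.lift_ι, unop_comp, narrow.map_comp, op_comp,
      X.functor.map_comp, Category.assoc]

/-- The kernel cone given by the primitives. -/
def kernelCone : X.kernelFunctor ⟶ narrow.op ⋙ X.functor where
  app x := X.primitivesι (narrow.obj x.unop)
  naturality _ _ f := (X.isPrimitive_narrow_map f.unop).lift_ι

instance (x : AugmentedSimplexCategoryᵒᵖ) : Mono (X.kernelCone.app x) :=
  inferInstanceAs (Mono (X.primitivesι (narrow.obj x.unop)))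

theorem isKernelCone_kernelCone : X.IsKernelCone X.kernelCone where
  primitive _ := X.isPrimitive_primitivesι _
  existsUnique_lift _ _ _ hg := ⟨hg.lift, hg.lift_ι, fun _ h =>
    (cancel_mono (X.primitivesι _)).1 (h.trans hg.lift_ι.symm)⟩

variable [MonoidalPreadditive V]

/-- The unit lands in the value at `[1]`, where every morphism is primitive, and products of
primitives are primitive after the inner face. The axioms are inherited along the monic inclusions.
-/
instance : X.kernelFunctor.LaxMonoidal :=
  laxMonoidalOfMono X.kernelCone
    (X.isPrimitive_of_len_le_one (n := narrow.obj (𝟙_ AugmentedSimplexCategory)) le_rfl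
      (ε (narrow.op ⋙ X.functor))).lift
    (IsPrimitive.lift_ι _)
    (fun x y => ((X.isPrimitive_primitivesι _).mul (x := x.unop) (y := y.unop)
      (X.isPrimitive_primitivesι _)).lift)
    (fun _ _ => (IsPrimitive.lift_ι _).trans (Category.assoc _ _ _))

instance : NatTrans.IsMonoidal X.kernelCone where
  unit := IsPrimitive.lift_ι _
  tensor _ _ := (IsPrimitive.lift_ι _).trans (Category.assoc _ _ _)

end FrobeniusFunctor

end

/-! ### The equivalence -/

open FiniteInterval Functor.LaxMonoidal Functor.OplaxMonoidal

noncomputable section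

namespace FrobeniusFunctor

section

variable {V : Type u} [Category.{v} V] [MonoidalCategory V] [Preadditive V]
  [HasFiniteBiproducts V] [HasKernels V]
  {X Y : FrobeniusFunctor FiniteIntervalᵒᵖ V}
  {F : AugmentedSimplexCategoryᵒᵖ ⥤ V}

/-- The factorization of a cone of primitive morphisms through the functor of primitives. -/
def kernelLift (ι : F ⟶ narrow.op ⋙ X.functor)
    (hι : ∀ n, X.IsPrimitive (n := narrow.obj n) (ι.app (op n))) : F ⟶ X.kernelFunctor where
  app x := (hι x.unop).lift
  naturality x y f := by
    have key : ∀ {A B D E G H : V} {f : A ⟶ B} {l : B ⟶ D} {i : D ⟶ E} {l' : A ⟶ G} {k : G ⟶ D}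
        {i' : G ⟶ H} {n : H ⟶ E} {t : B ⟶ E} {t' : A ⟶ H}, l ≫ i = t → l' ≫ i' = t' →
        k ≫ i = i' ≫ n → f ≫ t = t' ≫ n → (f ≫ l) ≫ i = (l' ≫ k) ≫ i := by
      rintro A B D E G H f l i l' k i' n t t' rfl rfl h h'
      rw [Category.assoc, h', Category.assoc, Category.assoc, h]
    exact (cancel_mono (X.kernelCone.app y)).1 (key (hι y.unop).lift_ι (hι x.unop).lift_ι
      (X.kernelCone.naturality f) (ι.naturality f))

theorem kernelLift_app_cone (ι : F ⟶ narrow.op ⋙ X.functor)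
    (hι : ∀ n, X.IsPrimitive (n := narrow.obj n) (ι.app (op n)))
    (x : AugmentedSimplexCategoryᵒᵖ) :
    (kernelLift ι hι).app x ≫ X.kernelCone.app x = ι.app x :=
  (hι x.unop).lift_ι

/-- Two kernel cones have the same universal property, so they agree up to a unique isomorphism. -/
theorem isIso_kernelLift_app {ι : F ⟶ narrow.op ⋙ X.functor} (hι : X.IsKernelCone ι)
    (x : AugmentedSimplexCategoryᵒᵖ) : IsIso ((kernelLift ι hι.primitive).app x) := by
  obtain ⟨g, hg, -⟩ := hι.existsUnique_lift x.unop _ _ (X.isPrimitive_primitivesι _)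
  have hg' : g ≫ ι.app x = X.kernelCone.app x := hg
  refine ⟨g, ?_, ?_⟩
  · refine (hι.existsUnique_lift x.unop _ _ (hι.primitive x.unop)).unique ?_ (Category.id_comp _)
    exact (Category.assoc _ _ _).trans ((congrArg (_ ≫ ·) hg').trans (kernelLift_app_cone _ _ x))
  · refine (cancel_mono (X.kernelCone.app x)).1 ((Category.assoc _ _ _).trans
      (((congrArg (g ≫ ·) (kernelLift_app_cone ι hι.primitive x)).trans hg').trans
        (Category.id_comp _).symm))

/-- The image of the kernel cone under a bimonoidal natural transformation. -/
def kernelConeMap (α : X ⟶ Y) : X.kernelFunctor ⟶ narrow.op ⋙ Y.functor :=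
  X.kernelCone ≫ Functor.whiskerLeft narrow.op α.natTrans

theorem isPrimitive_kernelConeMap (α : X ⟶ Y) (n : AugmentedSimplexCategory) :
    Y.IsPrimitive (n := narrow.obj n) ((kernelConeMap α).app (op n)) :=
  (X.isPrimitive_primitivesι _).hom α

variable [MonoidalPreadditive V]

instance [F.LaxMonoidal] (ι : F ⟶ narrow.op ⋙ X.functor) [NatTrans.IsMonoidal ι]
    (hι : ∀ n, X.IsPrimitive (n := narrow.obj n) (ι.app (op n))) :
    NatTrans.IsMonoidal (kernelLift ι hι) where
  unit := by
    rw [← cancel_mono (X.kernelCone.app _), Category.assoc, kernelLift_app_cone,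
      NatTrans.IsMonoidal.unit, NatTrans.IsMonoidal.unit]
  tensor x y := by
    rw [← cancel_mono (X.kernelCone.app _), Category.assoc, kernelLift_app_cone,
      NatTrans.IsMonoidal.tensor, Category.assoc, NatTrans.IsMonoidal.tensor,
      tensorHom_comp_tensorHom_assoc, kernelLift_app_cone, kernelLift_app_cone]

instance (α : X ⟶ Y) : NatTrans.IsMonoidal α.natTrans where
  unit := α.lax_unit
  tensor := α.lax_tensor

instance (α : X ⟶ Y) : NatTrans.IsMonoidal (kernelConeMap α) :=
  inferInstanceAs (NatTrans.IsMonoidal (X.kernelCone ≫ Functor.whiskerLeft narrow.op α.natTrans))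

end

section

variable {V : Type u} [Category.{v} V] [MonoidalCategory V]
  [HasColimits V] [∀ X : V, PreservesColimits (tensorLeft X)]
  [∀ X : V, PreservesColimits (tensorRight X)] [Preadditive V] [HasKernels V]
  [HasFiniteBiproducts V] [MonoidalPreadditive V] {X Y : FrobeniusFunctor FiniteIntervalᵒᵖ V}

theorem hom_ext_kernelFunctor {F : AugmentedSimplexCategoryᵒᵖ ⥤ V} [F.LaxMonoidal]
    {f g : DayMonoid.ofLax F ⟶ DayMonoid.ofLax X.kernelFunctor}
    (h : ∀ x, f.hom.natTrans.app x ≫ X.kernelCone.app x =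
      g.hom.natTrans.app x ≫ X.kernelCone.app x) : f = g :=
  DayMonoid.hom_ext fun x => (cancel_mono (X.kernelCone.app x)).1 (h x)

/-- The morphism on kernel monoids induced by a bimonoidal natural transformation. -/
def kernelMonoidMap (α : X ⟶ Y) :
    DayMonoid.ofLax X.kernelFunctor ⟶ DayMonoid.ofLax Y.kernelFunctor :=
  DayMonoid.homOfLax (kernelLift (kernelConeMap α) (isPrimitive_kernelConeMap α))

theorem kernelMonoidMap_app_cone (α : X ⟶ Y) (x : AugmentedSimplexCategoryᵒᵖ) :
    (kernelMonoidMap α).hom.natTrans.app x ≫ Y.kernelCone.app x =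
      X.kernelCone.app x ≫ α.natTrans.app (narrow.op.obj x) :=
  kernelLift_app_cone (kernelConeMap α) (isPrimitive_kernelConeMap α) x

variable (V) in
/-- The functor that sends a Frobenius monoidal functor to its kernel monoid. -/
def kernelMonoid : FrobeniusFunctor FiniteIntervalᵒᵖ V ⥤ Mon (AugSimplicialObject V) where
  obj X := DayMonoid.ofLax X.kernelFunctor
  map α := kernelMonoidMap α
  map_id X := hom_ext_kernelFunctor fun x =>
    (kernelMonoidMap_app_cone (𝟙 X) x).trans ((Category.comp_id _).trans (Category.id_comp _).symm)
  map_comp {X Y Z} α β := hom_ext_kernelFunctor fun x => by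
    have key : ∀ {A B C D E F : V} {a : A ⟶ B} {b : B ⟶ C} {c : C ⟶ F} {d : A ⟶ D} {e : D ⟶ E}
        {f : E ⟶ F} {g : B ⟶ E}, a ≫ g = d ≫ e → b ≫ c = g ≫ f →
        d ≫ e ≫ f = (a ≫ b) ≫ c := by
      intro A B C D E F a b c d e f g h₁ h₂
      rw [Category.assoc, h₂, reassoc_of% h₁]
    exact (kernelMonoidMap_app_cone (α ≫ β) x).trans
      (key (kernelMonoidMap_app_cone α x) (kernelMonoidMap_app_cone β x))

theorem isKernelMonoid_kernelMonoid (X : FrobeniusFunctor FiniteIntervalᵒᵖ V) :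
    IsKernelMonoid X ((kernelMonoid V).obj X) fun n => X.kernelCone.app (op n) where
  comul_zero n := X.isKernelCone_kernelCone.primitive n
  existsUnique_lift n := X.isKernelCone_kernelCone.existsUnique_lift n
  naturality f := X.kernelCone.naturality f.op
  mul m n := (Category.assoc _ _ _).symm.trans ((congrArg (· ≫ X.kernelCone.app (op m ⊗ op n))
    (DayMonoid.mulApp_ofLax X.kernelFunctor (op m) (op n))).trans
      (NatTrans.IsMonoidal.tensor (op m) (op n)))
  one := (Category.assoc _ _ _).symm.trans ((congrArg (· ≫ X.kernelCone.app (𝟙_ _))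
    (DayMonoid.oneApp_ofLax X.kernelFunctor)).trans NatTrans.IsMonoidal.unit)

instance : (kernelMonoid V).Faithful where
  map_injective {X Y α α'} h := hom_ext_of_isKernelCone X.isKernelCone_kernelCone fun x =>
    (kernelMonoidMap_app_cone α x).symm.trans
      ((congrArg (fun t => t.hom.natTrans.app x ≫ Y.kernelCone.app x) h).trans
        (kernelMonoidMap_app_cone α' x))

/-- Followed by the kernel cone of `Y`, a morphism of kernel monoids becomes a monoidal cone of
primitives on the kernel of `X`, and this extends to `X`. -/
instance : (kernelMonoid V).Full where
  map_surjective {X Y} β := by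
    let b : X.kernelFunctor ⟶ Y.kernelFunctor := β.hom.natTrans
    have : NatTrans.IsMonoidal b := DayMonoid.isMonoidal_natTrans β
    obtain ⟨α, hα⟩ := exists_hom_of_isKernelCone X.isKernelCone_kernelCone (b ≫ Y.kernelCone)
      fun n => (Y.isPrimitive_primitivesι (narrow.obj n)).comp (b.app (op n))
    exact ⟨α, hom_ext_kernelFunctor fun x => (kernelMonoidMap_app_cone α x).trans (hα x)⟩

/-- The preimage of `M` is the sum over subdivisions built from its lax functor. The trivial
subdivisions form a monoidal kernel cone there, so they identify `M` with the kernel monoid. -/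
instance : (kernelMonoid V).EssSurj where
  mem_essImage M := by
    let F := M.X.functor
    let : F.LaxMonoidal := DayMonoid.laxMonoidal M
    let f := kernelLift (frobCone F) (isKernelCone_frobCone F).primitive
    let e : F ≅ (frobObject F).kernelFunctor := NatIso.ofComponents
      (fun x => @asIso _ _ _ _ (f.app x) (isIso_kernelLift_app (isKernelCone_frobCone F) x))
      fun g => f.naturality g
    refine ⟨frobObject F, ⟨(DayMonoid.isoMk e (fun x y => ?_) ?_).symm⟩⟩
    · refine Eq.trans ?_ (congrArg (_ ≫ ·) (DayMonoid.mulApp_ofLax (frobObject F).kernelFunctor x y).symm)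
      exact NatTrans.IsMonoidal.tensor (τ := f) x y
    · refine Eq.trans ?_ (DayMonoid.oneApp_ofLax (frobObject F).kernelFunctor).symm
      exact NatTrans.IsMonoidal.unit (τ := f)

instance : (kernelMonoid V).IsEquivalence where

end

end FrobeniusFunctor

end

/-- Tensoring with an object preserves binary coproducts, hence binary biproducts, hence sums of
morphisms, since these are defined through biproducts. -/
theorem monoidalPreadditive_of_preservesColimits (V : Type u) [Category.{v} V] [MonoidalCategory V]
    [Preadditive V] [HasFiniteBiproducts V] [∀ X : V, PreservesColimits (tensorLeft X)]
    [∀ X : V, PreservesColimits (tensorRight X)] : MonoidalPreadditive V := by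
  have := hasBinaryBiproducts_of_finite_biproducts V
  have hl : ∀ X : V, (tensorLeft X).Additive := fun X =>
    have := preservesSmallestColimits_of_preservesColimits (tensorLeft X)
    have := preservesBinaryBiproducts_of_preservesBinaryCoproducts (tensorLeft X)
    Functor.additive_of_preservesBinaryBiproducts _
  have hr : ∀ X : V, (tensorRight X).Additive := fun X =>
    have := preservesSmallestColimits_of_preservesColimits (tensorRight X)
    have := preservesBinaryBiproducts_of_preservesBinaryCoproducts (tensorRight X)
    Functor.additive_of_preservesBinaryBiproducts _
  exact
    { whiskerLeft_zero := fun {X _ _} => (tensorLeft X).map_zero _ _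
      zero_whiskerRight := fun {X _ _} => (tensorRight X).map_zero _ _
      whiskerLeft_add := fun {X _ _} _ _ => (tensorLeft X).map_add
      add_whiskerRight := fun {X _ _} _ _ => (tensorRight X).map_add }

theorem mainTheorem5 {V : Type u} [Category.{v} V] [MonoidalCategory V]
    [HasColimits V] [∀ X : V, PreservesColimits (tensorLeft X)]
    [∀ X : V, PreservesColimits (tensorRight X)]
    [Preadditive V] [HasKernels V] :
    ∃ (e : FrobeniusFunctor FiniteIntervalᵒᵖ V ≌ Mon (AugSimplicialObject V))
      (ι : ∀ (X : FrobeniusFunctor FiniteIntervalᵒᵖ V) (n : AugmentedSimplexCategory),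
        (e.functor.obj X).X.functor.obj (op n) ⟶
          X.functor.obj (op (FiniteInterval.narrow.obj n))),
      (∀ X, IsKernelMonoid X (e.functor.obj X) (ι X)) ∧
      ∀ {X Y : FrobeniusFunctor FiniteIntervalᵒᵖ V} (α : X ⟶ Y) (n : AugmentedSimplexCategory),
        (e.functor.map α).hom.natTrans.app (op n) ≫ ι Y n =
          ι X n ≫ α.natTrans.app (op (FiniteInterval.narrow.obj n)) := by
  have : HasColimitsOfSize.{0, 0} V := hasSmallestColimitsOfHasColimits V
  have : HasFiniteBiproducts V := HasFiniteBiproducts.of_hasFiniteCoproducts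
  have : MonoidalPreadditive V := monoidalPreadditive_of_preservesColimits V
  -- The kernel functor is faithful, full and essentially surjective; the resulting equivalence
  -- includes a triangle identity and so is adjoint.
  exact ⟨(FrobeniusFunctor.kernelMonoid V).asEquivalence, fun X n => X.kernelCone.app (op n),
    FrobeniusFunctor.isKernelMonoid_kernelMonoid,
    fun α n => FrobeniusFunctor.kernelMonoidMap_app_cone α (op n)⟩
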